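/- Let $a<0<b$. For real coefficients $e=(e_1,\dots,e_9)$ and small real $\varepsilon$ consider the planar system $$\dot x=y,\qquad \dot y=-x+\frac{3\sqrt b}{2a}x^2-\frac{b}{2a^2}x^3+\varepsilon Q_2(x,y),$$ $$Q_2(x,y)=(e_3+e_7x+e_2x^2+e_8x^3+e_1x^4+e_9x^5+e_5x^6+e_4y^2+e_6y^4)\,y .$$ For every $\varepsilon$ the point $q_1=(a/\sqrt b,0)$ is an equilibrium. For $\varepsilon=0$ the system is Hamiltonian with $$H_2(x,y)=\frac{x^2}{2}-\frac{\sqrt b}{2a}x^3+\frac{b}{8a^2}x^4+\frac{y^2}{2},$$ $q_1$ is a saddle, and the level set $L=\{H_2=a^2/(8b)\}=L_l\cup L_r$ is a double homoclinic loop, $L_l$ and $L_r$ being the parts with $x\le a/\sqrt b$ and $x\ge a/\sqrt b$. A homoclinic loop of the system is the union of $\{q_1\}$ and a non-constant orbit tending to $q_1$ as $t\to\pm\infty$; it is $\delta$-close to a set $S$ if it lies in the open $\delta$-neighbourhood of $S$ and $S$ lies in its open $\delta$-neighbourhood (here $\mathbb R^2$ carries the maximum norm). (i) The first order Melnikov integral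 along the upper half of $L_r$, $M_2=\int_{a/\sqrt b}^{a(1-\sqrt2)/\sqrt b}Q_2(x,y(x))\,dx$, where $y(x)\ge 0$ and $H_2(x,y(x))=a^2/(8b)$, equals $$\begin{aligned}M_2=\frac{a^2}{110880\,b^4}\Big(&32\sqrt2\big(1155b^3e_3+99a^2b^2(21e_2+2e_4)+32263a^6e_5+5a^4b(1551e_1+8e_6)\\&\quad+1155ab^{5/2}e_7+3927a^3b^{3/2}e_8+15675a^5\sqrt b\,e_9\big)\\&-3465a\big(32a^3be_1+8ab^2e_2+134a^5e_5+4b^{5/2}e_7+16a^2b^{3/2}e_8+65a^4\sqrt b\,e_9\big)\pi\Big).\end{aligned}$$ (ii) Put $e'=(e_1,e_3,e_4,e_5,e_6,e_7,e_8,e_9)$ and $$\begin{aligned}\phi_1^0(e')=\frac{1}{5544a^2b^2(12\sqrt2-5\pi)}\Big(&-32\sqrt2\big(1155b^3e_3+198a^2b^2e_4+32263a^6e_5+5a^4b(1551e_1+8e_6)\\&\quad+1155ab^{5/2}e_7+3927a^3b^{3/2}e_8+15675a^5\sqrt b\,e_9\big)\\&+3465a\big(32a^3be_1+134a^5e_5+4b^{5/2}e_7+16a^2b^{3/2}e_8+65a^4\sqrt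 b\,e_9\big)\pi\Big).\end{aligned}$$ There are a function $\phi_1(e',\varepsilon)$ and $\delta_0>0$ such that for every $R>0$: - $\phi_1(e',\varepsilon)=\phi_1^0(e')+O(\varepsilon)$ as $\varepsilon\to0$, uniformly for $|e_i|\le R$; - for every $0<\delta\le\delta_0$ there is $\varepsilon_0>0$ such that for all $0<|\varepsilon|<\varepsilon_0$ and all $e$ with $|e_i|\le R$ ($i=1,\dots,9$), the system has a homoclinic loop $\delta$-close to $L_r$ if and only if $e_2=\phi_1(e',\varepsilon)$. If moreover $e$ arises from an oscillator $\dot x=y$, $\dot y=-ax-2bx^3+\varepsilon(c_3+c_2x^2+c_1x^4+c_4y^2+c_5x^6+c_6y^4)y$ by moving its equilibrium $(\sqrt{-a/(2b)},0)$ to the origin and rescaling $x$ and $t$ by $\sqrt{-2a}$, i.e. if $$\begin{gathered}e_1=\tfrac{2c_1b-15ac_5}{8\sqrt2(-a)^{5/2}b},\quad e_2=\tfrac{15a^2c_5-12ac_1b+4c_2b^2}{8\sqrt2(-a)^{3/2}b^2},\quad e_3=-\tfrac{a^3c_5-2a^2c_1b+4ac_2b^2-8c_3b^3}{8\sqrt2\sqrt{-a}\,b^3},\\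 e_4=\tfrac{c_4}{\sqrt{-2a}},\quad e_5=\tfrac{c_5}{8\sqrt2(-a)^{7/2}},\quad e_6=\tfrac{c_6}{\sqrt{-2a}},\quad e_7=\tfrac{3a^2c_5-4ac_1b+4c_2b^2}{4\sqrt2\sqrt{-a}\,b^{5/2}},\\ e_8=-\tfrac{5ac_5-2c_1b}{2\sqrt2(-a)^{3/2}b^{3/2}},\quad e_9=\tfrac{3c_5}{4\sqrt2(-a)^{5/2}\sqrt b}\end{gathered}$$ for some real $c_1,\dots,c_6$, then $e_2=\phi_1(e',\varepsilon)$ is also equivalent to the existence of two homoclinic loops, one $\delta$-close to $L_l$ and one $\delta$-close to $L_r$ (that is, to the persistence of the double loop $L$). -/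

import Mathlib

open Set Filter Topology

noncomputable section

namespace RayleighLienard

/-- The coefficients `e₁, e₃, …, e₉` of the perturbation (all but `e₂`). -/
structure OtherCoeffs where
  e1 : ℝ
  e3 : ℝ
  e4 : ℝ
  e5 : ℝ
  e6 : ℝ
  e7 : ℝ
  e8 : ℝ
  e9 : ℝ

/-- The coefficients `e₁, …, e₉` of the perturbation. -/
structure Coeffs extends OtherCoeffs where
  e2 : ℝ

/-- All the coefficients `e₁, e₃, …, e₉` lie in `[-R, R]`. -/
def OtherCoeffs.BoundedBy (e : OtherCoeffs) (R : ℝ) : Prop :=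
  |e.e1| ≤ R ∧ |e.e3| ≤ R ∧ |e.e4| ≤ R ∧ |e.e5| ≤ R ∧
    |e.e6| ≤ R ∧ |e.e7| ≤ R ∧ |e.e8| ≤ R ∧ |e.e9| ≤ R

/-- All the coefficients `e₁, …, e₉` lie in `[-R, R]`. -/
def Coeffs.BoundedBy (e : Coeffs) (R : ℝ) : Prop :=
  e.toOtherCoeffs.BoundedBy R ∧ |e.e2| ≤ R

/-- The coefficients `e₁, …, e₉` that arise when the oscillator
`ẋ = y`, `ẏ = -a x - 2 b x³ + ε (c₃ + c₂ x² + c₁ x⁴ + c₄ y² + c₅ x⁶ + c₆ y⁴) y`, with `a < 0 < b`,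
is translated to its right center and rescaled. -/
def canonicalCoeffs (a b c1 c2 c3 c4 c5 c6 : ℝ) : Coeffs where
  e1 := (2 * c1 * b - 15 * a * c5) / (8 * √2 * √(-a) ^ 5 * b)
  e2 := (15 * a ^ 2 * c5 - 12 * a * c1 * b + 4 * c2 * b ^ 2) / (8 * √2 * √(-a) ^ 3 * b ^ 2)
  e3 := -(a ^ 3 * c5 - 2 * a ^ 2 * c1 * b + 4 * a * c2 * b ^ 2 - 8 * c3 * b ^ 3) /
    (8 * √2 * √(-a) * b ^ 3)
  e4 := c4 / √(-2 * a)
  e5 := c5 / (8 * √2 * √(-a) ^ 7)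
  e6 := c6 / √(-2 * a)
  e7 := (3 * a ^ 2 * c5 - 4 * a * c1 * b + 4 * c2 * b ^ 2) / (4 * √2 * √(-a) * √b ^ 5)
  e8 := -(5 * a * c5 - 2 * c1 * b) / (2 * √2 * √(-a) ^ 3 * √b ^ 3)
  e9 := 3 * c5 / (4 * √2 * √(-a) ^ 5 * √b)

/-- The perturbation term `Q₂(x, y)`. -/
def Q2 (e : Coeffs) (x y : ℝ) : ℝ :=
  (e.e3 + e.e7 * x + e.e2 * x ^ 2 + e.e8 * x ^ 3 + e.e1 * x ^ 4 + e.e9 * x ^ 5 + e.e5 * x ^ 6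
    + e.e4 * y ^ 2 + e.e6 * y ^ 4) * y

/-- The vector field of the canonical form. -/
def field (a b : ℝ) (e : Coeffs) (ε : ℝ) (p : ℝ × ℝ) : ℝ × ℝ :=
  (p.2,
    -p.1 + 3 * √b / (2 * a) * p.1 ^ 2 - b / (2 * a ^ 2) * p.1 ^ 3 + ε * Q2 e p.1 p.2)

/-- The Hamiltonian of the unperturbed system. -/
def H2 (a b : ℝ) (p : ℝ × ℝ) : ℝ :=
  p.1 ^ 2 / 2 - √b / (2 * a) * p.1 ^ 3 + b / (8 * a ^ 2) * p.1 ^ 4 + p.2 ^ 2 / 2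

/-- The saddle equilibrium `q₁`. -/
def q1 (a b : ℝ) : ℝ × ℝ := (a / √b, 0)

/-- The right unperturbed homoclinic loop (saddle included): the part to the right of the saddle
of the level set of `H2` through the saddle. -/
def rightLoop (a b : ℝ) : Set (ℝ × ℝ) :=
  {p | H2 a b p = a ^ 2 / (8 * b) ∧ a / √b ≤ p.1}

/-- The left unperturbed homoclinic loop (saddle included). -/
def leftLoop (a b : ℝ) : Set (ℝ × ℝ) :=
  {p | H2 a b p = a ^ 2 / (8 * b) ∧ p.1 ≤ a / √b}

/-- `γ` is a homoclinic orbit, at the equilibrium `q₁`, of the canonical form. -/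
def IsHomoclinicOrbit (a b : ℝ) (e : Coeffs) (ε : ℝ) (γ : ℝ → ℝ × ℝ) : Prop :=
  (∀ t, HasDerivAt γ (field a b e ε (γ t)) t) ∧ (∀ t, γ t ≠ q1 a b) ∧
    Tendsto γ atBot (𝓝 (q1 a b)) ∧ Tendsto γ atTop (𝓝 (q1 a b))

/-- Two sets are `δ`-close: each lies in the open `δ`-neighbourhood of the other. -/
def CloseSets (δ : ℝ) (S T : Set (ℝ × ℝ)) : Prop :=
  S ⊆ Metric.thickening δ T ∧ T ⊆ Metric.thickening δ S

/-- The canonical form has a homoclinic loop (a homoclinic orbit together with the saddle `q₁`)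
that is `δ`-close to the set `L`. -/
def HasHomoclinicLoopNear (a b : ℝ) (e : Coeffs) (ε δ : ℝ) (L : Set (ℝ × ℝ)) : Prop :=
  ∃ γ : ℝ → ℝ × ℝ, IsHomoclinicOrbit a b e ε γ ∧ CloseSets δ (insert (q1 a b) (range γ)) L

/-- The upper half `y = y(x) ≥ 0` of the right unperturbed loop,
for `a / √b ≤ x ≤ a (1 - √2) / √b`. -/
def upperArc (a b x : ℝ) : ℝ := √(2 * (a ^ 2 / (8 * b) - H2 a b (x, 0)))

/-- The first order Melnikov integral `∫ Q₂(x, y) dx` along the upper half of the right loop. -/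
def melnikov (a b : ℝ) (e : Coeffs) : ℝ :=
  ∫ x in (a / √b)..(a * (1 - √2) / √b), Q2 e x (upperArc a b x)

/-- The closed form of the Melnikov integral. -/
def melnikovClosedForm (a b : ℝ) (e : Coeffs) : ℝ :=
  a ^ 2 / (110880 * b ^ 4) *
    (32 * √2 * (1155 * b ^ 3 * e.e3 + 99 * a ^ 2 * b ^ 2 * (21 * e.e2 + 2 * e.e4)
        + 32263 * a ^ 6 * e.e5 + 5 * a ^ 4 * b * (1551 * e.e1 + 8 * e.e6)
        + 1155 * a * √b ^ 5 * e.e7 + 3927 * a ^ 3 * √b ^ 3 * e.e8 + 15675 * a ^ 5 * √b * e.e9)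
      - 3465 * a * (32 * a ^ 3 * b * e.e1 + 8 * a * b ^ 2 * e.e2 + 134 * a ^ 5 * e.e5
        + 4 * √b ^ 5 * e.e7 + 16 * a ^ 2 * √b ^ 3 * e.e8 + 65 * a ^ 4 * √b * e.e9) * Real.pi)

/-- The leading term (`ε = 0`) of the function `φ₁`. -/
def phiLead (a b : ℝ) (e : OtherCoeffs) : ℝ :=
  1 / (5544 * a ^ 2 * b ^ 2 * (12 * √2 - 5 * Real.pi)) *
    (-32 * √2 * (1155 * b ^ 3 * e.e3 + 198 * a ^ 2 * b ^ 2 * e.e4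
        + 32263 * a ^ 6 * e.e5 + 5 * a ^ 4 * b * (1551 * e.e1 + 8 * e.e6)
        + 1155 * a * √b ^ 5 * e.e7 + 3927 * a ^ 3 * √b ^ 3 * e.e8 + 15675 * a ^ 5 * √b * e.e9)
      + 3465 * a * (32 * a ^ 3 * b * e.e1 + 134 * a ^ 5 * e.e5
        + 4 * √b ^ 5 * e.e7 + 16 * a ^ 2 * √b ^ 3 * e.e8 + 65 * a ^ 4 * √b * e.e9) * Real.pi)

end RayleighLienard

end

noncomputable section

namespace RayleighLienard

/-! In the coordinates w = 1 - x√b/a, v = -y√b/a the system reads w' = v, v' = w(1 - w²)/2 + P(w,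
v²)v with P = ε·`rescaledPert`. The saddle is the origin and the right loop is w⁴/2 - w² + 2v² = 0,
w ≥ 0.

No invariant manifold theorem is used. The saddle is blown up by k = w²/2 + 2(v/w)² - 1 and σ =
w/√(2(1 + k)): the upper half of the unperturbed loop is k = 0, 0 ≤ σ ≤ 1, with the saddle at σ = 0
and the axis v = 0 at σ = 1. Orbits with v > 0 satisfy σ dk/dσ = -2k + `branchRate` k β, β =
`slopePert`, that is (σ²k)' = σ·`branchRate`. The solution that stays small at σ = 0 is the unstable
branch, obtained as the fixed point of a contraction (`exists_isBranch`). Time reversal replaces P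
by -P and gives the stable branch. The difference of their values k(1) is `splitting`.

A loop near the right one exists exactly when `splitting` vanishes (`hasHomoclinicLoopNear_iff`). If
the branches meet, gluing them and integrating a time change produces the orbit
(`exists_homoclinic`). Conversely, a weighted distance to the branch decreases along an orbit
(`antitoneOn_sq_sub_branch`), so a homoclinic orbit lies on the unstable branch up to its first zero
of v, and a comparison in the lower half plane shows that it cannot come back unless the ends agree
(`branch_end_eq`).

The end k(1) is linear in P up to a quadratic error (`IsBranch.abs_sub_sub_firstOrder_le`), and the
linear term is a multiple of the Melnikov integral (`firstOrder_rescaledPert`). That integral is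
affine in e₂ with root `phiLead` and a slope containing the factor 12√2 - 5π > 0. Hence `splitting`,
for small ε ≠ 0, has a unique zero in e₂ near `phiLead` (`exists_phi_estimates`). For coefficients
coming from the oscillator, P is even in w, and the point reflection at the saddle carries the right
loop to the left one. -/

/-! ### Small perturbations and estimates for the branch equation. -/

/-- On the box `-1 ≤ w ≤ 2`, `0 ≤ Z ≤ 1` the function `P` is bounded by `η` and
`η`-Lipschitz. -/
structure SmallOnBox (η : ℝ) (P : ℝ → ℝ → ℝ) : Prop where
  cont : Continuous fun p : ℝ × ℝ => P p.1 p.2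
  bound : ∀ w ∈ Icc (-1 : ℝ) 2, ∀ Z ∈ Icc (0 : ℝ) 1, |P w Z| ≤ η
  lip : ∀ w ∈ Icc (-1 : ℝ) 2, ∀ Z ∈ Icc (0 : ℝ) 1, ∀ w' ∈ Icc (-1 : ℝ) 2, ∀ Z' ∈ Icc (0 : ℝ) 1,
    |P w Z - P w' Z'| ≤ η * (|w - w'| + |Z - Z'|)

/-- The quantity `2 P v / w` at the point with `w = √(2 (1 + k)) σ`,
`v = (1 + k) σ √(1 - σ²)`. -/
def slopePert (P : ℝ → ℝ → ℝ) (σ k : ℝ) : ℝ :=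
  √2 * √(1 + k) * P (√2 * √(1 + k) * σ) ((1 + k) ^ 2 * σ ^ 2 * (1 - σ ^ 2)) * √(1 - σ ^ 2)

/-- The nonlinear part of the equation `σ dk/dσ = -2 k + branchRate k β`. -/
def branchRate (k β : ℝ) : ℝ := 2 * (k ^ 2 + β) / (1 + 2 * k - β)

lemma SmallOnBox.nonneg {η : ℝ} {P : ℝ → ℝ → ℝ} (h : SmallOnBox η P) : 0 ≤ η :=
  (abs_nonneg _).trans (h.bound 0 (by norm_num) 0 (by norm_num))

lemma SmallOnBox.mono {η η' : ℝ} {P : ℝ → ℝ → ℝ} (h : SmallOnBox η P) (hη : η ≤ η') :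
    SmallOnBox η' P where
  cont := h.cont
  bound w hw Z hZ := (h.bound w hw Z hZ).trans hη
  lip w hw Z hZ w' hw' Z' hZ' := (h.lip w hw Z hZ w' hw' Z' hZ').trans (by gcongr)

lemma SmallOnBox.add {η η' : ℝ} {P Q : ℝ → ℝ → ℝ} (h : SmallOnBox η P) (h' : SmallOnBox η' Q) :
    SmallOnBox (η + η') fun w Z => P w Z + Q w Z where
  cont := h.cont.add h'.cont
  bound w hw Z hZ := (abs_add_le _ _).trans (add_le_add (h.bound w hw Z hZ) (h'.bound w hw Z hZ))
  lip w hw Z hZ w' hw' Z' hZ' := by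
    have e : P w Z + Q w Z - (P w' Z' + Q w' Z') = (P w Z - P w' Z') + (Q w Z - Q w' Z') := by ring
    rw [e, add_mul]
    exact (abs_add_le _ _).trans
      (add_le_add (h.lip w hw Z hZ w' hw' Z' hZ') (h'.lip w hw Z hZ w' hw' Z' hZ'))

lemma SmallOnBox.const_mul {η : ℝ} {P : ℝ → ℝ → ℝ} (h : SmallOnBox η P) (c : ℝ) :
    SmallOnBox (|c| * η) fun w Z => c * P w Z where
  cont := continuous_const.mul h.cont
  bound w hw Z hZ := by
    rw [abs_mul]; exact mul_le_mul_of_nonneg_left (h.bound w hw Z hZ) (abs_nonneg c)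
  lip w hw Z hZ w' hw' Z' hZ' := by
    rw [← mul_sub, abs_mul, mul_assoc]
    exact mul_le_mul_of_nonneg_left (h.lip w hw Z hZ w' hw' Z' hZ') (abs_nonneg c)

lemma SmallOnBox.neg {η : ℝ} {P : ℝ → ℝ → ℝ} (h : SmallOnBox η P) :
    SmallOnBox η fun w Z => -P w Z := by
  simpa using h.const_mul (-1)

lemma SmallOnBox.mul {η η' : ℝ} {P Q : ℝ → ℝ → ℝ} (h : SmallOnBox η P) (h' : SmallOnBox η' Q) :
    SmallOnBox (2 * η * η') fun w Z => P w Z * Q w Z where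
  cont := h.cont.mul h'.cont
  bound w hw Z hZ := by
    rw [abs_mul]
    have := mul_le_mul (h.bound w hw Z hZ) (h'.bound w hw Z hZ) (abs_nonneg _) h.nonneg
    nlinarith [mul_nonneg h.nonneg h'.nonneg]
  lip w hw Z hZ w' hw' Z' hZ' := by
    have e : P w Z * Q w Z - P w' Z' * Q w' Z'
        = (P w Z - P w' Z') * Q w Z + P w' Z' * (Q w Z - Q w' Z') := by ring
    rw [e]
    refine (abs_add_le _ _).trans ?_
    rw [abs_mul, abs_mul]
    have h1 := mul_le_mul (h.lip w hw Z hZ w' hw' Z' hZ') (h'.bound w hw Z hZ) (abs_nonneg _)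
      (mul_nonneg h.nonneg (by positivity))
    have h2 := mul_le_mul (h.bound w' hw' Z' hZ') (h'.lip w hw Z hZ w' hw' Z' hZ') (abs_nonneg _)
      h.nonneg
    linarith

/-- Guarantees that the bounds of `SmallOnBox` apply at every point described by σ and a small k. -/
lemma box_mem {σ k : ℝ} (hσ : σ ∈ Icc (0 : ℝ) 1) (hk : |k| ≤ 1 / 20) :
    √2 * √(1 + k) * σ ∈ Icc (-1 : ℝ) 2 ∧
      (1 + k) ^ 2 * σ ^ 2 * (1 - σ ^ 2) ∈ Icc (0 : ℝ) 1 := by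
  obtain ⟨h0, h1⟩ := hσ
  obtain ⟨k0, k1⟩ := abs_le.1 hk
  have hs : √2 * √(1 + k) ≤ 2 := by
    rw [← Real.sqrt_mul (by norm_num), Real.sqrt_le_left (by norm_num)]; linarith
  have hσ2 : σ ^ 2 ≤ 1 := by nlinarith
  have hk2 : (1 + k) ^ 2 ≤ 2 := by nlinarith
  have h4 : σ ^ 2 * (1 - σ ^ 2) ≤ 1 / 4 := by nlinarith [sq_nonneg (σ ^ 2 - 1 / 2)]
  have h5 : 0 ≤ σ ^ 2 * (1 - σ ^ 2) := mul_nonneg (sq_nonneg _) (by linarith)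
  refine ⟨⟨?_, ?_⟩, ?_, ?_⟩
  · have : 0 ≤ √2 * √(1 + k) * σ := by positivity
    linarith
  · have : √2 * √(1 + k) * σ ≤ √2 * √(1 + k) * 1 := by gcongr
    linarith
  · rw [mul_assoc]; positivity
  · rw [mul_assoc]; nlinarith

lemma sqrt_two_mul_sqrt_le {k : ℝ} (hk : |k| ≤ 1 / 20) : √2 * √(1 + k) ≤ 3 / 2 := by
  obtain ⟨k0, k1⟩ := abs_le.1 hk
  rw [← Real.sqrt_mul (by norm_num), Real.sqrt_le_left (by norm_num)]; linarith

lemma abs_sqrt_two_mul_sqrt_sub_le {k k' : ℝ} (hk : |k| ≤ 1 / 20) (hk' : |k'| ≤ 1 / 20) :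
    |√2 * √(1 + k) - √2 * √(1 + k')| ≤ |k - k'| := by
  obtain ⟨k0, k1⟩ := abs_le.1 hk
  obtain ⟨k0', k1'⟩ := abs_le.1 hk'
  rw [← Real.sqrt_mul (by norm_num), ← Real.sqrt_mul (by norm_num)]
  set x := √(2 * (1 + k)) with hx
  set y := √(2 * (1 + k')) with hy
  have hx1 : 1 ≤ x := Real.one_le_sqrt.2 (by linarith)
  have hy1 : 1 ≤ y := Real.one_le_sqrt.2 (by linarith)
  have hx2 : x ^ 2 = 2 * (1 + k) := Real.sq_sqrt (by linarith)
  have hy2 : y ^ 2 = 2 * (1 + k') := Real.sq_sqrt (by linarith)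
  have e : k - k' = (x - y) * ((x + y) / 2) := by nlinarith
  rw [e, abs_mul]
  exact le_mul_of_one_le_right (abs_nonneg _) (by rw [abs_of_pos (by linarith)]; linarith)

lemma abs_slopePert_le {η : ℝ} {P : ℝ → ℝ → ℝ} (h : SmallOnBox η P) {σ k : ℝ}
    (hσ : σ ∈ Icc (0 : ℝ) 1) (hk : |k| ≤ 1 / 20) : |slopePert P σ k| ≤ 2 * η := by
  obtain ⟨h1, h2⟩ := box_mem hσ hk
  have hP := h.bound _ h1 _ h2
  have hs := sqrt_two_mul_sqrt_le hk
  have hc : √(1 - σ ^ 2) ≤ 1 := by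
    exact Real.sqrt_le_iff.2 ⟨by norm_num, by nlinarith [sq_nonneg σ]⟩
  unfold slopePert
  rw [abs_mul, abs_mul, abs_of_nonneg (show 0 ≤ √2 * √(1 + k) by positivity),
    abs_of_nonneg (Real.sqrt_nonneg (1 - σ ^ 2))]
  have hη := h.nonneg
  calc _ ≤ 3 / 2 * η * 1 := by gcongr
    _ ≤ 2 * η := by linarith

lemma abs_slopePert_sub_le {η : ℝ} {P : ℝ → ℝ → ℝ} (h : SmallOnBox η P) {σ k k' : ℝ}
    (hσ : σ ∈ Icc (0 : ℝ) 1) (hk : |k| ≤ 1 / 20) (hk' : |k'| ≤ 1 / 20) :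
    |slopePert P σ k - slopePert P σ k'| ≤ 4 * η * |k - k'| := by
  obtain ⟨h1, h2⟩ := box_mem hσ hk
  obtain ⟨h1', h2'⟩ := box_mem hσ hk'
  have hP := h.bound _ h1 _ h2
  have hL := h.lip _ h1 _ h2 _ h1' _ h2'
  have hs := sqrt_two_mul_sqrt_le hk'
  have hd := abs_sqrt_two_mul_sqrt_sub_le hk hk'
  have hη := h.nonneg
  have hc : √(1 - σ ^ 2) ≤ 1 := by
    exact Real.sqrt_le_iff.2 ⟨by norm_num, by nlinarith [sq_nonneg σ]⟩
  obtain ⟨k0, k1⟩ := abs_le.1 hk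
  obtain ⟨k0', k1'⟩ := abs_le.1 hk'
  have hw : |√2 * √(1 + k) * σ - √2 * √(1 + k') * σ| ≤ |k - k'| := by
    rw [← sub_mul, abs_mul, abs_of_nonneg hσ.1]
    exact (mul_le_of_le_one_right (abs_nonneg _) hσ.2).trans hd
  have hσ2 : σ ^ 2 ≤ 1 := by nlinarith [hσ.1, hσ.2]
  have hZ : |(1 + k) ^ 2 * σ ^ 2 * (1 - σ ^ 2) - (1 + k') ^ 2 * σ ^ 2 * (1 - σ ^ 2)|
      ≤ 2 / 3 * |k - k'| := by
    have e : (1 + k) ^ 2 * σ ^ 2 * (1 - σ ^ 2) - (1 + k') ^ 2 * σ ^ 2 * (1 - σ ^ 2)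
        = ((2 + k + k') * (σ ^ 2 * (1 - σ ^ 2))) * (k - k') := by ring
    have h4 : σ ^ 2 * (1 - σ ^ 2) ≤ 1 / 4 := by nlinarith [sq_nonneg (σ ^ 2 - 1 / 2)]
    have h5 : 0 ≤ σ ^ 2 * (1 - σ ^ 2) := mul_nonneg (sq_nonneg _) (by linarith)
    rw [e, abs_mul]
    refine mul_le_mul_of_nonneg_right ?_ (abs_nonneg _)
    rw [abs_of_nonneg (mul_nonneg (by linarith) h5)]
    nlinarith
  unfold slopePert
  set A := √2 * √(1 + k)
  set A' := √2 * √(1 + k')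
  set p := P (A * σ) ((1 + k) ^ 2 * σ ^ 2 * (1 - σ ^ 2))
  set p' := P (A' * σ) ((1 + k') ^ 2 * σ ^ 2 * (1 - σ ^ 2))
  have e : A * p * √(1 - σ ^ 2) - A' * p' * √(1 - σ ^ 2)
      = ((A - A') * p + A' * (p - p')) * √(1 - σ ^ 2) := by ring
  have hA' : 0 ≤ A' := by positivity
  have hpp : |p - p'| ≤ η * (5 / 3 * |k - k'|) := hL.trans (by gcongr; linarith)
  have h1 : |(A - A') * p| ≤ |k - k'| * η := by rw [abs_mul]; gcongr
  have h2 : |A' * (p - p')| ≤ 3 / 2 * (η * (5 / 3 * |k - k'|)) := by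
    rw [abs_mul, abs_of_nonneg hA']; gcongr
  rw [e, abs_mul, abs_of_nonneg (Real.sqrt_nonneg _)]
  refine (mul_le_of_le_one_right (abs_nonneg _) hc).trans ((abs_add_le _ _).trans ?_)
  nlinarith [mul_nonneg hη (abs_nonneg (k - k'))]

lemma slopePert_sub (P Q : ℝ → ℝ → ℝ) (σ k : ℝ) :
    slopePert (fun w Z => P w Z - Q w Z) σ k = slopePert P σ k - slopePert Q σ k := by
  unfold slopePert; ring

lemma continuous_slopePert {P : ℝ → ℝ → ℝ} (h : Continuous fun p : ℝ × ℝ => P p.1 p.2)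
    {X : Type*} [TopologicalSpace X] {f g : X → ℝ} (hf : Continuous f) (hg : Continuous g) :
    Continuous fun x => slopePert P (f x) (g x) := by
  unfold slopePert
  have : Continuous fun x => P (√2 * √(1 + g x) * f x)
      ((1 + g x) ^ 2 * f x ^ 2 * (1 - f x ^ 2)) :=
    h.comp (f := fun x => (√2 * √(1 + g x) * f x, (1 + g x) ^ 2 * f x ^ 2 * (1 - f x ^ 2)))
      (by fun_prop)
  fun_prop

lemma branchRate_denom {k β : ℝ} (hk : |k| ≤ 1 / 20) (hβ : |β| ≤ 1 / 50) :
    22 / 25 ≤ 1 + 2 * k - β := by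
  linarith [(abs_le.1 hk).1, (abs_le.1 hβ).2]

/-- Isolates the linear part 2β; the remainder is quadratic in (k, β), so k itself enters only at
second order. -/
lemma branchRate_eq {k β : ℝ} (hk : |k| ≤ 1 / 20) (hβ : |β| ≤ 1 / 50) :
    branchRate k β = 2 * β + 2 * ((k - β) ^ 2 / (1 + 2 * k - β)) := by
  have := branchRate_denom hk hβ
  unfold branchRate
  field_simp
  ring

/-- The quadratic remainder has a Lipschitz constant proportional to the size α of its arguments.
The ceiling 7/100 is 1/20 + 1/50, the largest admissible |k| + |β|. -/
lemma abs_branchRate_sub_le {k β k' β' α : ℝ} (hk : |k| ≤ 1 / 20) (hβ : |β| ≤ 1 / 50)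
    (hk' : |k'| ≤ 1 / 20) (hβ' : |β'| ≤ 1 / 50) (hα : |k| + |β| ≤ α) (hα' : |k'| + |β'| ≤ α)
    (hα1 : α ≤ 7 / 100) :
    |branchRate k β - branchRate k' β' - 2 * (β - β')| ≤ 5 * α * (|k - k'| + |β - β'|) := by
  have hD := branchRate_denom hk hβ
  have hD' := branchRate_denom hk' hβ'
  rw [branchRate_eq hk hβ, branchRate_eq hk' hβ']
  set D := 1 + 2 * k - β with hDd
  set D' := 1 + 2 * k' - β' with hDd'
  have ha : |k - β| ≤ α := (abs_sub _ _).trans hα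
  have ha' : |k' - β'| ≤ α := (abs_sub _ _).trans hα'
  have hα0 : 0 ≤ α := (abs_nonneg _).trans ha
  set u := |k - k'|
  set v := |β - β'|
  have hu : 0 ≤ u := abs_nonneg _
  have hv : 0 ≤ v := abs_nonneg _
  have hdiff : |(k - β) - (k' - β')| ≤ u + v := by
    rw [show (k - β) - (k' - β') = (k - k') - (β - β') by ring]; exact abs_sub _ _
  have hDdiff : |D - D'| ≤ 2 * u + v := by
    rw [show D - D' = 2 * (k - k') - (β - β') by rw [hDd, hDd']; ring]
    refine (abs_sub _ _).trans ?_
    rw [abs_mul, abs_two]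
  have e : 2 * β + 2 * ((k - β) ^ 2 / D) - (2 * β' + 2 * ((k' - β') ^ 2 / D')) - 2 * (β - β')
      = 2 * (((k - β) - (k' - β')) * ((k - β) + (k' - β')) / D)
        - 2 * ((k' - β') ^ 2 * (D - D') / (D * D')) := by
    have : D ≠ 0 := by linarith
    have : D' ≠ 0 := by linarith
    field_simp
    ring
  rw [e]
  have h1 : |((k - β) - (k' - β')) * ((k - β) + (k' - β')) / D| ≤ (u + v) * (2 * α) / (22 / 25) := by
    rw [abs_div, abs_mul, abs_of_pos (show 0 < D by linarith)]
    have : |(k - β) + (k' - β')| ≤ 2 * α := (abs_add_le _ _).trans (by linarith)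
    gcongr
  have h2 : |(k' - β') ^ 2 * (D - D') / (D * D')|
      ≤ α ^ 2 * (2 * u + v) / (22 / 25 * (22 / 25)) := by
    rw [abs_div, abs_mul, abs_pow, abs_of_pos (show 0 < D * D' by
      exact mul_pos (by linarith) (by linarith))]
    gcongr
  refine (abs_sub _ _).trans ?_
  rw [abs_mul, abs_mul, abs_two]
  have h3 : α ^ 2 ≤ 7 / 100 * α := by nlinarith
  have h4 : α ^ 2 * (2 * u + v) ≤ 7 / 100 * α * (2 * u + 2 * v) := by gcongr; linarith
  have h5 : 0 ≤ α * (u + v) := by positivity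
  have h6 : (u + v) * (2 * α) / (22 / 25) = 25 / 11 * (α * (u + v)) := by ring
  have h7 : α ^ 2 * (2 * u + v) / (22 / 25 * (22 / 25)) ≤ 7 / 50 * (625 / 484) * (α * (u + v)) := by
    rw [div_le_iff₀ (by norm_num)]; linarith
  have h8 : 5 * α * (u + v) = 5 * (α * (u + v)) := by ring
  rw [h6] at h1
  rw [h8]
  linarith

/-- The Lipschitz constant 1 is used twice: with ∫₀¹ u du = 1/2 it makes the integral equation a
contraction, and against the linear term -2k it makes the weighted distance to a branch decrease. -/
lemma abs_branchRate_slopePert_sub_le {η : ℝ} {P : ℝ → ℝ → ℝ} (h : SmallOnBox η P)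
    (hη : η ≤ 1 / 100) {σ k k' : ℝ} (hσ : σ ∈ Icc (0 : ℝ) 1) (hk : |k| ≤ 1 / 20)
    (hk' : |k'| ≤ 1 / 20) :
    |branchRate k (slopePert P σ k) - branchRate k' (slopePert P σ k')| ≤ |k - k'| := by
  have hβ := abs_slopePert_le h hσ hk
  have hβ' := abs_slopePert_le h hσ hk'
  have hd := abs_slopePert_sub_le h hσ hk hk'
  have := abs_branchRate_sub_le (α := 7 / 100) (β := slopePert P σ k) (β' := slopePert P σ k') hk
    (by linarith) hk' (by linarith) (by linarith) (by linarith) le_rfl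
  set β := slopePert P σ k
  set β' := slopePert P σ k'
  have h1 : |branchRate k β - branchRate k' β'|
      ≤ |branchRate k β - branchRate k' β' - 2 * (β - β')| + |2 * (β - β')| := by
    simpa using abs_add_le (branchRate k β - branchRate k' β' - 2 * (β - β')) (2 * (β - β'))
  rw [abs_mul, abs_two] at h1
  have h2 : 4 * η * |k - k'| ≤ 4 / 100 * |k - k'| :=
    mul_le_mul_of_nonneg_right (by linarith) (abs_nonneg _)
  linarith [abs_nonneg (k - k')]

lemma abs_branchRate_le {k β : ℝ} (hk : |k| ≤ 1 / 20) (hβ : |β| ≤ 1 / 50) :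
    |branchRate k β| ≤ 1 / 4 * |k| + 5 / 2 * |β| := by
  have hD := branchRate_denom hk hβ
  unfold branchRate
  rw [abs_div, abs_of_pos (show 0 < 1 + 2 * k - β by linarith), div_le_iff₀ (by linarith), abs_mul,
    abs_two]
  have h1 : |k ^ 2 + β| ≤ 1 / 20 * |k| + |β| := by
    refine (abs_add_le _ _).trans ?_
    rw [abs_pow]
    nlinarith [abs_nonneg k]
  have h2 : (1 / 4 * |k| + 5 / 2 * |β|) * (22 / 25)
      ≤ (1 / 4 * |k| + 5 / 2 * |β|) * (1 + 2 * k - β) := by gcongr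
  linarith [abs_nonneg k, abs_nonneg β]

/-! ### The branch as a fixed point of an integral equation. -/

open scoped BoundedContinuousFunction

/-- `k` describes, in the coordinates `σ` and `k` of `slopePert`, the branch of the unstable
manifold of the saddle in the upper half plane for the perturbation `P`. -/
structure IsBranch (P : ℝ → ℝ → ℝ) (k : ℝ → ℝ) : Prop where
  cont : Continuous k
  bound : ∀ σ ∈ Icc (0 : ℝ) 1, |k σ| ≤ 1 / 20
  eq_integral : ∀ σ ∈ Icc (0 : ℝ) 1,
    k σ = ∫ u in (0 : ℝ)..1, u * branchRate (k (u * σ)) (slopePert P (u * σ) (k (u * σ)))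

lemma abs_integral_id_mul_le {f : ℝ → ℝ} {M : ℝ} (hf : ∀ u ∈ Ioc (0 : ℝ) 1, |f u| ≤ M) :
    |∫ u in (0 : ℝ)..1, u * f u| ≤ M / 2 := by
  have h : ‖∫ u in (0 : ℝ)..1, u * f u‖ ≤ ∫ u in (0 : ℝ)..1, u * M := by
    refine intervalIntegral.norm_integral_le_of_norm_le zero_le_one ?_
      (Continuous.intervalIntegrable (by fun_prop) _ _)
    refine Eventually.of_forall fun u hu => ?_
    rw [Real.norm_eq_abs, abs_mul, abs_of_pos hu.1]
    exact mul_le_mul_of_nonneg_left (hf u hu) hu.1.le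
  rw [intervalIntegral.integral_mul_const, integral_id] at h
  rw [Real.norm_eq_abs] at h
  linarith

lemma mul_mem_Icc_zero_one {u σ : ℝ} (hu : u ∈ Icc (0 : ℝ) 1) (hσ : σ ∈ Icc (0 : ℝ) 1) :
    u * σ ∈ Icc (0 : ℝ) 1 :=
  ⟨mul_nonneg hu.1 hσ.1, mul_le_one₀ hu.2 hσ.1 hσ.2⟩

/-- Truncation to `[0, 1]`. -/
def clipUnit (x : ℝ) : ℝ := max 0 (min 1 x)

/-- Truncation to `[-1/20, 1/20]`. -/
def clipSmall (x : ℝ) : ℝ := max (-(1 / 20)) (min (1 / 20) x)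

lemma clipUnit_mem (x : ℝ) : clipUnit x ∈ Icc (0 : ℝ) 1 :=
  ⟨le_max_left _ _, max_le zero_le_one (min_le_left _ _)⟩

lemma clipUnit_of_mem {x : ℝ} (hx : x ∈ Icc (0 : ℝ) 1) : clipUnit x = x := by
  unfold clipUnit; rw [min_eq_right hx.2, max_eq_right hx.1]

lemma abs_clipSmall_le (x : ℝ) : |clipSmall x| ≤ 1 / 20 :=
  abs_le.2 ⟨le_max_left _ _, max_le (by norm_num) (min_le_left _ _)⟩

lemma clipSmall_of_abs_le {x : ℝ} (hx : |x| ≤ 1 / 20) : clipSmall x = x := by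
  obtain ⟨h1, h2⟩ := abs_le.1 hx
  unfold clipSmall; rw [min_eq_right h2, max_eq_right h1]

lemma abs_clipSmall_sub_le (x y : ℝ) : |clipSmall x - clipSmall y| ≤ |x - y| := by
  unfold clipSmall
  refine (abs_max_sub_max_le_max _ _ _ _).trans ?_
  rw [sub_self, abs_zero]
  refine max_le (abs_nonneg _) ((abs_min_sub_min_le_max _ _ _ _).trans ?_)
  rw [sub_self, abs_zero]
  exact max_le (abs_nonneg _) le_rfl

/-- The truncated right hand side of the integral equation of `IsBranch`. -/
def clippedRate (P : ℝ → ℝ → ℝ) (k : ℝ → ℝ) (x : ℝ) : ℝ :=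
  branchRate (clipSmall (k (clipUnit x))) (slopePert P (clipUnit x) (clipSmall (k (clipUnit x))))

lemma clippedRate_of_mem {P : ℝ → ℝ → ℝ} {k : ℝ → ℝ} {x : ℝ} (hx : x ∈ Icc (0 : ℝ) 1)
    (hk : |k x| ≤ 1 / 20) : clippedRate P k x = branchRate (k x) (slopePert P x (k x)) := by
  unfold clippedRate
  rw [clipUnit_of_mem hx, clipSmall_of_abs_le hk]

lemma abs_slopePert_le_of_le {η : ℝ} {P : ℝ → ℝ → ℝ} (h : SmallOnBox η P) (hη : η ≤ 1 / 100)
    {σ k : ℝ} (hσ : σ ∈ Icc (0 : ℝ) 1) (hk : |k| ≤ 1 / 20) : |slopePert P σ k| ≤ 1 / 50 :=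
  (abs_slopePert_le h hσ hk).trans (by linarith)

lemma continuous_clippedRate {η : ℝ} {P : ℝ → ℝ → ℝ} (h : SmallOnBox η P) (hη : η ≤ 1 / 100)
    {k : ℝ → ℝ} (hk : Continuous k) : Continuous (clippedRate P k) := by
  have h1 : Continuous clipUnit := by unfold clipUnit; fun_prop
  have h2 : Continuous clipSmall := by unfold clipSmall; fun_prop
  have h3 : Continuous fun x => clipSmall (k (clipUnit x)) := h2.comp (hk.comp h1)
  have h4 := continuous_slopePert h.cont h1 h3
  unfold clippedRate branchRate
  refine Continuous.div (by fun_prop) (by fun_prop) fun x => ?_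
  have := branchRate_denom (abs_clipSmall_le (k (clipUnit x)))
    (abs_slopePert_le_of_le h hη (clipUnit_mem x) (abs_clipSmall_le (k (clipUnit x))))
  linarith

lemma abs_clippedRate_le {η : ℝ} {P : ℝ → ℝ → ℝ} (h : SmallOnBox η P) (hη : η ≤ 1 / 100)
    (k : ℝ → ℝ) (x : ℝ) : |clippedRate P k x| ≤ 1 / 10 := by
  have h1 := abs_clipSmall_le (k (clipUnit x))
  have h2 := abs_slopePert_le_of_le h hη (clipUnit_mem x) h1
  have := abs_branchRate_le h1 h2
  unfold clippedRate
  linarith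

/-- The truncations let the integral operator act on all bounded continuous functions on the line.
Its values are bounded by 1/20, so at the fixed point the truncations are inactive on [0, 1]. -/
lemma exists_isBranch {η : ℝ} {P : ℝ → ℝ → ℝ} (h : SmallOnBox η P) (hη : η ≤ 1 / 100) :
    ∃ k, IsBranch P k := by
  have hcont : ∀ k : ℝ →ᵇ ℝ, Continuous fun σ : ℝ =>
      ∫ u in (0 : ℝ)..1, u * clippedRate P k (u * σ) := by
    intro k
    refine intervalIntegral.continuous_parametric_intervalIntegral_of_continuous' ?_ _ _
    have := continuous_clippedRate h hη k.continuous
    simp only [Function.uncurry_def]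
    fun_prop
  have hbd : ∀ (k : ℝ → ℝ) (σ : ℝ), |∫ u in (0 : ℝ)..1, u * clippedRate P k (u * σ)| ≤ 1 / 20 :=
    fun k σ => (abs_integral_id_mul_le (fun u _ => abs_clippedRate_le h hη k _)).trans (by norm_num)
  let T : (ℝ →ᵇ ℝ) → (ℝ →ᵇ ℝ) := fun k =>
    BoundedContinuousFunction.ofNormedAddCommGroup _ (hcont k) (1 / 20) (hbd k)
  have hT : ∀ k σ, T k σ = ∫ u in (0 : ℝ)..1, u * clippedRate P k (u * σ) := fun k σ => rfl
  have hlip : ContractingWith (1 / 2) T := by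
    refine ⟨by norm_num, LipschitzWith.of_dist_le_mul fun k k' => ?_⟩
    refine (BoundedContinuousFunction.dist_le (by positivity)).2 fun σ => ?_
    have hc := continuous_clippedRate h hη k.continuous
    have hc' := continuous_clippedRate h hη k'.continuous
    rw [hT, hT, Real.dist_eq, ← intervalIntegral.integral_sub
      (Continuous.intervalIntegrable (by fun_prop) _ _)
      (Continuous.intervalIntegrable (by fun_prop) _ _)]
    simp only [← mul_sub]
    refine (abs_integral_id_mul_le (M := dist k k') fun u _ => ?_).trans (le_of_eq ?_)
    · refine (abs_branchRate_slopePert_sub_le h hη (clipUnit_mem _) (abs_clipSmall_le _)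
        (abs_clipSmall_le _)).trans ((abs_clipSmall_sub_le _ _).trans ?_)
      exact BoundedContinuousFunction.dist_coe_le_dist (f := k) (g := k') _
    · push_cast; ring
  let k := ContractingWith.fixedPoint T hlip
  have hk : T k = k := ContractingWith.fixedPoint_isFixedPt hlip
  have hk' : ∀ σ, k σ = ∫ u in (0 : ℝ)..1, u * clippedRate P k (u * σ) := fun σ => by
    rw [← hT, hk]
  have hkb : ∀ σ, |k σ| ≤ 1 / 20 := fun σ => by rw [hk']; exact hbd k σ
  refine ⟨k, k.continuous, fun σ _ => hkb σ, fun σ hσ => ?_⟩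
  rw [hk' σ]
  refine intervalIntegral.integral_congr fun u hu => ?_
  rw [uIcc_of_le zero_le_one] at hu
  rw [clippedRate_of_mem (mul_mem_Icc_zero_one hu hσ) (hkb _)]

lemma IsBranch.abs_slopePert_le {η : ℝ} {P : ℝ → ℝ → ℝ} (h : SmallOnBox η P) {k : ℝ → ℝ}
    (hk : IsBranch P k) {σ : ℝ} (hσ : σ ∈ Icc (0 : ℝ) 1) : |slopePert P σ (k σ)| ≤ 2 * η :=
  RayleighLienard.abs_slopePert_le h hσ (hk.bound σ hσ)

lemma IsBranch.continuousOn_rate {η : ℝ} {P : ℝ → ℝ → ℝ} (h : SmallOnBox η P) (hη : η ≤ 1 / 100)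
    {k : ℝ → ℝ} (hk : IsBranch P k) :
    ContinuousOn (fun σ => branchRate (k σ) (slopePert P σ (k σ))) (Icc 0 1) := by
  refine (continuous_clippedRate h hη hk.cont).continuousOn.congr fun σ hσ => ?_
  exact (clippedRate_of_mem hσ (hk.bound σ hσ)).symm

lemma IsBranch.intervalIntegrable {η : ℝ} {P : ℝ → ℝ → ℝ} (h : SmallOnBox η P)
    (hη : η ≤ 1 / 100) {k : ℝ → ℝ} (hk : IsBranch P k) {σ : ℝ} (hσ : σ ∈ Icc (0 : ℝ) 1) :
    IntervalIntegrable
      (fun u => u * branchRate (k (u * σ)) (slopePert P (u * σ) (k (u * σ))))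
      MeasureTheory.volume 0 1 :=
  ContinuousOn.intervalIntegrable_of_Icc zero_le_one
    (continuousOn_id.mul ((hk.continuousOn_rate h hη).comp (f := fun u => u * σ) (by fun_prop)
      fun _ hu => mul_mem_Icc_zero_one hu hσ))

/-! ### Size of a branch and its dependence on the perturbation. -/

/-- A branch is of the size of the perturbation. -/
lemma IsBranch.abs_le {η : ℝ} {P : ℝ → ℝ → ℝ} (h : SmallOnBox η P) (hη : η ≤ 1 / 100)
    {k : ℝ → ℝ} (hk : IsBranch P k) {σ : ℝ} (hσ : σ ∈ Icc (0 : ℝ) 1) : |k σ| ≤ 3 * η := by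
  obtain ⟨m, hm, hmax⟩ := isCompact_Icc.exists_isMaxOn (nonempty_Icc.2 zero_le_one)
    (hk.cont.abs.continuousOn (s := Icc (0 : ℝ) 1))
  have hM : ∀ σ ∈ Icc (0 : ℝ) 1, |k σ| ≤ |k m| := fun σ hσ => hmax hσ
  refine (hM σ hσ).trans ?_
  -- At a maximum M of |k| the integral equation bounds M by itself; solving gives M ≤ 20η/7.
  have h1 : |k m| ≤ (1 / 4 * |k m| + 5 * η) / 2 := by
    conv_lhs => rw [hk.eq_integral m hm]
    refine abs_integral_id_mul_le fun u hu => ?_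
    have hu' := mul_mem_Icc_zero_one (Ioc_subset_Icc_self hu) hm
    have h2 := hk.abs_slopePert_le h hu'
    have h3 := abs_branchRate_le (hk.bound _ hu') (h2.trans (by linarith))
    have h4 := hM _ hu'
    linarith
  linarith [h.nonneg]

/-- The first order displacement of the end point of the branch. -/
def firstOrder (P : ℝ → ℝ → ℝ) : ℝ := ∫ u in (0 : ℝ)..1, u * (2 * slopePert P u 0)

lemma slopePert_diff_le {η ν : ℝ} {P Q : ℝ → ℝ → ℝ} (h : SmallOnBox η P)
    (hd : SmallOnBox ν fun w Z => P w Z - Q w Z) {σ k k' : ℝ} (hσ : σ ∈ Icc (0 : ℝ) 1)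
    (hk : |k| ≤ 1 / 20) (hk' : |k'| ≤ 1 / 20) :
    |slopePert P σ k - slopePert Q σ k'| ≤ 4 * η * |k - k'| + 2 * ν := by
  have h1 := abs_slopePert_sub_le h hσ hk hk'
  have h2 := abs_slopePert_le hd hσ hk'
  rw [slopePert_sub] at h2
  have := abs_add_le (slopePert P σ k - slopePert P σ k') (slopePert P σ k' - slopePert Q σ k')
  rw [sub_add_sub_cancel] at this
  linarith

/-- Branches depend in a Lipschitz way on the perturbation. -/
lemma IsBranch.abs_sub_le {η ν : ℝ} {P Q : ℝ → ℝ → ℝ} (h : SmallOnBox η P) (h' : SmallOnBox η Q)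
    (hd : SmallOnBox ν fun w Z => P w Z - Q w Z) (hη : η ≤ 1 / 100) {k k' : ℝ → ℝ}
    (hk : IsBranch P k) (hk' : IsBranch Q k') {σ : ℝ} (hσ : σ ∈ Icc (0 : ℝ) 1) :
    |k σ - k' σ| ≤ 5 * ν := by
  obtain ⟨m, hm, hmax⟩ := isCompact_Icc.exists_isMaxOn (nonempty_Icc.2 zero_le_one)
    ((hk.cont.sub hk'.cont).abs.continuousOn (s := Icc (0 : ℝ) 1))
  have hM : ∀ σ ∈ Icc (0 : ℝ) 1, |k σ - k' σ| ≤ |k m - k' m| := fun σ hσ => hmax hσ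
  refine (hM σ hσ).trans ?_
  -- The same self-bounding argument at a maximum of the difference.
  have h1 : |k m - k' m| ≤ (|k m - k' m| + 5 * ν) / 2 := by
    conv_lhs => rw [hk.eq_integral m hm, hk'.eq_integral m hm]
    rw [← intervalIntegral.integral_sub (hk.intervalIntegrable h hη hm)
      (hk'.intervalIntegrable h' hη hm)]
    simp only [← mul_sub]
    refine abs_integral_id_mul_le fun u hu => ?_
    have hu' := mul_mem_Icc_zero_one (Ioc_subset_Icc_self hu) hm
    have h4 := hM _ hu'
    have e1 := hk.abs_slopePert_le h hu'
    have e2 := hk'.abs_slopePert_le h' hu'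
    have e3 := slopePert_diff_le h hd hu' (hk.bound _ hu') (hk'.bound _ hu')
    have b1 := hk.bound _ hu'
    have b2 := hk'.bound _ hu'
    set x := k (u * m)
    set x' := k' (u * m)
    set β := slopePert P (u * m) x
    set β' := slopePert Q (u * m) x'
    have e4 := abs_branchRate_sub_le (α := 7 / 100) (k := x) (β := β) (k' := x') (β' := β')
      b1 (by linarith) b2 (by linarith) (by linarith) (by linarith) le_rfl
    have e5 := abs_add_le (branchRate x β - branchRate x' β' - 2 * (β - β')) (2 * (β - β'))
    rw [sub_add_cancel, abs_mul 2, abs_two] at e5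
    have e6 : 4 * η * |x - x'| ≤ 4 / 100 * |x - x'| := by gcongr; linarith
    linarith [abs_nonneg (x - x'), hd.nonneg]
  linarith

lemma IsBranch.unique {η : ℝ} {P : ℝ → ℝ → ℝ} (h : SmallOnBox η P) (hη : η ≤ 1 / 100)
    {k k' : ℝ → ℝ} (hk : IsBranch P k) (hk' : IsBranch P k') {σ : ℝ} (hσ : σ ∈ Icc (0 : ℝ) 1) :
    k σ = k' σ := by
  have h0 : SmallOnBox 0 fun w Z => P w Z - P w Z := by
    simp only [sub_self]
    exact ⟨continuous_const, by simp, by simp⟩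
  have := hk.abs_sub_le h h h0 hη hk' hσ
  rw [mul_zero] at this
  exact sub_eq_zero.1 (abs_nonpos_iff.1 this)

/-- The displacement of the end point of a branch to first order. -/
lemma IsBranch.abs_sub_sub_firstOrder_le {η ν : ℝ} {P Q : ℝ → ℝ → ℝ} (h : SmallOnBox η P)
    (h' : SmallOnBox η Q) (hd : SmallOnBox ν fun w Z => P w Z - Q w Z) (hη : η ≤ 1 / 100)
    {k k' : ℝ → ℝ} (hk : IsBranch P k) (hk' : IsBranch Q k') :
    |k 1 - k' 1 - firstOrder fun w Z => P w Z - Q w Z| ≤ 200 * η * ν := by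
  have h1 : (1 : ℝ) ∈ Icc (0 : ℝ) 1 := by norm_num
  have hη0 := h.nonneg
  have hν0 := hd.nonneg
  have hid : Continuous fun u : ℝ => slopePert (fun w Z => P w Z - Q w Z) u 0 :=
    continuous_slopePert hd.cont continuous_id continuous_const
  have i1 := hk.intervalIntegrable h hη h1
  have i2 := hk'.intervalIntegrable h' hη h1
  rw [hk.eq_integral 1 h1, hk'.eq_integral 1 h1, firstOrder,
    ← intervalIntegral.integral_sub i1 i2, ← intervalIntegral.integral_sub (i1.sub i2)
      (Continuous.intervalIntegrable (by fun_prop) _ _)]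
  simp only [← mul_sub, mul_one]
  refine (abs_integral_id_mul_le (M := 400 * η * ν) fun u hu => ?_).trans (le_of_eq (by ring))
  have hu' := Ioc_subset_Icc_self hu
  have e1 := hk.abs_slopePert_le h hu'
  have e2 := hk'.abs_slopePert_le h' hu'
  have e3 := slopePert_diff_le h hd hu' (hk.bound _ hu') (hk'.bound _ hu')
  have e4 := abs_slopePert_sub_le h hu' (hk.bound _ hu') (hk'.bound _ hu')
  have e5 := abs_slopePert_sub_le hd hu' (hk'.bound _ hu') (k' := 0) (by norm_num)
  have e6 := hk.abs_sub_le h h' hd hη hk' hu'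
  have b1 := hk.abs_le h hη hu'
  have b2 := hk'.abs_le h' hη hu'
  have c1 := hk.bound _ hu'
  have c2 := hk'.bound _ hu'
  have e8 : slopePert P u (k' u) - slopePert Q u (k' u)
      = slopePert (fun w Z => P w Z - Q w Z) u (k' u) := (slopePert_sub P Q u (k' u)).symm
  set x := k u
  set x' := k' u
  set L := slopePert (fun w Z => P w Z - Q w Z) u 0
  set L' := slopePert (fun w Z => P w Z - Q w Z) u x'
  set β := slopePert P u x
  set β' := slopePert Q u x'
  set β'' := slopePert P u x'
  -- Here α = 5η comes from |k| ≤ 3η and |β| ≤ 2η; this extra factor η makes the error of order ην.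
  have e7 := abs_branchRate_sub_le (α := 5 * η) (k := x) (β := β) (k' := x') (β' := β')
    c1 (by linarith) c2 (by linarith) (by linarith) (by linarith) (by linarith)
  have g1 : |x - x'| + |β - β'| ≤ 8 * ν := by
    have : 4 * η * |x - x'| ≤ 4 / 100 * |x - x'| := by gcongr; linarith
    linarith
  have g2 : 5 * (5 * η) * (|x - x'| + |β - β'|) ≤ 200 * (η * ν) := by
    calc _ ≤ 5 * (5 * η) * (8 * ν) := by gcongr
      _ = _ := by ring
  have g3 : 4 * η * |x - x'| ≤ 20 * (η * ν) := by
    calc _ ≤ 4 * η * (5 * ν) := by gcongr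
      _ = _ := by ring
  have g4 : 4 * ν * |x' - 0| ≤ 12 * (η * ν) := by
    rw [sub_zero]
    calc _ ≤ 4 * ν * (3 * η) := by gcongr
      _ = _ := by ring
  -- Three errors are separated: the quadratic part of the rate, the moved base point in P, and the
  -- replacement of k' by 0 in P - Q. Each is O(ην).
  have e : branchRate x β - branchRate x' β' - 2 * L
      = (branchRate x β - branchRate x' β' - 2 * (β - β')) + 2 * ((β - β'') + (L' - L)) := by
    rw [← e8]; ring
  rw [e]
  refine (abs_add_le _ _).trans ?_
  rw [abs_mul 2, abs_two]
  have g5 := abs_add_le (β - β'') (L' - L)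
  have g6 : 0 ≤ η * ν := mul_nonneg hη0 hν0
  linarith

lemma abs_firstOrder_le {η : ℝ} {P : ℝ → ℝ → ℝ} (h : SmallOnBox η P) : |firstOrder P| ≤ 2 * η := by
  refine (abs_integral_id_mul_le (M := 4 * η) fun u hu => ?_).trans (le_of_eq (by ring))
  have := abs_slopePert_le h (Ioc_subset_Icc_self hu) (k := 0) (by norm_num)
  rw [abs_mul, abs_two]
  linarith

/-- The differential equation of a branch. -/
lemma IsBranch.hasDerivAt {η : ℝ} {P : ℝ → ℝ → ℝ} (h : SmallOnBox η P) (hη : η ≤ 1 / 100)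
    {k : ℝ → ℝ} (hk : IsBranch P k) {σ : ℝ} (hσ : σ ∈ Ioo (0 : ℝ) 1) :
    HasDerivAt k ((-2 * k σ + branchRate (k σ) (slopePert P σ (k σ))) / σ) σ := by
  have hc := continuous_clippedRate h hη hk.cont
  -- The substitution τ = uσ turns the integral equation into σ²k(σ) = ∫₀^σ τ·rate dτ, which can be
  -- differentiated.
  have hk2 : ∀ x ∈ Ioo (0 : ℝ) 1, k x = (∫ τ in (0 : ℝ)..x, τ * clippedRate P k τ) / x ^ 2 := by
    intro x hx
    have hx' := Ioo_subset_Icc_self hx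
    have e := intervalIntegral.integral_comp_mul_right (a := 0) (b := 1)
      (fun τ => τ * clippedRate P k τ) hx.1.ne'
    rw [zero_mul, one_mul, smul_eq_mul] at e
    have e2 : ∫ u in (0 : ℝ)..1, u * x * clippedRate P k (u * x) = x * k x := by
      rw [hk.eq_integral x hx', ← intervalIntegral.integral_const_mul]
      refine intervalIntegral.integral_congr fun u hu => ?_
      rw [uIcc_of_le zero_le_one] at hu
      have hu' := mul_mem_Icc_zero_one hu hx'
      rw [clippedRate_of_mem hu' (hk.bound _ hu')]
      ring
    have hx0 := hx.1.ne'
    rw [e2] at e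
    field_simp at e ⊢
    linarith
  have hF : HasDerivAt (fun x => ∫ τ in (0 : ℝ)..x, τ * clippedRate P k τ)
      (σ * clippedRate P k σ) σ :=
    (continuous_id.mul hc).integral_hasStrictDerivAt 0 σ |>.hasDerivAt
  have hσ0 := hσ.1.ne'
  have hD := hF.div (hasDerivAt_pow 2 σ) (pow_ne_zero 2 hσ0)
  refine (hD.congr_of_eventuallyEq ?_).congr_deriv ?_
  · filter_upwards [Ioo_mem_nhds hσ.1 hσ.2] with x hx using hk2 x hx
  · have h1 := hk2 σ hσ
    have h2 := clippedRate_of_mem (P := P) (Ioo_subset_Icc_self hσ)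
      (hk.bound σ (Ioo_subset_Icc_self hσ))
    rw [h2]
    have h3 : (∫ τ in (0 : ℝ)..σ, τ * clippedRate P k τ) = k σ * σ ^ 2 := by
      rw [h1]; field_simp
    rw [h3]
    field_simp
    push_cast
    ring

/-! ### Comparison lemmas on the line. -/

lemma eventually_lt_of_hasDerivAt_neg {f : ℝ → ℝ} {f' x : ℝ} (h : HasDerivAt f f' x)
    (hf : f' < 0) : ∀ᶠ t in 𝓝[>] x, f t < f x := by
  have h1 := (hasDerivAt_iff_tendsto_slope.1 h).mono_left
    (nhdsWithin_mono x (fun t (ht : x < t) => ht.ne'))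
  filter_upwards [h1.eventually_lt_const hf, self_mem_nhdsWithin] with t ht hxt
  rw [slope_def_field, div_neg_iff] at ht
  have : 0 < t - x := sub_pos.2 hxt
  rcases ht with ht | ht <;> linarith [ht.1, ht.2]

/-- A positive function on `(-∞, b]` whose derivative is at least `c > 0` wherever its value is
at most `a` stays above `a`. -/
lemma lt_of_pos_of_le_deriv {f f' : ℝ → ℝ} {a b c : ℝ} (hc : 0 < c)
    (hf : ∀ t ≤ b, HasDerivAt f (f' t) t) (hpos : ∀ t ≤ b, 0 < f t)
    (h : ∀ t ≤ b, f t ≤ a → c ≤ f' t) {t : ℝ} (ht : t ≤ b) : a < f t := by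
  by_contra! hle
  have ha : 0 < a := (hpos t ht).trans_le hle
  have hder : ∀ x ≥ 0, HasDerivAt (fun x => f (t - x)) (-f' (t - x)) x := fun x hx => by
    have := (hf (t - x) (by linarith)).comp x ((hasDerivAt_id x).const_sub t)
    simpa [Function.comp_def] using this
  have hB : ∀ x, HasDerivAt (fun x => a - c / 2 * x) (-(c / 2)) x := fun x => by
    simpa using ((hasDerivAt_id x).const_mul (c / 2)).const_sub a
  have hx0 : 0 ≤ 2 * a / c := by positivity
  -- Backwards in time f stays below a line of slope -c/2, which reaches 0 after time 2a/c. Halving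
  -- c supplies the strict inequality of the comparison.
  have key := image_le_of_deriv_right_lt_deriv_boundary' (a := 0) (b := 2 * a / c)
    (f := fun x => f (t - x)) (f' := fun x => -f' (t - x)) (B := fun x => a - c / 2 * x)
    (B' := fun _ => -(c / 2))
    (fun x hx => (hder x hx.1).continuousAt.continuousWithinAt)
    (fun x hx => (hder x hx.1).hasDerivWithinAt) (by simpa using hle)
    (fun x _ => (hB x).continuousAt.continuousWithinAt) (fun x _ => (hB x).hasDerivWithinAt)
    (fun x hx hfx => by
      have : a - c / 2 * x ≤ a := by nlinarith [hx.1]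
      linarith [h (t - x) (by linarith [hx.1]) (hfx.trans_le this)])
    (right_mem_Icc.2 hx0)
  have h1 := hpos (t - 2 * a / c) (by linarith)
  have h2 : c / 2 * (2 * a / c) = a := by field_simp
  linarith

/-- If `f' < 0` wherever `f = B` on `[a, b)`, then `f ≤ B` propagates from `a` to `[a, b]`. -/
lemma le_of_deriv_neg_of_eq {f f' : ℝ → ℝ} {a b B : ℝ} (hf : ∀ t, HasDerivAt f (f' t) t)
    (ha : f a ≤ B) (h : ∀ t ∈ Ico a b, f t = B → f' t < 0) : ∀ t ∈ Icc a b, f t ≤ B :=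
  fun _ ht => image_le_of_deriv_right_lt_deriv_boundary'
    (fun x _ => (hf x).continuousAt.continuousWithinAt) (fun x _ => (hf x).hasDerivWithinAt) ha
    continuousOn_const (fun _ _ => hasDerivWithinAt_const _ _ _) h ht

lemma exists_first_zero {f : ℝ → ℝ} (hf : Continuous f) {a b : ℝ} (hab : a ≤ b) (ha : 0 < f a)
    (hb : f b ≤ 0) : ∃ T ∈ Ioc a b, f T = 0 ∧ ∀ t ∈ Ico a T, 0 < f t := by
  have hS : IsCompact (Icc a b ∩ {t | f t ≤ 0}) :=
    isCompact_Icc.inter_right (isClosed_le hf continuous_const)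
  obtain ⟨T, ⟨hT, hTf⟩, hmin⟩ := hS.exists_isLeast ⟨b, ⟨hab, le_rfl⟩, hb⟩
  have hTa : a < T := lt_of_le_of_ne hT.1 (by rintro rfl; exact absurd hTf (not_le.2 ha))
  have hpos : ∀ t ∈ Ico a T, 0 < f t := fun t ht => by
    by_contra! h0
    exact absurd (hmin ⟨⟨ht.1, ht.2.le.trans hT.2⟩, h0⟩) (not_le.2 ht.2)
  refine ⟨T, ⟨hTa, hT.2⟩, le_antisymm hTf ?_, hpos⟩
  refine ge_of_tendsto (hf.continuousAt.tendsto.mono_left nhdsWithin_le_nhds :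
    Tendsto f (𝓝[<] T) (𝓝 (f T))) ?_
  filter_upwards [Ioo_mem_nhdsLT hTa] with t ht using (hpos t ⟨ht.1.le, ht.2⟩).le

/-! ### Qualitative behaviour of a homoclinic orbit. -/

/-- `(w, v)` solves the rescaled system `ẇ = v`, `v̇ = w (1 - w²) / 2 + P(w, v²) v`, stays in the
box in which `P` is controlled, and is homoclinic to the origin. -/
structure IsBoxedHomoclinic (P : ℝ → ℝ → ℝ) (w v : ℝ → ℝ) : Prop where
  deriv_w : ∀ t, HasDerivAt w (v t) t
  deriv_v : ∀ t, HasDerivAt v (w t * (1 - w t ^ 2) / 2 + P (w t) (v t ^ 2) * v t) t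
  ne_zero : ∀ t, ¬(w t = 0 ∧ v t = 0)
  w_atBot : Tendsto w atBot (𝓝 0)
  w_atTop : Tendsto w atTop (𝓝 0)
  v_atBot : Tendsto v atBot (𝓝 0)
  v_atTop : Tendsto v atTop (𝓝 0)
  w_mem : ∀ t, w t ∈ Icc (-(1 / 2) : ℝ) 2
  v_mem : ∀ t, |v t| ≤ 1

namespace IsBoxedHomoclinic

variable {P : ℝ → ℝ → ℝ} {w v : ℝ → ℝ}

/-- Time reversal. -/
lemma reverse (h : IsBoxedHomoclinic P w v) :
    IsBoxedHomoclinic (fun x Z => -P x Z) (fun t => w (-t)) (fun t => -v (-t)) where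
  deriv_w t := by
    simpa [Function.comp_def] using (h.deriv_w (-t)).comp t (hasDerivAt_neg t)
  deriv_v t := by
    have := ((h.deriv_v (-t)).comp t (hasDerivAt_neg t)).neg
    refine this.congr_deriv ?_
    rw [neg_sq]
    ring
  ne_zero t := by simpa using h.ne_zero (-t)
  w_atBot := h.w_atTop.comp tendsto_neg_atBot_atTop
  w_atTop := h.w_atBot.comp tendsto_neg_atTop_atBot
  v_atBot := by simpa [Function.comp_def] using (h.v_atTop.comp tendsto_neg_atBot_atTop).neg
  v_atTop := by simpa [Function.comp_def] using (h.v_atBot.comp tendsto_neg_atTop_atBot).neg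
  w_mem t := h.w_mem (-t)
  v_mem t := by simpa using h.v_mem (-t)

lemma abs_P_le (h : IsBoxedHomoclinic P w v) {η : ℝ} (hP : SmallOnBox η P) (hη : η ≤ 1 / 100)
    (t : ℝ) : |P (w t) (v t ^ 2)| ≤ 1 / 100 := by
  refine (hP.bound _ (Icc_subset_Icc_left (by norm_num) (h.w_mem t)) _ ⟨sq_nonneg _, ?_⟩).trans hη
  have := h.v_mem t
  rw [← sq_abs]
  nlinarith [abs_nonneg (v t)]

lemma continuous_w (h : IsBoxedHomoclinic P w v) : Continuous w :=
  continuous_iff_continuousAt.2 fun t => (h.deriv_w t).continuousAt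

lemma continuous_v (h : IsBoxedHomoclinic P w v) : Continuous v :=
  continuous_iff_continuousAt.2 fun t => (h.deriv_v t).continuousAt

/-- The quadrant w ≤ 0, v ≤ 0 is forward invariant: w decreases where v < 0, and v decreases on v =
0 because -1/2 ≤ w < 0. An orbit inside it moves away from the saddle and cannot return. -/
lemma not_nonpos_nonpos (h : IsBoxedHomoclinic P w v) {η : ℝ} (hP : SmallOnBox η P)
    (hη : η ≤ 1 / 100) (t₀ : ℝ) : ¬(w t₀ ≤ 0 ∧ v t₀ ≤ 0) := by
  intro h0
  have hinv : ∀ t, t₀ ≤ t → w t ≤ 0 ∧ v t ≤ 0 := by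
    intro t ht
    have hcl : IsClosed ({t | w t ≤ 0 ∧ v t ≤ 0} ∩ Icc t₀ t) :=
      ((isClosed_le h.continuous_w continuous_const).inter
        (isClosed_le h.continuous_v continuous_const)).inter isClosed_Icc
    refine hcl.Icc_subset_of_forall_mem_nhdsWithin h0 ?_ ⟨ht, le_rfl⟩
    rintro s ⟨⟨hw, hv⟩, -⟩
    rcases hv.lt_or_eq with hv' | hv'
    · filter_upwards [eventually_lt_of_hasDerivAt_neg (h.deriv_w s) hv',
        (h.continuous_v.continuousAt.eventually_lt_const hv').filter_mono nhdsWithin_le_nhds]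
        with r h1 h2 using ⟨h1.le.trans hw, h2.le⟩
    · have hw' : w s < 0 := lt_of_le_of_ne hw fun e => h.ne_zero s ⟨e, hv'⟩
      have hneg : w s * (1 - w s ^ 2) / 2 + P (w s) (v s ^ 2) * v s < 0 := by
        have := (h.w_mem s).1
        rw [hv', mul_zero, add_zero]
        nlinarith [mul_pos (neg_pos.2 hw') (show 0 < 1 - w s ^ 2 by nlinarith)]
      filter_upwards [eventually_lt_of_hasDerivAt_neg (h.deriv_v s) hneg,
        (h.continuous_w.continuousAt.eventually_lt_const hw').filter_mono nhdsWithin_le_nhds]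
        with r h1 h2 using ⟨h2.le, h1.le.trans hv⟩
  -- A positive combination of w and v; it decreases in the quadrant because 7/10 dominates |P| ≤
  -- 1/100.
  let f : ℝ → ℝ := fun t => 7 / 10 * w t + v t
  have hf : ∀ t, HasDerivAt f
      (7 / 10 * v t + (w t * (1 - w t ^ 2) / 2 + P (w t) (v t ^ 2) * v t)) t :=
    fun t => ((h.deriv_w t).const_mul _).add (h.deriv_v t)
  have hanti : AntitoneOn f (Ici t₀) := by
    refine antitoneOn_of_hasDerivWithinAt_nonpos (convex_Ici t₀)
      (fun t _ => (hf t).continuousAt.continuousWithinAt) (fun t _ => (hf t).hasDerivWithinAt) ?_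
    intro t ht
    rw [interior_Ici] at ht
    obtain ⟨hw, hv⟩ := hinv t ht.le
    have hp := (abs_le.1 (h.abs_P_le hP hη t)).1
    have h1 : w t * (1 - w t ^ 2) ≤ 0 :=
      mul_nonpos_of_nonpos_of_nonneg hw (by nlinarith [(h.w_mem t).1])
    nlinarith
  have hneg : f t₀ < 0 := by
    rcases h0.1.lt_or_eq with h1 | h1
    · simp only [f]; linarith [h0.2]
    · have : v t₀ < 0 := lt_of_le_of_ne h0.2 fun e => h.ne_zero t₀ ⟨h1, e⟩
      simp only [f]; linarith
  have hlim : Tendsto f atTop (𝓝 0) := by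
    simpa [f] using (h.w_atTop.const_mul (7 / 10)).add h.v_atTop
  have : (0 : ℝ) ≤ f t₀ := le_of_tendsto hlim <| by
    filter_upwards [eventually_ge_atTop t₀] with t ht using hanti self_mem_Ici ht ht
  linarith

/-- Time reversal changes the sign of v, so excluding one quadrant excludes the half plane w ≤ 0. -/
lemma w_pos (h : IsBoxedHomoclinic P w v) {η : ℝ} (hP : SmallOnBox η P) (hη : η ≤ 1 / 100)
    (t : ℝ) : 0 < w t := by
  by_contra! hw
  rcases le_total (v t) 0 with hv | hv
  · exact h.not_nonpos_nonpos hP hη t ⟨hw, hv⟩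
  · exact h.reverse.not_nonpos_nonpos hP.neg hη (-t) (by simpa using ⟨hw, hv⟩)

/-- For 0 < w < 1 the field points upwards on v = 0, so v ≤ 0 persists backwards in time. Then w
decreases from its limit 0 at -∞, against w > 0. -/
lemma eventually_v_pos (h : IsBoxedHomoclinic P w v) {η : ℝ} (hP : SmallOnBox η P)
    (hη : η ≤ 1 / 100) : ∃ b, ∀ t ≤ b, 0 < v t ∧ w t ≤ 1 / 10 := by
  obtain ⟨b, hb⟩ := eventually_atBot.1
    (h.w_atBot.eventually_le_const (show (0 : ℝ) < 1 / 10 by norm_num))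
  refine ⟨b, fun t ht => ⟨?_, hb t ht⟩⟩
  by_contra! hv
  have hneg : ∀ s ≤ t, v s ≤ 0 := by
    intro s hs
    have := le_of_deriv_neg_of_eq (a := -t) (b := -s) (B := 0) (f := fun x => v (-x))
      (f' := fun x => -(w (-x) * (1 - w (-x) ^ 2) / 2 + P (w (-x)) (v (-x) ^ 2) * v (-x)))
      (fun x => by simpa [Function.comp_def] using (h.deriv_v (-x)).comp x (hasDerivAt_neg x))
      (by simpa using hv) (fun x hx hvx => ?_) (-s) ⟨by linarith, le_rfl⟩
    · simpa using this
    · have h1 := h.w_pos hP hη (-x)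
      have h2 := hb (-x) (by linarith [hx.1])
      rw [hvx, mul_zero, add_zero]
      nlinarith [mul_pos h1 (show 0 < 1 - w (-x) ^ 2 by nlinarith)]
  have hanti : AntitoneOn w (Iic t) :=
    antitoneOn_of_hasDerivWithinAt_nonpos (convex_Iic t)
      (fun t _ => (h.deriv_w t).continuousAt.continuousWithinAt)
      (fun t _ => (h.deriv_w t).hasDerivWithinAt)
      (fun s hs => hneg s (mem_Iic.1 (interior_subset hs)))
  have : w t ≤ 0 := ge_of_tendsto h.w_atBot <| by
    filter_upwards [eventually_le_atBot t] with s hs using hanti hs self_mem_Iic hs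
  linarith [h.w_pos hP hη t]

end IsBoxedHomoclinic

/-! ### Blow-up coordinates along an orbit. -/

/-- The coordinate `k` of a point, with `w² k = w⁴ / 2 - w² + 2 v²`. -/
def excess (w v : ℝ → ℝ) (t : ℝ) : ℝ := w t ^ 2 / 2 + 2 * (v t / w t) ^ 2 - 1

/-- The coordinate `σ` of a point. -/
def phase (w v : ℝ → ℝ) (t : ℝ) : ℝ := w t / √(2 * (1 + excess w v t))

namespace IsBoxedHomoclinic

variable {P : ℝ → ℝ → ℝ} {w v : ℝ → ℝ}

lemma hasDerivAt_slope (h : IsBoxedHomoclinic P w v) {t : ℝ} (hw : 0 < w t) :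
    HasDerivAt (fun t => v t / w t)
      ((1 - w t ^ 2) / 2 + P (w t) (v t ^ 2) * (v t / w t) - (v t / w t) ^ 2) t := by
  refine ((h.deriv_v t).div (h.deriv_w t) hw.ne').congr_deriv ?_
  field_simp

/-- The product w²·`excess` is the energy up to a constant factor, with derivative 4Pv². Hence
`excess` is damped at rate 2v/w and forced by P. -/
lemma hasDerivAt_excess (h : IsBoxedHomoclinic P w v) {t : ℝ} (hw : 0 < w t) :
    HasDerivAt (excess w v)
      (2 * (v t / w t) * (2 * P (w t) (v t ^ 2) * (v t / w t) - excess w v t)) t := by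
  have h1 := ((h.deriv_w t).pow 2).div_const 2
  have h2 := (((h.hasDerivAt_slope hw).pow 2).const_mul 2)
  refine ((h1.add h2).sub_const 1).congr_deriv ?_
  unfold excess
  push_cast
  field_simp
  ring

/-- The slope v/w obeys a Riccati equation whose positive equilibrium is close to 1/√2. A slope that
is positive for all past times must lie near it, here between 69/100 and 18/25. -/
lemma eventually_excess_le (h : IsBoxedHomoclinic P w v) {η : ℝ} (hP : SmallOnBox η P)
    (hη : η ≤ 1 / 100) : ∃ b, ∀ t ≤ b, 0 < v t ∧ |excess w v t| ≤ 1 / 20 := by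
  obtain ⟨b, hb⟩ := h.eventually_v_pos hP hη
  refine ⟨b, fun t ht => ⟨(hb t ht).1, ?_⟩⟩
  have hq : 69 / 100 < v t / w t := by
    refine lt_of_pos_of_le_deriv (c := 1 / 100) (by norm_num)
      (fun s _ => h.hasDerivAt_slope (h.w_pos hP hη s))
      (fun s hs => div_pos (hb s hs).1 (h.w_pos hP hη s)) (fun s hs hle => ?_) ht
    have h0 := div_pos (hb s hs).1 (h.w_pos hP hη s)
    have hp := (abs_le.1 (h.abs_P_le hP hη s)).1
    have hw := h.w_pos hP hη s
    have hw' := (hb s hs).2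
    nlinarith
  -- The upper bound on the slope is a lower bound on its reciprocal, where the backward argument of
  -- `lt_of_pos_of_le_deriv` applies; 25/18 is the reciprocal of 18/25.
  have hp : 25 / 18 < w t / v t := by
    refine lt_of_pos_of_le_deriv (f := fun t => w t / v t) (c := 1 / 100) (by norm_num)
      (f' := fun s => 1 - (w s / v s) ^ 2 * (1 - w s ^ 2) / 2 - P (w s) (v s ^ 2) * (w s / v s))
      (fun s hs => ?_)
      (fun s hs => div_pos (h.w_pos hP hη s) (hb s hs).1) (fun s hs hle => ?_) ht
    · have hv := (hb s hs).1
      refine ((h.deriv_w s).div (h.deriv_v s) hv.ne').congr_deriv ?_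
      field_simp
      ring
    · have h0 := div_pos (h.w_pos hP hη s) (hb s hs).1
      have hp := (abs_le.1 (h.abs_P_le hP hη s)).2
      have h1 : (w s / v s) ^ 2 * (1 - w s ^ 2) ≤ (25 / 18) ^ 2 * 1 :=
        mul_le_mul (pow_le_pow_left₀ h0.le hle 2) (by nlinarith [sq_nonneg (w s)])
          (by nlinarith [(hb s hs).2, h.w_pos hP hη s]) (by norm_num)
      have h2 : P (w s) (v s ^ 2) * (w s / v s) ≤ 1 / 100 * (25 / 18) :=
        (mul_le_mul_of_nonneg_right hp h0.le).trans (by gcongr)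
      norm_num at h1 h2 ⊢
      linarith
  have hw := h.w_pos hP hη t
  have hv := (hb t ht).1
  have hq' : v t / w t < 18 / 25 := by
    rw [lt_div_iff₀ hv] at hp
    rw [div_lt_iff₀ hw]
    linarith
  have := (hb t ht).2
  unfold excess
  rw [abs_le]
  constructor <;> nlinarith

lemma sq_slope_eq (w v : ℝ → ℝ) (t : ℝ) :
    4 * (v t / w t) ^ 2 = 2 * (1 + excess w v t) - w t ^ 2 := by
  unfold excess; ring

lemma two_mul_one_add_excess_pos {t : ℝ} (hw : 0 < w t) : 0 < 2 * (1 + excess w v t) := by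
  unfold excess
  have := sq_nonneg (v t / w t)
  have := pow_pos hw 2
  linarith

lemma phase_sq {t : ℝ} (hw : 0 < w t) :
    phase w v t ^ 2 = w t ^ 2 / (2 * (1 + excess w v t)) := by
  rw [phase, div_pow, Real.sq_sqrt (two_mul_one_add_excess_pos hw).le]

lemma one_sub_phase_sq {t : ℝ} (hw : 0 < w t) :
    1 - phase w v t ^ 2 = 4 * (v t / w t) ^ 2 / (2 * (1 + excess w v t)) := by
  rw [phase_sq hw, sq_slope_eq, sub_div, div_self (two_mul_one_add_excess_pos hw).ne']

lemma phase_pos {t : ℝ} (hw : 0 < w t) : 0 < phase w v t :=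
  div_pos hw (Real.sqrt_pos.2 (two_mul_one_add_excess_pos hw))

lemma phase_mem {t : ℝ} (hw : 0 < w t) : phase w v t ∈ Icc (0 : ℝ) 1 := by
  refine ⟨(phase_pos hw).le, ?_⟩
  have h1 : 0 ≤ 1 - phase w v t ^ 2 := by
    rw [one_sub_phase_sq hw]
    exact div_nonneg (by positivity) (two_mul_one_add_excess_pos hw).le
  nlinarith [phase_pos (v := v) hw]

lemma phase_lt_one {t : ℝ} (hw : 0 < w t) (hv : 0 < v t) : phase w v t < 1 := by
  have h1 : 0 < 1 - phase w v t ^ 2 := by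
    rw [one_sub_phase_sq hw]
    exact div_pos (by positivity) (two_mul_one_add_excess_pos hw)
  nlinarith [phase_pos (v := v) hw]

lemma phase_eq_one {t : ℝ} (hw : 0 < w t) (hv : v t = 0) : phase w v t = 1 := by
  have h1 : 1 - phase w v t ^ 2 = 0 := by
    rw [one_sub_phase_sq hw, hv]; simp
  nlinarith [phase_pos (v := v) hw]

/-- Inverts the blow-up: P evaluated in the coordinates σ and k is P along the orbit, which links
the branch equation to the flow. -/
lemma slopePert_phase {t : ℝ} (hw : 0 < w t) (hv : 0 ≤ v t) :
    slopePert P (phase w v t) (excess w v t) = 2 * P (w t) (v t ^ 2) * (v t / w t) := by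
  have hN := two_mul_one_add_excess_pos (v := v) hw
  have hs : √2 * √(1 + excess w v t) = √(2 * (1 + excess w v t)) :=
    (Real.sqrt_mul (by norm_num) _).symm
  have hs0 := Real.sqrt_pos.2 hN
  have e1 : √(2 * (1 + excess w v t)) * phase w v t = w t := by
    unfold phase; field_simp
  have e2 : (1 + excess w v t) ^ 2 * phase w v t ^ 2 * (1 - phase w v t ^ 2) = v t ^ 2 := by
    rw [one_sub_phase_sq hw, phase_sq hw]
    have : 1 + excess w v t ≠ 0 := by linarith
    field_simp
    ring
  have e3 : √(1 - phase w v t ^ 2) = 2 * (v t / w t) / √(2 * (1 + excess w v t)) := by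
    rw [one_sub_phase_sq hw, Real.sqrt_div (by positivity),
      show 4 * (v t / w t) ^ 2 = (2 * (v t / w t)) ^ 2 by ring, Real.sqrt_sq (by positivity)]
  unfold slopePert
  rw [hs, e1, e2, e3]
  field_simp

lemma hasDerivAt_phase (h : IsBoxedHomoclinic P w v) {t : ℝ} (hw : 0 < w t) :
    HasDerivAt (phase w v) (phase w v t * (v t / w t) *
      (1 + 2 * excess w v t - 2 * P (w t) (v t ^ 2) * (v t / w t)) / (1 + excess w v t)) t := by
  have hN := two_mul_one_add_excess_pos (v := v) hw
  have hs0 := Real.sqrt_pos.2 hN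
  have h1 := (((h.hasDerivAt_excess hw).const_add 1).const_mul 2).sqrt hN.ne'
  refine ((h.deriv_w t).div h1 hs0.ne').congr_deriv ?_
  have h2 : √(2 * (1 + excess w v t)) ^ 2 = 2 * (1 + excess w v t) := Real.sq_sqrt hN.le
  have h3 : 1 + excess w v t ≠ 0 := by linarith
  unfold phase
  set s := √(2 * (1 + excess w v t))
  set E := excess w v t
  field_simp
  rw [h2]
  ring

lemma continuous_excess (h : IsBoxedHomoclinic P w v) (hw : ∀ t, 0 < w t) :
    Continuous (excess w v) :=
  continuous_iff_continuousAt.2 fun t => (h.hasDerivAt_excess (hw t)).continuousAt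

lemma continuous_phase (h : IsBoxedHomoclinic P w v) (hw : ∀ t, 0 < w t) :
    Continuous (phase w v) :=
  continuous_iff_continuousAt.2 fun t => (h.hasDerivAt_phase (hw t)).continuousAt

/-- Along an orbit in the upper half plane the weighted distance to a branch decreases. -/
lemma antitoneOn_sq_sub_branch (h : IsBoxedHomoclinic P w v) {η : ℝ} (hP : SmallOnBox η P)
    (hη : η ≤ 1 / 100) {k : ℝ → ℝ} (hk : IsBranch P k) {a b : ℝ}
    (hv : ∀ t ∈ Ioo a b, 0 < v t) (he : ∀ t ∈ Icc a b, |excess w v t| ≤ 1 / 20) :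
    AntitoneOn (fun t => ((excess w v t - k (phase w v t)) * phase w v t) ^ 2) (Icc a b) := by
  have hw := h.w_pos hP hη
  have hc : Continuous fun t => ((excess w v t - k (phase w v t)) * phase w v t) ^ 2 :=
    (((h.continuous_excess hw).sub (hk.cont.comp (h.continuous_phase hw))).mul
      (h.continuous_phase hw)).pow 2
  have hder : ∀ t ∈ Ioo a b, ∃ D ≤ (0 : ℝ), HasDerivAt
      (fun t => ((excess w v t - k (phase w v t)) * phase w v t) ^ 2) D t := by
    intro t ht
    have hwt := hw t
    have hvt := hv t ht
    have het := he t (Ioo_subset_Icc_self ht)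
    have hσ := phase_pos (v := v) hwt
    have hσ' := phase_lt_one hwt hvt
    have hσI : phase w v t ∈ Icc (0 : ℝ) 1 := phase_mem hwt
    have hβ := slopePert_phase (P := P) hwt hvt.le
    have d1 := h.hasDerivAt_excess hwt
    have d2 := h.hasDerivAt_phase hwt
    have d3 := (hk.hasDerivAt hP hη ⟨hσ, hσ'⟩).comp t d2
    have hβ' := abs_slopePert_le_of_le hP hη hσI het
    have hD := branchRate_denom het hβ'
    have hL := abs_branchRate_slopePert_sub_le hP hη hσI het (hk.bound _ hσI)
    rw [hβ] at hβ' hD hL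
    have d4 := ((d1.sub d3).mul d2).pow 2
    refine ⟨_, ?_, d4⟩
    have hq := div_pos hvt hwt
    simp only [Pi.mul_apply, Pi.sub_apply, Function.comp_apply]
    set σ := phase w v t
    set E := excess w v t
    set q := v t / w t
    set β := 2 * P (w t) (v t ^ 2) * q
    set J := branchRate (k σ) (slopePert P σ (k σ))
    have hE1 : 0 < 1 + E := by linarith [(abs_le.1 het).1]
    have hD0 : 0 < 1 + 2 * E - β := by linarith
    have hJ : 2 * (β - E) * (1 + E) = (-2 * E + branchRate E β) * (1 + 2 * E - β) := by
      unfold branchRate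
      field_simp
      ring
    -- Along the orbit σ' = σΛ, so the orbit satisfies the branch equation too, up to the factor Λ >
    -- 0; subtracting the branch gives an equation for the difference E - k(σ).
    have e : (2 * q * (β - E) - (-2 * k σ + J) / σ * (σ * q * (1 + 2 * E - β) / (1 + E)))
        = q * (1 + 2 * E - β) / (1 + E) * (-2 * (E - k σ) + (branchRate E β - J)) := by
      have : 2 * q * (β - E) = q * (2 * (β - E) * (1 + E)) / (1 + E) := by field_simp
      rw [this, hJ]
      field_simp
      ring
    rw [e]
    have hΛ : 0 < q * (1 + 2 * E - β) / (1 + E) := by positivity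
    have hdJ : (E - k σ) * (branchRate E β - J) ≤ (E - k σ) ^ 2 := by
      have h1 := le_abs_self ((E - k σ) * (branchRate E β - J))
      rw [abs_mul] at h1
      have h2 := mul_le_mul_of_nonneg_left hL (abs_nonneg (E - k σ))
      rw [← sq_abs]
      linarith
    have e2 : ∀ Λ B : ℝ, ((2 : ℕ) : ℝ) * ((E - k σ) * σ) ^ (2 - 1) *
        (Λ * (-2 * (E - k σ) + B) * σ + (E - k σ) * (σ * q * (1 + 2 * E - β) / (1 + E)))
        = 2 * σ ^ 2 * ((E - k σ) * Λ * (-2 * (E - k σ) + B)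
          + (E - k σ) ^ 2 * (q * (1 + 2 * E - β) / (1 + E))) := by
      intro Λ B
      push_cast
      ring
    rw [e2]
    set Λ := q * (1 + 2 * E - β) / (1 + E)
    -- The balance is exact: -2 from the linear part, at most +1 from the Lipschitz bound, and +1
    -- from the weight σ.
    have h3 : (E - k σ) * Λ * (-2 * (E - k σ) + (branchRate E β - J)) + (E - k σ) ^ 2 * Λ ≤ 0 := by
      have : (E - k σ) * Λ * (-2 * (E - k σ) + (branchRate E β - J)) + (E - k σ) ^ 2 * Λ
        = Λ * ((E - k σ) * (branchRate E β - J) - (E - k σ) ^ 2) := by ring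
      rw [this]
      exact mul_nonpos_of_nonneg_of_nonpos hΛ.le (by linarith)
    exact mul_nonpos_of_nonneg_of_nonpos (by positivity) h3
  refine antitoneOn_of_deriv_nonpos (convex_Icc a b) hc.continuousOn ?_ ?_
  · rw [interior_Icc]
    intro t ht
    obtain ⟨D, -, hD⟩ := hder t ht
    exact hD.differentiableAt.differentiableWithinAt
  · rw [interior_Icc]
    intro t ht
    obtain ⟨D, hD0, hD⟩ := hder t ht
    rw [hD.deriv]; exact hD0

end IsBoxedHomoclinic

/-! ### A homoclinic orbit forces the branches to meet. -/

namespace IsBoxedHomoclinic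

variable {P : ℝ → ℝ → ℝ} {w v : ℝ → ℝ}

/-- The sign of the derivative of `excess` on the boundary of `[-1/20, 1/20]`. -/
lemma excess_deriv_sign (h : IsBoxedHomoclinic P w v) {η : ℝ} (hP : SmallOnBox η P)
    (hη : η ≤ 1 / 100) {t : ℝ} (hw : 0 < w t) (hv : v t ≠ 0) {s : ℝ} (hs : |s| = 1)
    (he : excess w v t = s / 20) :
    s * (2 * P (w t) (v t ^ 2) * (v t / w t) - excess w v t) < 0 := by
  have hp := h.abs_P_le hP hη t
  have hq := sq_slope_eq w v t
  have hss : s ^ 2 = 1 := by rw [← sq_abs, hs]; norm_num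
  have hs1 := abs_le.1 hs.le
  have hq1 : |v t / w t| ≤ 1 := by
    rw [abs_le]
    have := sq_nonneg (w t)
    constructor <;> nlinarith
  have h1 : |s * (2 * P (w t) (v t ^ 2) * (v t / w t))| ≤ 1 * (2 * (1 / 100) * 1) := by
    rw [abs_mul, abs_mul, abs_mul, abs_two, hs]
    gcongr
  have h2 := le_abs_self (s * (2 * P (w t) (v t ^ 2) * (v t / w t)))
  rw [he, mul_sub]
  nlinarith

/-- A homoclinic orbit follows the branch of the unstable manifold until it first meets the
horizontal axis. -/
lemma exists_top (h : IsBoxedHomoclinic P w v) {η : ℝ} (hP : SmallOnBox η P)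
    (hη : η ≤ 1 / 100) {k : ℝ → ℝ} (hk : IsBranch P k) :
    ∃ T, v T = 0 ∧ excess w v T = k 1 ∧ ∀ t < T, 0 < v t := by
  have hw := h.w_pos hP hη
  obtain ⟨b, hb⟩ := h.eventually_excess_le hP hη
  obtain ⟨c, hbc, hc⟩ : ∃ c, b ≤ c ∧ v c ≤ 0 := by
    by_contra! hcon
    have hmono : MonotoneOn w (Ici b) :=
      monotoneOn_of_hasDerivWithinAt_nonneg (convex_Ici b)
        (fun t _ => (h.deriv_w t).continuousAt.continuousWithinAt)
        (fun t _ => (h.deriv_w t).hasDerivWithinAt)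
        (fun t ht => (hcon t (mem_Ici.1 (interior_subset ht))).le)
    have : w b ≤ 0 := ge_of_tendsto h.w_atTop <| by
      filter_upwards [eventually_ge_atTop b] with t ht using hmono self_mem_Ici ht ht
    linarith [hw b]
  obtain ⟨T, ⟨hbT, -⟩, hT0, hTpos⟩ :=
    exists_first_zero h.continuous_v hbc (hb b le_rfl).1 hc
  have hpos : ∀ t < T, 0 < v t := fun t ht => by
    rcases le_total t b with h1 | h1
    · exact (hb t h1).1
    · exact hTpos t ⟨h1, ht⟩
  -- While v > 0 the strip |k| ≤ 1/20 cannot be left, since on its boundary `excess_deriv_sign`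
  -- points inwards.
  have hE : ∀ t ≤ T, |excess w v t| ≤ 1 / 20 := by
    intro t ht
    rcases le_total t b with h1 | h1
    · exact (hb t h1).2
    · have hb0 := abs_le.1 (hb b le_rfl).2
      have hder := fun t => h.hasDerivAt_excess (hw t)
      have hq : ∀ t ∈ Ico b T, 0 < v t / w t := fun t ht => div_pos (hpos t ht.2) (hw t)
      rw [abs_le']
      constructor
      · refine le_of_deriv_neg_of_eq (b := T) hder hb0.2 (fun x hx he => ?_) t ⟨h1, ht⟩
        have := h.excess_deriv_sign hP hη (hw x) (hpos x hx.2).ne' (s := 1) (by norm_num) he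
        nlinarith [hq x hx]
      · refine le_of_deriv_neg_of_eq (b := T) (fun t => (hder t).neg) (B := 1 / 20)
          (by simp only [Pi.neg_apply]; linarith) (fun x hx he => ?_) t ⟨h1, ht⟩
        simp only [Pi.neg_apply] at he
        have := h.excess_deriv_sign hP hη (hw x) (hpos x hx.2).ne' (s := -1) (by norm_num)
          (by linarith)
        nlinarith [hq x hx]
  have hσT : phase w v T = 1 := phase_eq_one (hw T) hT0
  -- At T the weight is 1, at time a it is at most w(a). Letting a → -∞ forces equality with the
  -- branch.
  have hle : ∀ a ≤ T, (excess w v T - k 1) ^ 2 ≤ w a ^ 2 := by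
    intro a ha
    have hanti := h.antitoneOn_sq_sub_branch hP hη hk (a := a) (b := T)
      (fun t ht => hpos t ht.2) (fun t ht => hE t ht.2)
    have := hanti (left_mem_Icc.2 ha) (right_mem_Icc.2 ha) ha
    simp only [hσT, mul_one] at this
    refine this.trans ?_
    have hσ : phase w v a ∈ Icc (0 : ℝ) 1 := phase_mem (hw a)
    have h1 := abs_le.1 (hE a ha)
    have h2 := abs_le.1 (hk.bound _ hσ)
    have h3 : (excess w v a - k (phase w v a)) ^ 2 ≤ 1 := by nlinarith
    have h4 : phase w v a ^ 2 ≤ w a ^ 2 := by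
      rw [phase_sq (hw a)]
      exact div_le_self (sq_nonneg _) (by linarith)
    rw [mul_pow]
    nlinarith [sq_nonneg (phase w v a)]
  refine ⟨T, hT0, ?_, hpos⟩
  have hlim : Tendsto (fun a => w a ^ 2) atBot (𝓝 0) := by simpa using h.w_atBot.pow 2
  have : (excess w v T - k 1) ^ 2 ≤ 0 := ge_of_tendsto hlim <| by
    filter_upwards [eventually_le_atBot T] with a ha using hle a ha
  nlinarith

lemma excess_reverse (w v : ℝ → ℝ) (t : ℝ) :
    excess (fun t => w (-t)) (fun t => -v (-t)) t = excess w v (-t) := by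
  simp only [excess, neg_div, neg_sq]

/-- The unstable branch cannot end outside the stable one. -/
lemma branch_end_le (h : IsBoxedHomoclinic P w v) {η : ℝ} (hP : SmallOnBox η P)
    (hη : η ≤ 1 / 100) {k k' : ℝ → ℝ} (hk : IsBranch P k)
    (hk' : IsBranch (fun x Z => -P x Z) k') : k 1 ≤ k' 1 := by
  by_contra! hlt
  have hw := h.w_pos hP hη
  have hr := h.reverse
  have h1I : (1 : ℝ) ∈ Icc (0 : ℝ) 1 := by norm_num
  obtain ⟨T, hT0, hTe, hTpos⟩ := h.exists_top hP hη hk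
  obtain ⟨T', hT0', hTe', hTpos'⟩ := hr.exists_top hP.neg hη hk'
  rw [excess_reverse] at hTe'
  have hvneg : ∀ t > -T', v t < 0 := fun t ht => by
    have := hTpos' (-t) (by linarith)
    simp only [neg_neg] at this
    linarith
  -- Equal times would give equal ends, and in the opposite order v would have both signs in
  -- between.
  have hTT' : T < -T' := by
    rcases lt_trichotomy T (-T') with h1 | h1 | h1
    · exact h1
    · rw [← h1] at hTe'; linarith
    · have hm := hvneg ((T + -T') / 2) (by linarith)
      have hm' := hTpos ((T + -T') / 2) (by linarith)
      linarith
  have hderE := fun t => h.hasDerivAt_excess (hw t)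
  have hcE := h.continuous_excess hw
  have hkb := abs_le.1 (hk.bound 1 h1I)
  -- just after `T` the orbit is in the lower half plane
  have hdv : w T * (1 - w T ^ 2) / 2 + P (w T) (v T ^ 2) * v T < 0 := by
    rw [hT0, mul_zero, add_zero]
    have : w T ^ 2 = 2 * (1 + k 1) := by
      have := hTe
      rw [excess, hT0] at this
      linarith [zero_div (w T), sq_nonneg (0 : ℝ), (by simp : (0 / w T) ^ 2 = 0)]
    nlinarith [hw T]
  obtain ⟨r, hr1, hr2⟩ : ∃ r, T < r ∧ r < -T' ∧ ∀ t ∈ Ioc T r, v t < 0 := by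
    obtain ⟨u, hu, hsub⟩ := mem_nhdsGT_iff_exists_Ioo_subset.1
      (eventually_lt_of_hasDerivAt_neg (h.deriv_v T) hdv)
    have hu' : T < u := hu
    refine ⟨(T + min u (-T')) / 2, ?_, ?_, fun t ht => ?_⟩
    · have := lt_min hu' hTT'; linarith
    · have := lt_min hu' hTT'; linarith [min_le_right u (-T')]
    · have := lt_min hu' hTT'
      have h2 : t ∈ Ioo T u := ⟨ht.1, ht.2.trans_lt (by linarith [min_le_left u (-T')])⟩
      have h3 : v t < v T := hsub h2
      rwa [hT0] at h3
  obtain ⟨S, ⟨hrS, -⟩, hS0, hSneg⟩ := exists_first_zero (f := fun t => -v t) h.continuous_v.neg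
    hr2.1.le (by simpa using hr2.2 r ⟨hr1, le_rfl⟩) (b := -T')
    (by linarith)
  have hS0' : v S = 0 := by linarith
  have hvS : ∀ t ∈ Ioo T S, v t < 0 := fun t ht => by
    rcases le_total t r with h2 | h2
    · exact hr2.2 t ⟨ht.1, h2⟩
    · linarith [hSneg t ⟨h2, ht.2⟩]
  have hTS : T < S := hr1.trans hrS
  -- The orbit reaches the axis from below at S, so v'(S) ≥ 0, which on v = 0 means w ≤ 1. Its
  -- `excess` there is far below every branch.
  have hwS : w S ≤ 1 := by
    by_contra! hcon
    have hd : -(w S * (1 - w S ^ 2) / 2 + P (w S) (v S ^ 2) * v S) > 0 := by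
      rw [hS0', mul_zero, add_zero]
      nlinarith [mul_pos (hw S) (show 0 < w S ^ 2 - 1 by nlinarith)]
    have hd' : HasDerivAt (fun t => v (-t))
        (-(w S * (1 - w S ^ 2) / 2 + P (w S) (v S ^ 2) * v S)) (-S) := by
      have h2 : HasDerivAt v (w S * (1 - w S ^ 2) / 2 + P (w S) (v S ^ 2) * v S) (- -S) := by
        rw [neg_neg]; exact h.deriv_v S
      simpa [Function.comp_def] using h2.comp (-S) (hasDerivAt_neg (-S))
    have h3 := eventually_lt_of_hasDerivAt_neg hd'.neg (by linarith)
    obtain ⟨x, hx1, hx2⟩ := (h3.and (Ioo_mem_nhdsGT (show -S < -T by linarith))).exists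
    have h4 := hvS (-x) ⟨by linarith [hx2.2], by linarith [hx2.1]⟩
    simp only [Pi.neg_apply, neg_neg, hS0'] at hx1
    linarith
  have hES : excess w v S ≤ -(1 / 2) := by
    rw [excess, hS0', zero_div]
    nlinarith [hw S]
  -- the excess never exceeds `1/20` between `T` and `S`
  have hup : ∀ t ∈ Icc T S, excess w v t ≤ 1 / 20 := by
    by_contra! hcon
    obtain ⟨t, ht, hte⟩ := hcon
    have := le_of_deriv_neg_of_eq (a := t) (b := S) (fun t => (hderE t).neg) (B := -(1 / 20))
      (by simp only [Pi.neg_apply]; linarith) (fun x hx he => ?_) S ⟨ht.2, le_rfl⟩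
    · simp only [Pi.neg_apply] at this
      linarith
    · simp only [Pi.neg_apply] at he
      have hxT : T < x := by
        refine lt_of_le_of_ne (ht.1.trans hx.1) ?_
        rintro rfl
        have : t = T := le_antisymm hx.1 ht.1
        rw [this] at hte
        linarith
      have hvx := hvS x ⟨hxT, hx.2⟩
      have h2 := h.excess_deriv_sign hP hη (hw x) hvx.ne (s := 1) (by norm_num) (by linarith)
      have h3 : v x / w x < 0 := div_neg_of_neg_of_pos hvx (hw x)
      nlinarith
  obtain ⟨U, ⟨hTU, hUS⟩, hU0, hUpos⟩ := exists_first_zero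
    (f := fun t => excess w v t + 1 / 20) (hcE.add continuous_const) hTS.le
    (by
      have := hk.abs_le hP hη h1I
      have := (abs_le.1 this).1
      simp only [hTe]; linarith) (by linarith)
  have hE : ∀ t ∈ Icc T U, |excess w v t| ≤ 1 / 20 := fun t ht => by
    refine abs_le.2 ⟨?_, hup t ⟨ht.1, ht.2.trans hUS⟩⟩
    rcases ht.2.lt_or_eq with h2 | h2
    · linarith [hUpos t ⟨ht.1, h2⟩]
    · rw [h2]; linarith
  have hphase : ∀ t, phase (fun t => w (-t)) (fun t => -v (-t)) t = phase w v (-t) := fun t => by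
    simp only [phase, excess_reverse]
  have hanti := hr.antitoneOn_sq_sub_branch hP.neg hη hk' (a := -U) (b := -T)
    (fun t ht => by
      have := hvS (-t) ⟨by linarith [ht.2], by linarith [ht.1]⟩
      simpa using this)
    (fun t ht => by
      rw [excess_reverse]
      exact hE (-t) ⟨by linarith [ht.2], by linarith [ht.1]⟩)
  have hσT : phase w v T = 1 := phase_eq_one (hw T) hT0
  -- If the orbit touched the stable branch at t, the reversed-time monotonicity would make the
  -- distance at T vanish as well, against k(1) > k'(1).
  have hne : ∀ t ∈ Icc T U, excess w v t - k' (phase w v t) ≠ 0 := by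
    intro t ht h0
    have := hanti (a := -t) ⟨by linarith [ht.2], by linarith [ht.1]⟩
      (b := -T) ⟨by linarith, le_rfl⟩ (by linarith [ht.1])
    simp only [excess_reverse, hphase, neg_neg, h0, hσT, hTe] at this
    nlinarith
  have hcd : Continuous fun t => excess w v t - k' (phase w v t) :=
    hcE.sub (hk'.cont.comp (h.continuous_phase hw))
  have hdU : 0 < excess w v U - k' (phase w v U) := by
    by_contra! hcon
    obtain ⟨x, hx, hx0, -⟩ := exists_first_zero hcd hTU.le (by simp only [hσT, hTe]; linarith) hcon
    exact hne x ⟨hx.1.le, hx.2⟩ hx0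
  -- By continuity the orbit is still outside the stable branch at U, although its `excess` is -1/20
  -- there and the branch stays above -3η ≥ -3/100.
  have hkU := (abs_le.1 (hk'.abs_le hP.neg hη (phase_mem (v := v) (hw U)))).1
  linarith

/-- For a homoclinic orbit the branches of the stable and unstable manifolds meet. -/
lemma branch_end_eq (h : IsBoxedHomoclinic P w v) {η : ℝ} (hP : SmallOnBox η P)
    (hη : η ≤ 1 / 100) {k k' : ℝ → ℝ} (hk : IsBranch P k)
    (hk' : IsBranch (fun x Z => -P x Z) k') : k 1 = k' 1 :=
  le_antisymm (h.branch_end_le hP hη hk hk')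
    (h.reverse.branch_end_le hP.neg hη hk' (by simpa using hk))

end IsBoxedHomoclinic

/-! ### Construction of the homoclinic orbit from meeting branches. -/

/-- The hyperbolic secant. -/
def sech (x : ℝ) : ℝ := (Real.cosh x)⁻¹

lemma sech_pos (x : ℝ) : 0 < sech x := inv_pos.2 (Real.cosh_pos x)

lemma sech_mem (x : ℝ) : sech x ∈ Icc (0 : ℝ) 1 :=
  ⟨(sech_pos x).le, inv_le_one_of_one_le₀ (Real.one_le_cosh x)⟩

lemma sech_lt_one {x : ℝ} (hx : x ≠ 0) : sech x < 1 :=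
  inv_lt_one_of_one_lt₀ (Real.one_lt_cosh.2 hx)

lemma sech_sq (x : ℝ) : sech x ^ 2 = 1 - Real.tanh x ^ 2 := by
  have := (Real.cosh_pos x).ne'
  rw [Real.tanh_eq_sinh_div_cosh, sech]
  field_simp
  rw [Real.cosh_sq]; ring

lemma hasDerivAt_sech (x : ℝ) : HasDerivAt sech (-Real.tanh x * sech x) x := by
  have := (Real.cosh_pos x).ne'
  refine ((Real.hasDerivAt_cosh x).inv this).congr_deriv ?_
  rw [Real.tanh_eq_sinh_div_cosh, sech]
  field_simp

lemma hasDerivAt_neg_tanh (x : ℝ) :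
    HasDerivAt (fun x => -Real.tanh x) (-(sech x ^ 2)) x := by
  have h0 := (Real.cosh_pos x).ne'
  have h1 : Real.tanh = fun x => Real.sinh x / Real.cosh x :=
    funext fun x => Real.tanh_eq_sinh_div_cosh x
  rw [h1]
  refine (((Real.hasDerivAt_sinh x).div (Real.hasDerivAt_cosh x) h0).neg).congr_deriv ?_
  rw [sech]
  field_simp
  linarith [Real.cosh_sq x]

lemma continuous_sech : Continuous sech :=
  continuous_iff_continuousAt.2 fun x => (hasDerivAt_sech x).continuousAt

lemma continuous_neg_tanh : Continuous fun x => -Real.tanh x :=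
  continuous_iff_continuousAt.2 fun x => (hasDerivAt_neg_tanh x).continuousAt

lemma tendsto_sech_atTop : Tendsto sech atTop (𝓝 0) := by
  refine tendsto_inv_atTop_zero.comp (tendsto_atTop_mono (f := fun x => Real.exp x / 2) ?_ ?_)
  · intro x
    rw [Real.cosh_eq]
    linarith [Real.exp_pos (-x)]
  · exact Real.tendsto_exp_atTop.atTop_div_const (by norm_num)

lemma sech_neg (x : ℝ) : sech (-x) = sech x := by rw [sech, sech, Real.cosh_neg]

lemma tendsto_sech_atBot : Tendsto sech atBot (𝓝 0) := by
  have := tendsto_sech_atTop.comp tendsto_neg_atBot_atTop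
  simpa [Function.comp_def, sech_neg] using this

/-- A branch of the unstable manifold followed by one of the stable manifold. -/
def glue (k k' : ℝ → ℝ) (x : ℝ) : ℝ := if x ≤ 0 then k (sech x) else k' (sech x)

/-- The perturbation term along `glue`. -/
def gluePert (P : ℝ → ℝ → ℝ) (k k' : ℝ → ℝ) (x : ℝ) : ℝ :=
  √2 * √(1 + glue k k' x) * P (√2 * √(1 + glue k k' x) * sech x)
    ((1 + glue k k' x) ^ 2 * sech x ^ 2 * (1 - sech x ^ 2)) * -Real.tanh x

section

variable {P : ℝ → ℝ → ℝ} {η : ℝ} {k k' : ℝ → ℝ}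

lemma sqrt_one_sub_sech_sq (x : ℝ) : √(1 - sech x ^ 2) = |Real.tanh x| := by
  rw [sech_sq, sub_sub_cancel, Real.sqrt_sq_eq_abs]

/-- With σ = sech x one has √(1 - σ²) = |tanh x|. The signed factor -tanh x absorbs both the sign of
v and the change from P to -P, so a single formula covers the two halves. -/
lemma gluePert_of_nonpos {x : ℝ} (hx : x ≤ 0) :
    gluePert P k k' x = slopePert P (sech x) (k (sech x)) := by
  have h : -Real.tanh x = |Real.tanh x| := by
    rw [abs_of_nonpos]
    rw [Real.tanh_eq_sinh_div_cosh]
    exact div_nonpos_of_nonpos_of_nonneg (Real.sinh_nonpos_iff.2 hx) (Real.cosh_pos x).le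
  unfold gluePert slopePert glue
  rw [if_pos hx, sqrt_one_sub_sech_sq, h]

lemma gluePert_of_pos {x : ℝ} (hx : 0 < x) :
    gluePert P k k' x = slopePert (fun w Z => -P w Z) (sech x) (k' (sech x)) := by
  have h : Real.tanh x = |Real.tanh x| := by
    rw [abs_of_nonneg]
    rw [Real.tanh_eq_sinh_div_cosh]
    exact div_nonneg (Real.sinh_nonneg_iff.2 hx.le) (Real.cosh_pos x).le
  unfold gluePert slopePert glue
  rw [if_neg (not_le.2 hx), sqrt_one_sub_sech_sq, ← h]
  ring

lemma abs_glue_le (hP : SmallOnBox η P) (hη : η ≤ 1 / 100) (hk : IsBranch P k)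
    (hk' : IsBranch (fun w Z => -P w Z) k') (x : ℝ) : |glue k k' x| ≤ 3 * η := by
  unfold glue
  split_ifs
  · exact hk.abs_le hP hη (sech_mem x)
  · exact hk'.abs_le hP.neg hη (sech_mem x)

lemma abs_gluePert_le (hP : SmallOnBox η P) (hk : IsBranch P k)
    (hk' : IsBranch (fun w Z => -P w Z) k') (x : ℝ) : |gluePert P k k' x| ≤ 2 * η := by
  rcases le_or_gt x 0 with hx | hx
  · rw [gluePert_of_nonpos hx]; exact hk.abs_slopePert_le hP (sech_mem x)
  · rw [gluePert_of_pos hx]; exact hk'.abs_slopePert_le hP.neg (sech_mem x)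

lemma hasDerivAt_glue_of_ne (hP : SmallOnBox η P) (hη : η ≤ 1 / 100) (hk : IsBranch P k)
    (hk' : IsBranch (fun w Z => -P w Z) k') {x : ℝ} (hx : x ≠ 0) :
    HasDerivAt (glue k k')
      (-Real.tanh x * (-2 * glue k k' x + branchRate (glue k k' x) (gluePert P k k' x))) x := by
  have hσ : sech x ∈ Ioo (0 : ℝ) 1 := ⟨sech_pos x, sech_lt_one hx⟩
  have hσ0 := (sech_pos x).ne'
  rcases lt_or_gt_of_ne hx with h | h
  · have h1 := (hk.hasDerivAt hP hη hσ).comp x (hasDerivAt_sech x)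
    refine (h1.congr_of_eventuallyEq ?_).congr_deriv ?_
    · filter_upwards [Iio_mem_nhds h] with y hy
      exact if_pos (le_of_lt hy)
    · rw [gluePert_of_nonpos h.le, glue, if_pos h.le]
      field_simp
  · have h1 := (hk'.hasDerivAt hP.neg hη hσ).comp x (hasDerivAt_sech x)
    refine (h1.congr_of_eventuallyEq ?_).congr_deriv ?_
    · filter_upwards [Ioi_mem_nhds h] with y hy
      exact if_neg (not_le.2 hy)
    · rw [gluePert_of_pos h, glue, if_neg (not_le.2 h)]
      field_simp

lemma continuous_glue (hk : IsBranch P k)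
    (hk' : IsBranch (fun w Z => -P w Z) k') (hkk : k 1 = k' 1) : Continuous (glue k k') := by
  refine Continuous.if_le (hk.cont.comp continuous_sech) (hk'.cont.comp continuous_sech)
    continuous_id continuous_const fun x hx => ?_
  have hx0 : x = 0 := hx
  subst hx0
  simpa [sech] using hkk

lemma continuous_gluePert (hP : SmallOnBox η P) (hk : IsBranch P k)
    (hk' : IsBranch (fun w Z => -P w Z) k') (hkk : k 1 = k' 1) : Continuous (gluePert P k k') := by
  have h1 := continuous_glue hk hk' hkk
  have h2 := continuous_sech
  have h3 := continuous_neg_tanh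
  have : Continuous fun x => P (√2 * √(1 + glue k k' x) * sech x)
      ((1 + glue k k' x) ^ 2 * sech x ^ 2 * (1 - sech x ^ 2)) :=
    hP.cont.comp (f := fun x => (√2 * √(1 + glue k k' x) * sech x,
      (1 + glue k k' x) ^ 2 * sech x ^ 2 * (1 - sech x ^ 2))) (by fun_prop)
  unfold gluePert
  exact (Continuous.mul (by fun_prop) this).mul h3

lemma glue_denom_ge (hP : SmallOnBox η P) (hη : η ≤ 1 / 100) (hk : IsBranch P k)
    (hk' : IsBranch (fun w Z => -P w Z) k') (x : ℝ) :
    22 / 25 ≤ 1 + 2 * glue k k' x - gluePert P k k' x :=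
  branchRate_denom ((abs_glue_le hP hη hk hk' x).trans (by linarith))
    ((abs_gluePert_le hP hk hk' x).trans (by linarith))

lemma hasDerivAt_glue (hP : SmallOnBox η P) (hη : η ≤ 1 / 100) (hk : IsBranch P k)
    (hk' : IsBranch (fun w Z => -P w Z) k') (hkk : k 1 = k' 1) (x : ℝ) :
    HasDerivAt (glue k k')
      (-Real.tanh x * (-2 * glue k k' x + branchRate (glue k k' x) (gluePert P k k' x))) x := by
  rcases eq_or_ne x 0 with rfl | hx
  · have h1 := continuous_glue hk hk' hkk
    have h2 := continuous_gluePert hP hk hk' hkk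
    have h3 := continuous_neg_tanh
    have h4 : Continuous fun x => branchRate (glue k k' x) (gluePert P k k' x) := by
      unfold branchRate
      refine Continuous.div (by fun_prop) (by fun_prop) fun x => ?_
      linarith [glue_denom_ge hP hη hk hk' x]
    -- At the junction σ = 1 the branch equation is not available; the derivative is the limit of
    -- the derivatives on both sides.
    refine hasDerivAt_of_hasDerivAt_of_ne (g := fun x => -Real.tanh x *
      (-2 * glue k k' x + branchRate (glue k k' x) (gluePert P k k' x)))
      (fun y hy => hasDerivAt_glue_of_ne hP hη hk hk' hy) h1.continuousAt ?_
    exact Continuous.continuousAt (by fun_prop)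
  · exact hasDerivAt_glue_of_ne hP hη hk hk' hx

/-- If the branches meet, then there is a homoclinic orbit close to the unperturbed one. -/
lemma exists_homoclinic (hP : SmallOnBox η P) (hη : η ≤ 1 / 100) (hk : IsBranch P k)
    (hk' : IsBranch (fun w Z => -P w Z) k') (hkk : k 1 = k' 1) :
    ∃ w v : ℝ → ℝ, ∃ X : ℝ → ℝ, Function.Surjective X ∧
      (∀ t, HasDerivAt w (v t) t) ∧
      (∀ t, HasDerivAt v (w t * (1 - w t ^ 2) / 2 + P (w t) (v t ^ 2) * v t) t) ∧
      (∀ t, 0 < w t) ∧ Tendsto w atBot (𝓝 0) ∧ Tendsto w atTop (𝓝 0) ∧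
      Tendsto v atBot (𝓝 0) ∧ Tendsto v atTop (𝓝 0) ∧
      (∀ t, |w t - √2 * sech (X t)| ≤ 3 * η) ∧
      ∀ t, |v t - sech (X t) * -Real.tanh (X t)| ≤ 3 * η := by
  set e := glue k k' with he
  set B := gluePert P k k' with hB
  have hη0 := hP.nonneg
  have hce : Continuous e := continuous_glue hk hk' hkk
  have hcB : Continuous B := continuous_gluePert hP hk hk' hkk
  have heb' : ∀ x, |e x| ≤ 3 * η := abs_glue_le hP hη hk hk'
  have heb : ∀ x, |e x| ≤ 1 / 20 := fun x => (heb' x).trans (by linarith)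
  have hD : ∀ x, 22 / 25 ≤ 1 + 2 * e x - B x := glue_denom_ge hP hη hk hk'
  have hBb : ∀ x, |B x| ≤ 1 / 50 := fun x =>
    (abs_gluePert_le hP hk hk' x).trans (by linarith)
  have he1 : ∀ x, 0 < 1 + e x := fun x => by linarith [(abs_le.1 (heb x)).1]
  -- Λ is dx/dt along the orbit, read off from the derivative of `phase` with σ = sech x.
  let Λ : ℝ → ℝ := fun x => (1 + 2 * e x - B x) / (√2 * √(1 + e x))
  have hs0 : ∀ x, 0 < √2 * √(1 + e x) := fun x =>
    mul_pos (by positivity) (Real.sqrt_pos.2 (he1 x))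
  have hΛ0 : ∀ x, 0 < Λ x := fun x => div_pos (by linarith [hD x]) (hs0 x)
  have hΛ1 : ∀ x, Λ x ≤ 1 := fun x => by
    have h1 : 23 / 20 ≤ √2 * √(1 + e x) := by
      rw [← Real.sqrt_mul (by norm_num)]
      refine Real.le_sqrt_of_sq_le ?_
      linarith [(abs_le.1 (heb x)).1]
    rw [div_le_one (hs0 x)]
    linarith [(abs_le.1 (heb x)).2, (abs_le.1 (hBb x)).1]
  have hcΛ : Continuous Λ := by
    refine Continuous.div (by fun_prop) (by fun_prop) fun x => (hs0 x).ne'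
  have hcΛi : Continuous fun x => (Λ x)⁻¹ := hcΛ.inv₀ fun x => (hΛ0 x).ne'
  let τ : ℝ → ℝ := fun x => ∫ y in (0 : ℝ)..x, (Λ y)⁻¹
  have hτ : ∀ x, HasDerivAt τ (Λ x)⁻¹ x := fun x =>
    (hcΛi.integral_hasStrictDerivAt 0 x).hasDerivAt
  have hτc : Continuous τ := continuous_iff_continuousAt.2 fun x => (hτ x).continuousAt
  have hτm : StrictMono τ := strictMono_of_hasDerivAt_pos hτ fun x => inv_pos.2 (hΛ0 x)
  -- Since Λ ≤ 1, the time τ runs at least as fast as x, so it covers the whole line.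
  have hτi : Monotone fun x => τ x - x :=
    monotone_of_hasDerivAt_nonneg (fun x => (hτ x).sub (hasDerivAt_id x)) fun x =>
      sub_nonneg.2 ((one_le_inv₀ (hΛ0 x)).2 (hΛ1 x))
  have hτ0 : τ 0 = 0 := intervalIntegral.integral_same
  have hτs : Function.Surjective τ := by
    refine hτc.surjective ?_ ?_
    · refine tendsto_atTop_mono' _ ?_ tendsto_id
      filter_upwards [eventually_ge_atTop 0] with x hx
      have := hτi hx
      simp only [hτ0] at this
      simp only [id]; linarith
    · refine tendsto_atBot_mono' _ ?_ tendsto_id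
      filter_upwards [eventually_le_atBot 0] with x hx
      have := hτi hx
      simp only [hτ0] at this
      simp only [id]; linarith
  let iso := hτm.orderIsoOfSurjective τ hτs
  let X : ℝ → ℝ := iso.symm
  have hXτ : ∀ t, τ (X t) = t := fun t => iso.apply_symm_apply t
  have hXc : Continuous X := iso.symm.continuous
  have hX : ∀ t, HasDerivAt X (Λ (X t)) t := fun t => by
    have := HasDerivAt.of_local_left_inverse hXc.continuousAt (hτ (X t))
      (inv_ne_zero (hΛ0 _).ne') (Eventually.of_forall hXτ)
    rwa [inv_inv] at this
  let W : ℝ → ℝ := fun x => √2 * √(1 + e x) * sech x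
  let V : ℝ → ℝ := fun x => (1 + e x) * sech x * -Real.tanh x
  have hde : ∀ x, HasDerivAt e (-Real.tanh x * (-2 * e x + branchRate (e x) (B x))) x :=
    hasDerivAt_glue hP hη hk hk' hkk
  -- This is the branch equation in its original form, before the linear term -2k was split off.
  have hF : ∀ x, -2 * e x + branchRate (e x) (B x)
      = 2 * (1 + e x) * (B x - e x) / (1 + 2 * e x - B x) := fun x => by
    have : 1 + 2 * e x - B x ≠ 0 := by linarith [hD x]
    unfold branchRate
    field_simp
    ring
  have h2 : √2 ^ 2 = 2 := Real.sq_sqrt (by norm_num)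
  have hPB : ∀ x, √2 * √(1 + e x) * P (W x) (V x ^ 2) * -Real.tanh x = B x := fun x => by
    have : V x ^ 2 = (1 + e x) ^ 2 * sech x ^ 2 * (1 - sech x ^ 2) := by
      rw [sech_sq]; simp only [V]; rw [mul_pow, mul_pow, sech_sq]; ring
    rw [this, hB, gluePert]
  have hW : ∀ x, HasDerivAt W (V x * (Λ x)⁻¹) x := fun x => by
    refine ((((hde x).const_add 1).sqrt (he1 x).ne').const_mul √2 |>.mul
      (hasDerivAt_sech x)).congr_deriv ?_
    rw [hF]
    have h1 : √(1 + e x) ^ 2 = 1 + e x := Real.sq_sqrt (he1 x).le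
    have h3 : √(1 + e x) ≠ 0 := (Real.sqrt_pos.2 (he1 x)).ne'
    have h4 : 1 + 2 * e x - B x ≠ 0 := by linarith [hD x]
    have h5 : √2 ≠ 0 := by positivity
    simp only [V, Λ]
    rw [inv_div]
    field_simp
    rw [h1]
    ring
  have hV : ∀ x, HasDerivAt V
      ((W x * (1 - W x ^ 2) / 2 + P (W x) (V x ^ 2) * V x) * (Λ x)⁻¹) x := fun x => by
    refine ((((hde x).const_add 1).mul (hasDerivAt_sech x)).mul
      (hasDerivAt_neg_tanh x)).congr_deriv ?_
    rw [hF]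
    have h1 : √(1 + e x) ^ 2 = 1 + e x := Real.sq_sqrt (he1 x).le
    have h3 : √(1 + e x) ≠ 0 := (Real.sqrt_pos.2 (he1 x)).ne'
    have h4 : 1 + 2 * e x - B x ≠ 0 := by linarith [hD x]
    have h5 : √2 ≠ 0 := by positivity
    have h6 : P (W x) (V x ^ 2) * V x = W x * B x / 2 := by
      rw [← hPB]
      simp only [W, V]
      linear_combination (-(1 / 2) * P (W x) (V x ^ 2) * sech x * -Real.tanh x) *
        (√(1 + e x) ^ 2 * h2 + 2 * h1)
    have h7 : W x ^ 2 = 2 * (1 + e x) * sech x ^ 2 := by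
      simp only [W]; rw [mul_pow, mul_pow, h2, h1]
    have h8 : W x * (Λ x)⁻¹ = 2 * (1 + e x) * sech x / (1 + 2 * e x - B x) := by
      simp only [W, Λ]
      rw [inv_div, ← mul_div_assoc]
      congr 1
      linear_combination sech x * (√(1 + e x) ^ 2 * h2 + 2 * h1)
    have h9 : (W x * (1 - W x ^ 2) / 2 + W x * B x / 2) * (Λ x)⁻¹
        = (W x * (Λ x)⁻¹) * ((1 - W x ^ 2) / 2 + B x / 2) := by ring
    rw [h6, h9, h7, h8, sech_sq]
    simp only [Pi.mul_apply]
    field_simp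
    ring
  have hWle : ∀ x, |W x| ≤ 3 / 2 * sech x := fun x => by
    simp only [W]
    rw [abs_mul, abs_of_pos (sech_pos x), abs_of_pos (hs0 x)]
    exact mul_le_mul_of_nonneg_right (sqrt_two_mul_sqrt_le (heb x)) (sech_pos x).le
  have hVle : ∀ x, |V x| ≤ 3 / 2 * sech x := fun x => by
    simp only [V]
    rw [abs_mul, abs_mul, abs_of_pos (sech_pos x), abs_of_pos (he1 x), abs_neg]
    have := Real.abs_tanh_lt_one x
    have h1 : 1 + e x ≤ 3 / 2 := by linarith [(abs_le.1 (heb x)).2]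
    have h3 : (1 + e x) * sech x ≤ 3 / 2 * sech x :=
      mul_le_mul_of_nonneg_right h1 (sech_pos x).le
    exact (mul_le_of_le_one_right (mul_pos (he1 x) (sech_pos x)).le this.le).trans h3
  have hXt : Tendsto X atTop atTop := iso.symm.tendsto_atTop
  have hXb : Tendsto X atBot atBot := iso.symm.tendsto_atBot
  have hsq : ∀ {l : Filter ℝ} {f : ℝ → ℝ}, (∀ x, |f x| ≤ 3 / 2 * sech x) →
      Tendsto sech l (𝓝 0) → Tendsto f l (𝓝 0) := fun hf hl =>
    squeeze_zero_norm hf (by simpa using hl.const_mul (3 / 2))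
  refine ⟨fun t => W (X t), fun t => V (X t), X, iso.symm.surjective, fun t => ?_, fun t => ?_,
    fun t => mul_pos (hs0 _) (sech_pos _), (hsq hWle tendsto_sech_atBot).comp hXb,
    (hsq hWle tendsto_sech_atTop).comp hXt, (hsq hVle tendsto_sech_atBot).comp hXb,
    (hsq hVle tendsto_sech_atTop).comp hXt, fun t => ?_, fun t => ?_⟩
  · refine ((hW (X t)).comp t (hX t)).congr_deriv ?_
    rw [mul_assoc, inv_mul_cancel₀ (hΛ0 _).ne', mul_one]
  · refine ((hV (X t)).comp t (hX t)).congr_deriv ?_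
    rw [mul_assoc, inv_mul_cancel₀ (hΛ0 _).ne', mul_one]
  · have h1 := abs_sqrt_two_mul_sqrt_sub_le (heb (X t)) (k' := 0) (by norm_num)
    rw [add_zero, Real.sqrt_one, mul_one, sub_zero] at h1
    simp only [W]
    rw [← sub_mul, abs_mul, abs_of_pos (sech_pos _)]
    exact (mul_le_of_le_one_right (abs_nonneg _) (sech_mem _).2).trans (h1.trans (heb' _))
  · have h1 : V (X t) - sech (X t) * -Real.tanh (X t)
        = e (X t) * (sech (X t) * -Real.tanh (X t)) := by simp only [V]; ring
    rw [h1, abs_mul]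
    refine (mul_le_of_le_one_right (abs_nonneg _) ?_).trans (heb' _)
    rw [abs_mul, abs_neg, abs_of_pos (sech_pos _)]
    exact mul_le_one₀ (sech_mem _).2 (abs_nonneg _) (Real.abs_tanh_lt_one _).le

end

/-! ### Evaluation of the Melnikov integral. -/

/-- The moments of `√(1 - u²)` on `[0, 1]`. -/
def sqrtMoment (n : ℕ) : ℝ := ∫ u in (0 : ℝ)..1, u ^ n * √(1 - u ^ 2)

lemma intervalIntegrable_sqrtMoment (n : ℕ) :
    IntervalIntegrable (fun u : ℝ => u ^ n * √(1 - u ^ 2)) MeasureTheory.volume 0 1 :=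
  Continuous.intervalIntegrable (by fun_prop) _ _

lemma hasDerivAt_sqrt_one_sub_sq {u : ℝ} (hu : u ∈ Ioo (0 : ℝ) 1) :
    HasDerivAt (fun u => √(1 - u ^ 2)) (-u / √(1 - u ^ 2)) u := by
  have h0 : 1 - u ^ 2 ≠ 0 := by nlinarith [hu.1, hu.2]
  refine ((((hasDerivAt_id u).pow 2).const_sub 1).sqrt h0).congr_deriv ?_
  simp
  ring

lemma sqrtMoment_zero : sqrtMoment 0 = Real.pi / 4 := by
  have h := intervalIntegral.integral_eq_sub_of_hasDerivAt_of_le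
    (f := fun u : ℝ => (u * √(1 - u ^ 2) + Real.arcsin u) / 2)
    (f' := fun u : ℝ => u ^ 0 * √(1 - u ^ 2)) zero_le_one
    (Continuous.continuousOn (by have := Real.continuous_arcsin; fun_prop))
    (fun u hu => ?_) (intervalIntegrable_sqrtMoment 0)
  · rw [sqrtMoment, h]
    norm_num
    ring
  · have hs : 0 < 1 - u ^ 2 := by nlinarith [hu.1, hu.2]
    have hs0 := (Real.sqrt_pos.2 hs).ne'
    refine ((((hasDerivAt_id u).mul (hasDerivAt_sqrt_one_sub_sq hu)).add
      (Real.hasDerivAt_arcsin (by linarith [hu.1]) (by linarith [hu.2]))).div_const 2).congr_deriv ?_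
    have := Real.sq_sqrt hs.le
    simp only [id]
    field_simp
    linarith

lemma sqrtMoment_one : sqrtMoment 1 = 1 / 3 := by
  have h := intervalIntegral.integral_eq_sub_of_hasDerivAt_of_le
    (f := fun u : ℝ => -((1 - u ^ 2) * √(1 - u ^ 2)) / 3)
    (f' := fun u : ℝ => u ^ 1 * √(1 - u ^ 2)) zero_le_one
    (Continuous.continuousOn (by fun_prop))
    (fun u hu => ?_) (intervalIntegrable_sqrtMoment 1)
  · rw [sqrtMoment, h]
    norm_num
  · have hs : 0 < 1 - u ^ 2 := by nlinarith [hu.1, hu.2]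
    have hs0 := (Real.sqrt_pos.2 hs).ne'
    refine (((((hasDerivAt_id u).pow 2).const_sub 1).mul
      (hasDerivAt_sqrt_one_sub_sq hu)).neg.div_const 3).congr_deriv ?_
    have := Real.sq_sqrt hs.le
    simp
    field_simp
    rw [this]
    ring

/-- Integrate the derivative of u^(n+1)(1 - u²)^(3/2), whose boundary values vanish. -/
lemma sqrtMoment_add_two (n : ℕ) :
    sqrtMoment (n + 2) = (n + 1) / (n + 4) * sqrtMoment n := by
  have h := intervalIntegral.integral_eq_sub_of_hasDerivAt_of_le
    (f := fun u : ℝ => u ^ (n + 1) * ((1 - u ^ 2) * √(1 - u ^ 2)))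
    (f' := fun u : ℝ => (n + 1) * (u ^ n * √(1 - u ^ 2)) - (n + 4) * (u ^ (n + 2) * √(1 - u ^ 2)))
    zero_le_one (Continuous.continuousOn (by fun_prop))
    (fun u hu => ?_) (Continuous.intervalIntegrable (by fun_prop) _ _)
  · rw [intervalIntegral.integral_sub (Continuous.intervalIntegrable (by fun_prop) _ _)
      (Continuous.intervalIntegrable (by fun_prop) _ _), intervalIntegral.integral_const_mul,
      intervalIntegral.integral_const_mul] at h
    norm_num at h
    have h4 : (n : ℝ) + 4 ≠ 0 := by positivity
    rw [sqrtMoment, sqrtMoment]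
    field_simp
    linarith
  · have hs : 0 < 1 - u ^ 2 := by nlinarith [hu.1, hu.2]
    have hs0 := (Real.sqrt_pos.2 hs).ne'
    refine ((hasDerivAt_pow (n + 1) u).mul ((((hasDerivAt_id u).pow 2).const_sub 1).mul
      (hasDerivAt_sqrt_one_sub_sq hu))).congr_deriv ?_
    have := Real.sq_sqrt hs.le
    simp
    field_simp
    rw [this]
    ring

lemma sqrtMoment_values :
    sqrtMoment 1 = 1 / 3 ∧ sqrtMoment 2 = Real.pi / 16 ∧ sqrtMoment 3 = 2 / 15 ∧
      sqrtMoment 4 = Real.pi / 32 ∧ sqrtMoment 5 = 8 / 105 ∧ sqrtMoment 6 = 5 * Real.pi / 256 ∧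
      sqrtMoment 7 = 16 / 315 ∧ sqrtMoment 9 = 128 / 3465 := by
  have h1 := sqrtMoment_one
  have h2 := sqrtMoment_add_two 0
  have h3 := sqrtMoment_add_two 1
  have h4 := sqrtMoment_add_two 2
  have h5 := sqrtMoment_add_two 3
  have h6 := sqrtMoment_add_two 4
  have h7 := sqrtMoment_add_two 5
  have h9 := sqrtMoment_add_two 7
  rw [sqrtMoment_zero] at h2
  norm_num at h2 h3 h4 h5 h6 h7 h9
  rw [h1] at h3
  rw [h2] at h4
  rw [h3] at h5
  rw [h4] at h6
  rw [h5] at h7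
  rw [h7] at h9
  refine ⟨h1, ?_, ?_, ?_, ?_, ?_, ?_, ?_⟩ <;> linarith

/-- The factor of `y` in `Q₂`, in the coordinates `w = 1 - x √b / a`, `Z = (y √b / a)²`. -/
def rescaledPert (a b : ℝ) (e : Coeffs) (w Z : ℝ) : ℝ :=
  e.e3 + e.e7 * (a / √b * (1 - w)) + e.e2 * (a / √b * (1 - w)) ^ 2
    + e.e8 * (a / √b * (1 - w)) ^ 3 + e.e1 * (a / √b * (1 - w)) ^ 4
    + e.e9 * (a / √b * (1 - w)) ^ 5 + e.e5 * (a / √b * (1 - w)) ^ 6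
    + e.e4 * ((a / √b) ^ 2 * Z) + e.e6 * ((a / √b) ^ 2 * Z) ^ 2

lemma Q2_eq (a b : ℝ) (e : Coeffs) (w v : ℝ) :
    Q2 e (a / √b * (1 - w)) (-(a / √b) * v) = -(a / √b) * (rescaledPert a b e w (v ^ 2) * v) := by
  unfold Q2 rescaledPert; ring

lemma H2_eq {a b : ℝ} (ha : a < 0) (hb : 0 < b) (w v : ℝ) :
    a ^ 2 / (8 * b) - H2 a b (a / √b * (1 - w), -(a / √b) * v)
      = -((a / √b) ^ 2 / 4) * (w ^ 4 / 2 - w ^ 2 + 2 * v ^ 2) := by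
  have hs := (Real.sqrt_pos.2 hb).ne'
  have hB : b = √b ^ 2 := (Real.sq_sqrt hb.le).symm
  have ha' := ha.ne
  unfold H2
  simp only
  set B := √b
  rw [hB]
  field_simp
  ring

lemma upperArc_eq {a b : ℝ} (ha : a < 0) (hb : 0 < b) {u : ℝ} (hu : u ∈ Icc (0 : ℝ) 1) :
    upperArc a b (a / √b * (1 - √2 * u)) = -(a / √b) * (u * √(1 - u ^ 2)) := by
  have h := H2_eq ha hb (√2 * u) 0
  have hs : a / √b < 0 := div_neg_of_neg_of_pos ha (Real.sqrt_pos.2 hb)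
  rw [mul_zero] at h
  unfold upperArc
  have h2 : √2 ^ 2 = 2 := Real.sq_sqrt (by norm_num)
  have h4 : √2 ^ 4 = 4 := by rw [show √2 ^ 4 = (√2 ^ 2) ^ 2 by ring, h2]; norm_num
  rw [h, mul_pow, mul_pow, h2, h4, show 2 * (-((a / √b) ^ 2 / 4) *
      (4 * u ^ 4 / 2 - 2 * u ^ 2 + 2 * 0 ^ 2)) = (-(a / √b) * u) ^ 2 * (1 - u ^ 2) by ring,
    Real.sqrt_mul (sq_nonneg _), Real.sqrt_sq (mul_nonneg (by linarith) hu.1)]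
  ring

/-- The substitution x = (a/√b)(1 - √2u) makes u the coordinate σ of the unperturbed loop. -/
lemma melnikov_eq {a b : ℝ} (ha : a < 0) (hb : 0 < b) (e : Coeffs) :
    melnikov a b e = √2 * (a / √b) ^ 2 *
      ∫ u in (0 : ℝ)..1, u * (rescaledPert a b e (√2 * u) (u ^ 2 * (1 - u ^ 2)) * √(1 - u ^ 2)) := by
  have hs : a / √b < 0 := div_neg_of_neg_of_pos ha (Real.sqrt_pos.2 hb)
  have h := intervalIntegral.smul_integral_comp_add_mul (a := 0) (b := 1)
    (fun x => Q2 e x (upperArc a b x)) (-(√2 * (a / √b))) (a / √b)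
  rw [mul_zero, add_zero, mul_one, show a / √b + -(√2 * (a / √b)) = a * (1 - √2) / √b by ring,
    smul_eq_mul] at h
  rw [melnikov, ← h, ← intervalIntegral.integral_const_mul, ← intervalIntegral.integral_const_mul]
  refine intervalIntegral.integral_congr fun u hu => ?_
  rw [uIcc_of_le zero_le_one] at hu
  rw [show a / √b + -(√2 * (a / √b)) * u = a / √b * (1 - √2 * u) by ring, upperArc_eq ha hb hu,
    Q2_eq, mul_pow, Real.sq_sqrt (show 0 ≤ 1 - u ^ 2 by nlinarith [hu.1, hu.2])]
  ring

/-- Identifies the linear displacement of the branch end with the Melnikov integral. -/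
lemma firstOrder_rescaledPert {a b : ℝ} (ha : a < 0) (hb : 0 < b) (e : Coeffs) (ε : ℝ) :
    firstOrder (fun w Z => ε * rescaledPert a b e w Z)
      = ε * (2 / (a / √b) ^ 2 * melnikov a b e) := by
  have hs : a / √b ≠ 0 := (div_neg_of_neg_of_pos ha (Real.sqrt_pos.2 hb)).ne
  rw [melnikov_eq ha hb, firstOrder, show ∀ I : ℝ, ε * (2 / (a / √b) ^ 2 *
    (√2 * (a / √b) ^ 2 * I)) = (ε * 2 * √2) * I from fun I => by
      generalize a / √b = s at hs; field_simp,
    ← intervalIntegral.integral_const_mul]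
  refine intervalIntegral.integral_congr fun u _ => ?_
  simp only [slopePert, add_zero, Real.sqrt_one, mul_one, one_pow, one_mul]
  ring

lemma melnikov_eq_closedForm {a b : ℝ} (ha : a < 0) (hb : 0 < b) (e : Coeffs) :
    melnikov a b e = melnikovClosedForm a b e := by
  have hsB := (Real.sqrt_pos.2 hb).ne'
  have hB : b = √b ^ 2 := (Real.sq_sqrt hb.le).symm
  have h2 : √2 ^ 2 = 2 := Real.sq_sqrt (by norm_num)
  rw [melnikov_eq ha hb]
  set s := a / √b with hs
  -- The coefficients of the powers of u in `rescaledPert` along the loop. No u⁷ occurs, so the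
  -- moment of order 8 is not needed.
  let c : Fin 9 → ℝ := ![e.e3 + e.e7 * s + e.e2 * s ^ 2 + e.e8 * s ^ 3 + e.e1 * s ^ 4
      + e.e9 * s ^ 5 + e.e5 * s ^ 6,
    -√2 * (e.e7 * s + 2 * e.e2 * s ^ 2 + 3 * e.e8 * s ^ 3 + 4 * e.e1 * s ^ 4
      + 5 * e.e9 * s ^ 5 + 6 * e.e5 * s ^ 6),
    2 * (e.e2 * s ^ 2 + 3 * e.e8 * s ^ 3 + 6 * e.e1 * s ^ 4 + 10 * e.e9 * s ^ 5
      + 15 * e.e5 * s ^ 6) + e.e4 * s ^ 2,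
    -√2 * 2 * (e.e8 * s ^ 3 + 4 * e.e1 * s ^ 4 + 10 * e.e9 * s ^ 5 + 20 * e.e5 * s ^ 6),
    4 * (e.e1 * s ^ 4 + 5 * e.e9 * s ^ 5 + 15 * e.e5 * s ^ 6) - e.e4 * s ^ 2 + e.e6 * s ^ 4,
    -√2 * 4 * (e.e9 * s ^ 5 + 6 * e.e5 * s ^ 6),
    8 * e.e5 * s ^ 6 - 2 * e.e6 * s ^ 4,
    0,
    e.e6 * s ^ 4]
  have hint : ∫ u in (0 : ℝ)..1,
      u * (rescaledPert a b e (√2 * u) (u ^ 2 * (1 - u ^ 2)) * √(1 - u ^ 2))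
      = ∑ i, c i * sqrtMoment (i + 1) := by
    simp only [sqrtMoment, ← intervalIntegral.integral_const_mul]
    rw [← intervalIntegral.integral_finsetSum fun i _ =>
      Continuous.intervalIntegrable (by fun_prop) _ _]
    refine intervalIntegral.integral_congr fun u _ => ?_
    simp only [rescaledPert, ← hs]
    have h3 : √2 ^ 3 = 2 * √2 := by rw [pow_succ, h2]
    have h4 : √2 ^ 4 = 4 := by rw [pow_succ, h3]; linarith
    have h5 : √2 ^ 5 = 4 * √2 := by rw [pow_succ, h4]
    have h6 : √2 ^ 6 = 8 := by rw [pow_succ, h5]; linarith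
    simp only [Fin.sum_univ_succ, c]
    simp
    ring_nf
    simp only [h2, h3, h4, h5, h6]
    ring
  obtain ⟨m1, m2, m3, m4, m5, m6, m7, m9⟩ := sqrtMoment_values
  have hsum : ∑ i, c i * sqrtMoment (i + 1) = c 0 * (1 / 3) + c 1 * (Real.pi / 16) + c 2 * (2 / 15)
      + c 3 * (Real.pi / 32) + c 4 * (8 / 105) + c 5 * (5 * Real.pi / 256) + c 6 * (16 / 315)
      + c 8 * (128 / 3465) := by
    rw [← m1, ← m2, ← m3, ← m4, ← m5, ← m6, ← m7, ← m9]
    simp only [Fin.sum_univ_succ, c]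
    simp
    ring
  rw [hint, hsum, show c 0 = e.e3 + e.e7 * s + e.e2 * s ^ 2 + e.e8 * s ^ 3 + e.e1 * s ^ 4
      + e.e9 * s ^ 5 + e.e5 * s ^ 6 from rfl,
    show c 1 = -√2 * (e.e7 * s + 2 * e.e2 * s ^ 2 + 3 * e.e8 * s ^ 3 + 4 * e.e1 * s ^ 4
      + 5 * e.e9 * s ^ 5 + 6 * e.e5 * s ^ 6) from rfl,
    show c 2 = 2 * (e.e2 * s ^ 2 + 3 * e.e8 * s ^ 3 + 6 * e.e1 * s ^ 4 + 10 * e.e9 * s ^ 5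
      + 15 * e.e5 * s ^ 6) + e.e4 * s ^ 2 from rfl,
    show c 3 = -√2 * 2 * (e.e8 * s ^ 3 + 4 * e.e1 * s ^ 4 + 10 * e.e9 * s ^ 5
      + 20 * e.e5 * s ^ 6) from rfl,
    show c 4 = 4 * (e.e1 * s ^ 4 + 5 * e.e9 * s ^ 5 + 15 * e.e5 * s ^ 6) - e.e4 * s ^ 2
      + e.e6 * s ^ 4 from rfl,
    show c 5 = -√2 * 4 * (e.e9 * s ^ 5 + 6 * e.e5 * s ^ 6) from rfl,
    show c 6 = 8 * e.e5 * s ^ 6 - 2 * e.e6 * s ^ 4 from rfl,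
    show c 8 = e.e6 * s ^ 4 from rfl]
  have hclosed : melnikovClosedForm a b e = s ^ 2 / 110880 *
      (32 * √2 * (1155 * e.e3 + 99 * s ^ 2 * (21 * e.e2 + 2 * e.e4) + 32263 * s ^ 6 * e.e5
        + 5 * s ^ 4 * (1551 * e.e1 + 8 * e.e6) + 1155 * s * e.e7 + 3927 * s ^ 3 * e.e8
        + 15675 * s ^ 5 * e.e9) - 3465 * s * (32 * s ^ 3 * e.e1 + 8 * s * e.e2
        + 134 * s ^ 5 * e.e5 + 4 * e.e7 + 16 * s ^ 2 * e.e8 + 65 * s ^ 4 * e.e9) * Real.pi) := by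
    have ha' : a = s * √b := by rw [hs]; field_simp
    unfold melnikovClosedForm
    generalize √b = B at hB ha' hsB
    rw [ha', hB]
    field_simp
  rw [hclosed]
  linear_combination (-s ^ 2 * Real.pi * ((e.e7 * s + 2 * e.e2 * s ^ 2 + 3 * e.e8 * s ^ 3
    + 4 * e.e1 * s ^ 4 + 5 * e.e9 * s ^ 5 + 6 * e.e5 * s ^ 6) / 16
    + 2 * (e.e8 * s ^ 3 + 4 * e.e1 * s ^ 4 + 10 * e.e9 * s ^ 5 + 20 * e.e5 * s ^ 6) / 32
    + 4 * (e.e9 * s ^ 5 + 6 * e.e5 * s ^ 6) * 5 / 256)) * h2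

/-! ### Smallness of the rescaled perturbation. -/

lemma smallOnBox_const (c : ℝ) : SmallOnBox |c| fun _ _ => c where
  cont := continuous_const
  bound _ _ _ _ := le_rfl
  lip w _ Z _ w' _ Z' _ := by rw [sub_self, abs_zero]; positivity

lemma smallOnBox_fst : SmallOnBox 2 fun w _ => w where
  cont := continuous_fst
  bound w hw _ _ := abs_le.2 ⟨by linarith [hw.1], hw.2⟩
  lip w _ Z _ w' _ Z' _ := by linarith [abs_nonneg (w - w'), abs_nonneg (Z - Z')]

lemma smallOnBox_snd : SmallOnBox 1 fun _ Z => Z where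
  cont := continuous_snd
  bound _ _ Z hZ := abs_le.2 ⟨by linarith [hZ.1], hZ.2⟩
  lip w _ Z _ w' _ Z' _ := by linarith [abs_nonneg (w - w'), abs_nonneg (Z - Z')]

lemma exists_smallOnBox_mul {P Q : ℝ → ℝ → ℝ} (h : ∃ C, SmallOnBox C P) (h' : ∃ C, SmallOnBox C Q) :
    ∃ C, SmallOnBox C fun w Z => P w Z * Q w Z := by
  obtain ⟨C, h⟩ := h
  obtain ⟨C', h'⟩ := h'
  exact ⟨_, h.mul h'⟩

lemma exists_smallOnBox_pow {P : ℝ → ℝ → ℝ} (h : ∃ C, SmallOnBox C P) (n : ℕ) :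
    ∃ C, SmallOnBox C fun w Z => P w Z ^ n := by
  induction n with
  | zero => exact ⟨_, by simpa using smallOnBox_const 1⟩
  | succ n ih => simpa only [pow_succ] using exists_smallOnBox_mul ih h

/-- The perturbation is small with its coefficients, and changes with `e₂` proportionally. -/
lemma exists_smallOnBox_rescaledPert (a b : ℝ) : ∃ C > 0,
    (∀ (R : ℝ) (e : Coeffs), e.BoundedBy R → SmallOnBox (C * R) (rescaledPert a b e)) ∧
    ∀ (e : OtherCoeffs) (x y : ℝ), SmallOnBox (C * |x - y|)
      fun w Z => rescaledPert a b ⟨e, x⟩ w Z - rescaledPert a b ⟨e, y⟩ w Z := by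
  have hX : ∃ C, SmallOnBox C fun w _ => a / √b * (1 - w) := by
    have h1 := ((smallOnBox_const 1).add (smallOnBox_fst.const_mul (-1))).const_mul (a / √b)
    have e : (fun w (_ : ℝ) => a / √b * (1 - w)) = fun w _ => a / √b * (1 + -1 * w) := by
      funext w _; ring
    rw [e]
    exact ⟨_, h1⟩
  have hY : ∃ C, SmallOnBox C fun _ Z => (a / √b) ^ 2 * Z := ⟨_, smallOnBox_snd.const_mul _⟩
  obtain ⟨C1, h1⟩ := hX
  obtain ⟨C2, h2⟩ := exists_smallOnBox_pow ⟨C1, h1⟩ 2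
  obtain ⟨C3, h3⟩ := exists_smallOnBox_pow ⟨C1, h1⟩ 3
  obtain ⟨C4, h4⟩ := exists_smallOnBox_pow ⟨C1, h1⟩ 4
  obtain ⟨C5, h5⟩ := exists_smallOnBox_pow ⟨C1, h1⟩ 5
  obtain ⟨C6, h6⟩ := exists_smallOnBox_pow ⟨C1, h1⟩ 6
  obtain ⟨C7, h7⟩ := hY
  obtain ⟨C8, h8⟩ := exists_smallOnBox_pow ⟨C7, h7⟩ 2
  have n1 := h1.nonneg
  have n2 := h2.nonneg
  have n3 := h3.nonneg
  have n4 := h4.nonneg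
  have n5 := h5.nonneg
  have n6 := h6.nonneg
  have n7 := h7.nonneg
  have n8 := h8.nonneg
  refine ⟨1 + C1 + C2 + C3 + C4 + C5 + C6 + C7 + C8, by positivity, ?_, ?_⟩
  · rintro R e ⟨⟨b1, b3, b4, b5, b6, b7, b8, b9⟩, b2⟩
    have h := ((((((((smallOnBox_const e.e3).add (h1.const_mul e.e7)).add
      (h2.const_mul e.e2)).add (h3.const_mul e.e8)).add (h4.const_mul e.e1)).add
      (h5.const_mul e.e9)).add (h6.const_mul e.e5)).add (h7.const_mul e.e4)).add
      (h8.const_mul e.e6)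
    refine SmallOnBox.mono h ?_
    calc _ ≤ R + R * C1 + R * C2 + R * C3 + R * C4 + R * C5 + R * C6 + R * C7 + R * C8 := by gcongr
      _ = _ := by ring
  · intro e x y
    have h := h2.const_mul (x - y)
    have h' : SmallOnBox (|x - y| * C2)
        fun w Z => rescaledPert a b ⟨e, x⟩ w Z - rescaledPert a b ⟨e, y⟩ w Z := by
      convert h using 3
      simp only [rescaledPert]
      ring
    refine h'.mono ?_
    rw [mul_comm]
    exact mul_le_mul_of_nonneg_right (by linarith) (abs_nonneg _)

/-! ### Passage between the original and the rescaled system. -/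

section conjugation

variable {a b : ℝ}

lemma scale_neg (ha : a < 0) (hb : 0 < b) : a / √b < 0 :=
  div_neg_of_neg_of_pos ha (Real.sqrt_pos.2 hb)

lemma field_snd_eq (ha : a < 0) (hb : 0 < b) (e : Coeffs) (ε w v : ℝ) :
    (field a b e ε (a / √b * (1 - w), -(a / √b) * v)).2
      = -(a / √b) * (w * (1 - w ^ 2) / 2 + ε * rescaledPert a b e w (v ^ 2) * v) := by
  have hs := (Real.sqrt_pos.2 hb).ne'
  have hB : b = √b ^ 2 := (Real.sq_sqrt hb.le).symm
  have ha' := ha.ne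
  simp only [field]
  rw [Q2_eq]
  generalize rescaledPert a b e w (v ^ 2) = p
  generalize √b = B at hs hB
  rw [hB]
  field_simp
  ring

lemma point_eq (ha : a < 0) (hb : 0 < b) (p : ℝ × ℝ) :
    ∃ w v, p = (a / √b * (1 - w), -(a / √b) * v) := by
  have hs := (scale_neg ha hb).ne
  refine ⟨1 - p.1 / (a / √b), -(p.2 / (a / √b)), ?_⟩
  ext
  · simp only
    rw [sub_sub_cancel, mul_div_cancel₀ _ hs]
  · simp only
    rw [neg_mul_neg, mul_div_cancel₀ _ hs]

lemma dist_point (w v w' v' : ℝ) :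
    dist ((a / √b * (1 - w), -(a / √b) * v) : ℝ × ℝ) (a / √b * (1 - w'), -(a / √b) * v')
      = |a / √b| * max (|w - w'|) (|v - v'|) := by
  rw [Prod.dist_eq, mul_max_of_nonneg _ _ (abs_nonneg _), Real.dist_eq, Real.dist_eq, ← abs_mul,
    ← abs_mul]
  simp only
  congr 1
  · rw [← abs_neg]; ring_nf
  · rw [← abs_neg]; ring_nf

lemma mem_rightLoop_iff (ha : a < 0) (hb : 0 < b) (w v : ℝ) :
    (a / √b * (1 - w), -(a / √b) * v) ∈ rightLoop a b
      ↔ w ^ 4 / 2 - w ^ 2 + 2 * v ^ 2 = 0 ∧ 0 ≤ w := by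
  have hs := scale_neg ha hb
  have h := H2_eq ha hb w v
  have hs2 : -((a / √b) ^ 2 / 4) ≠ 0 := by
    have := pow_pos (neg_pos.2 hs) 2
    rw [neg_sq] at this
    linarith
  refine and_congr ⟨fun h1 => ?_, fun h1 => ?_⟩ ⟨fun h1 => ?_, fun h1 => ?_⟩
  · rw [h1, sub_self] at h
    exact (mul_eq_zero.1 h.symm).resolve_left hs2
  · rw [h1, mul_zero] at h
    linarith
  · simp only at h1
    nlinarith
  · simp only
    nlinarith

lemma q1_eq (a b : ℝ) : q1 a b = (a / √b * (1 - 0), -(a / √b) * 0) := by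
  simp [q1]

/-- On the loop 0 ≤ w ≤ 3/2 and |v| ≤ 1/2. A distance at most |a/√b|/4 moves w and v by less than
1/4, which stays in the box. -/
lemma isBoxedHomoclinic_of_loop (ha : a < 0) (hb : 0 < b) {e : Coeffs} {ε δ : ℝ}
    (hδ : δ ≤ -(a / √b) / 4) (h : HasHomoclinicLoopNear a b e ε δ (rightLoop a b)) :
    ∃ w v, IsBoxedHomoclinic (fun w Z => ε * rescaledPert a b e w Z) w v := by
  obtain ⟨γ, ⟨hder, hne, hbot, htop⟩, hclose, -⟩ := h
  have hs := scale_neg ha hb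
  choose w v hwv using fun t => point_eq ha hb (γ t)
  have hw : ∀ t, w t = 1 - (γ t).1 / (a / √b) := fun t => by
    rw [hwv t]; simp only
    rw [mul_div_cancel_left₀ _ hs.ne]; ring
  have hv : ∀ t, v t = -((γ t).2 / (a / √b)) := fun t => by
    rw [hwv t]; simp only
    rw [neg_mul, neg_div, mul_div_cancel_left₀ _ hs.ne, neg_neg]
  have hfst : ∀ {l : Filter ℝ}, Tendsto γ l (𝓝 (q1 a b)) → Tendsto w l (𝓝 0) := fun hl => by
    have h1 : Tendsto (fun t => (γ t).1) _ (𝓝 (a / √b)) := (continuous_fst.tendsto _).comp hl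
    have h2 := (h1.div_const (a / √b)).const_sub 1
    rw [div_self hs.ne, sub_self] at h2
    exact h2.congr fun t => (hw t).symm
  have hsnd : ∀ {l : Filter ℝ}, Tendsto γ l (𝓝 (q1 a b)) → Tendsto v l (𝓝 0) := fun hl => by
    have h1 : Tendsto (fun t => (γ t).2) _ (𝓝 0) := (continuous_snd.tendsto _).comp hl
    have h2 := (h1.div_const (a / √b)).neg
    rw [zero_div, neg_zero] at h2
    exact h2.congr fun t => (hv t).symm
  have hbox : ∀ t, w t ∈ Icc (-(1 / 2) : ℝ) 2 ∧ |v t| ≤ 1 := by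
    intro t
    obtain ⟨p, hp, hd⟩ := Metric.mem_thickening_iff.1 (hclose (Or.inr ⟨t, rfl⟩))
    obtain ⟨w', v', rfl⟩ := point_eq ha hb p
    rw [mem_rightLoop_iff ha hb] at hp
    rw [hwv t, dist_point, abs_of_neg hs] at hd
    have hm : max (|w t - w'|) (|v t - v'|) < 1 / 4 := by
      by_contra! hcon
      nlinarith
    obtain ⟨hm1, hm2⟩ := max_lt_iff.1 hm
    obtain ⟨hE, hw'⟩ := hp
    have hw2 : w' ≤ 3 / 2 := by
      by_contra! hcon
      have h2 : 2 < w' ^ 2 := by nlinarith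
      nlinarith [sq_nonneg v', mul_pos (show 0 < w' ^ 2 by linarith) (sub_pos.2 h2)]
    have hv2 : |v'| ≤ 1 / 2 := by
      refine abs_le_of_sq_le_sq' ?_ (by norm_num) |> abs_le.2
      nlinarith [sq_nonneg (w' ^ 2 - 1)]
    have := abs_lt.1 hm1
    have := abs_lt.1 hm2
    have := abs_le.1 hv2
    refine ⟨⟨?_, ?_⟩, abs_le.2 ⟨?_, ?_⟩⟩ <;> linarith
  refine ⟨w, v, fun t => ?_, fun t => ?_, fun t h0 => ?_, hfst hbot, hfst htop, hsnd hbot,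
    hsnd htop, fun t => (hbox t).1, fun t => (hbox t).2⟩
  · have h1 : HasDerivAt (fun t => (γ t).1) (γ t).2 t :=
      (hasFDerivAt_fst (p := γ t)).comp_hasDerivAt t (hder t)
    have h2 := (h1.div_const (a / √b)).const_sub 1
    rw [← hv t] at h2
    exact h2.congr_of_eventuallyEq (Eventually.of_forall hw)
  · have h1 : HasDerivAt (fun t => (γ t).2) (field a b e ε (γ t)).2 t :=
      (hasFDerivAt_snd (p := γ t)).comp_hasDerivAt t (hder t)
    have h2 := (h1.div_const (a / √b)).neg
    refine (h2.congr_of_eventuallyEq (Eventually.of_forall hv)).congr_deriv ?_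
    rw [hwv t, field_snd_eq ha hb, neg_mul, neg_div, neg_neg, mul_div_cancel_left₀ _ hs.ne]
  · refine hne t ?_
    rw [hwv t, h0.1, h0.2, q1_eq]

lemma sech_mem_loop (x : ℝ) : (√2 * sech x) ^ 4 / 2 - (√2 * sech x) ^ 2
    + 2 * (sech x * -Real.tanh x) ^ 2 = 0 ∧ 0 ≤ √2 * sech x := by
  have h2 : √2 ^ 2 = 2 := Real.sq_sqrt (by norm_num)
  refine ⟨?_, mul_nonneg (Real.sqrt_nonneg _) (sech_pos x).le⟩
  have h1 : (√2 * sech x) ^ 2 = 2 * sech x ^ 2 := by rw [mul_pow, h2]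
  rw [show (√2 * sech x) ^ 4 = ((√2 * sech x) ^ 2) ^ 2 by ring, h1,
    show (sech x * -Real.tanh x) ^ 2 = sech x ^ 2 * (1 - (1 - Real.tanh x ^ 2)) by ring,
    ← sech_sq]
  ring

/-- On the loop (√2v/w)² = 1 - w²/2 < 1, so -√2v/w is a hyperbolic tangent. -/
lemma exists_sech_eq {w v : ℝ} (h : w ^ 4 / 2 - w ^ 2 + 2 * v ^ 2 = 0) (hw : 0 < w) :
    ∃ x, w = √2 * sech x ∧ v = sech x * -Real.tanh x := by
  have h2 : √2 ^ 2 = 2 := Real.sq_sqrt (by norm_num)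
  have hs2 : 0 < √2 := by positivity
  have hc : (√2 * v / w) ^ 2 = 1 - w ^ 2 / 2 := by
    rw [div_pow, mul_pow, h2]
    field_simp
    linarith
  have hlt : (√2 * v / w) ^ 2 < 1 := by rw [hc]; nlinarith
  obtain ⟨h1, h3⟩ := abs_lt.1 ((sq_lt_one_iff_abs_lt_one _).1 hlt)
  obtain ⟨x, -, hx⟩ := Real.tanh_surjOn (show -(√2 * v / w) ∈ Ioo (-1 : ℝ) 1 by
    constructor <;> linarith)
  have hx2 : sech x ^ 2 = (w / √2) ^ 2 := by
    rw [sech_sq, hx, neg_sq, hc, div_pow, h2]; ring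
  have hx1 : sech x = w / √2 :=
    (pow_left_inj₀ (sech_pos x).le (by positivity) two_ne_zero).1 hx2
  refine ⟨x, ?_, ?_⟩
  · rw [hx1]; field_simp
  · rw [hx, hx1]; field_simp

lemma hasHomoclinicLoopNear_of_branch (ha : a < 0) (hb : 0 < b) {e : Coeffs} {ε δ η : ℝ}
    {k k' : ℝ → ℝ} (hP : SmallOnBox η fun w Z => ε * rescaledPert a b e w Z) (hη : η ≤ 1 / 100)
    (hδ : |a / √b| * (3 * η) < δ) (hk : IsBranch (fun w Z => ε * rescaledPert a b e w Z) k)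
    (hk' : IsBranch (fun w Z => -(ε * rescaledPert a b e w Z)) k') (hkk : k 1 = k' 1) :
    HasHomoclinicLoopNear a b e ε δ (rightLoop a b) := by
  obtain ⟨w, v, X, hX, hdw, hdv, hw0, hwb, hwt, hvb, hvt, hwX, hvX⟩ :=
    exists_homoclinic hP hη hk hk' hkk
  have hs := scale_neg ha hb
  have hη0 := hP.nonneg
  have hδ0 : 0 < δ := lt_of_le_of_lt (by positivity) hδ
  have hlim : ∀ {l : Filter ℝ}, Tendsto w l (𝓝 0) → Tendsto v l (𝓝 0) →
      Tendsto (fun t => ((a / √b * (1 - w t), -(a / √b) * v t) : ℝ × ℝ)) l (𝓝 (q1 a b)) := by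
    intro l h1 h2
    rw [q1_eq]
    exact ((h1.const_sub 1).const_mul _).prodMk_nhds (h2.const_mul _)
  have hd : ∀ t, dist ((a / √b * (1 - w t), -(a / √b) * v t) : ℝ × ℝ)
      (a / √b * (1 - √2 * sech (X t)), -(a / √b) * (sech (X t) * -Real.tanh (X t))) < δ := by
    intro t
    rw [dist_point]
    refine lt_of_le_of_lt ?_ hδ
    exact mul_le_mul_of_nonneg_left (max_le (hwX t) (hvX t)) (abs_nonneg _)
  refine ⟨fun t => (a / √b * (1 - w t), -(a / √b) * v t), ⟨fun t => ?_, fun t h0 => ?_,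
    hlim hwb hvb, hlim hwt hvt⟩, ?_, ?_⟩
  · have h1 := ((hdw t).const_sub 1).const_mul (a / √b)
    have h2 := (hdv t).const_mul (-(a / √b))
    refine (h1.prodMk h2).congr_deriv ?_
    ext
    · simp [field]
    · simp only
      rw [field_snd_eq ha hb]
  · rw [q1_eq, Prod.mk.injEq] at h0
    have := mul_left_cancel₀ hs.ne h0.1
    linarith [hw0 t]
  · rintro p (rfl | ⟨t, rfl⟩)
    · refine Metric.self_subset_thickening hδ0 _ ?_
      rw [q1_eq, mem_rightLoop_iff ha hb]
      norm_num
    · exact Metric.mem_thickening_iff.2 ⟨_, (mem_rightLoop_iff ha hb _ _).2 (sech_mem_loop _), hd t⟩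
  · intro p hp
    obtain ⟨w', v', rfl⟩ := point_eq ha hb p
    obtain ⟨hE, hw'⟩ := (mem_rightLoop_iff ha hb _ _).1 hp
    rcases hw'.eq_or_lt with h0 | h0
    · subst h0
      have hv' : v' = 0 := by nlinarith
      subst hv'
      exact Metric.self_subset_thickening hδ0 _ (Or.inl (q1_eq a b).symm)
    · obtain ⟨x, rfl, rfl⟩ := exists_sech_eq hE h0
      obtain ⟨t, rfl⟩ := hX x
      refine Metric.mem_thickening_iff.2 ⟨_, Or.inr ⟨t, rfl⟩, ?_⟩
      rw [dist_comm]
      exact hd t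

/-- The end point of the branch for the perturbation `P`. -/
def branchEnd (P : ℝ → ℝ → ℝ) : ℝ :=
  open Classical in if h : ∃ k, IsBranch P k then h.choose 1 else 0

lemma IsBranch.branchEnd_eq {η : ℝ} {P : ℝ → ℝ → ℝ} (h : SmallOnBox η P) (hη : η ≤ 1 / 100)
    {k : ℝ → ℝ} (hk : IsBranch P k) : branchEnd P = k 1 := by
  have hex : ∃ k, IsBranch P k := ⟨k, hk⟩
  unfold branchEnd
  rw [dif_pos hex]
  exact hex.choose_spec.unique h hη hk (by norm_num)

/-- The distance between the unstable and the stable branch. -/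
def splitting (a b : ℝ) (e : Coeffs) (ε : ℝ) : ℝ :=
  branchEnd (fun w Z => ε * rescaledPert a b e w Z)
    - branchEnd (fun w Z => -(ε * rescaledPert a b e w Z))

lemma hasHomoclinicLoopNear_iff (ha : a < 0) (hb : 0 < b) {e : Coeffs} {ε δ η : ℝ}
    (hP : SmallOnBox η fun w Z => ε * rescaledPert a b e w Z) (hη : η ≤ 1 / 100)
    (hδ : |a / √b| * (3 * η) < δ) (hδ' : δ ≤ -(a / √b) / 4) :
    HasHomoclinicLoopNear a b e ε δ (rightLoop a b) ↔ splitting a b e ε = 0 := by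
  obtain ⟨k, hk⟩ := exists_isBranch hP hη
  obtain ⟨k', hk'⟩ := exists_isBranch hP.neg hη
  rw [splitting, hk.branchEnd_eq hP hη, hk'.branchEnd_eq hP.neg hη, sub_eq_zero]
  constructor
  · intro h
    obtain ⟨w, v, hwv⟩ := isBoxedHomoclinic_of_loop ha hb hδ' h
    exact hwv.branch_end_eq hP hη hk hk'
  · exact hasHomoclinicLoopNear_of_branch ha hb hP hη hδ hk hk'

/-- For an even perturbation the point reflection at the saddle is a symmetry. -/
lemma hasHomoclinicLoopNear_leftLoop (ha : a < 0) (hb : 0 < b) {e : Coeffs} {ε δ : ℝ}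
    (heven : ∀ w Z, rescaledPert a b e (-w) Z = rescaledPert a b e w Z)
    (h : HasHomoclinicLoopNear a b e ε δ (rightLoop a b)) :
    HasHomoclinicLoopNear a b e ε δ (leftLoop a b) := by
  obtain ⟨γ, ⟨hder, hne, hbot, htop⟩, hc1, hc2⟩ := h
  have hs := scale_neg ha hb
  let ρ : ℝ × ℝ → ℝ × ℝ := fun p => (2 * (a / √b) - p.1, -p.2)
  have hρρ : ∀ p, ρ (ρ p) = p := fun p => by simp [ρ]
  have hρd : ∀ p q, dist (ρ p) (ρ q) = dist p q := fun p q => by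
    simp only [ρ, Prod.dist_eq, dist_sub_left, dist_neg_neg]
  have hρq : ρ (q1 a b) = q1 a b := by simp [ρ, q1]; ring
  have hρpt : ∀ w v, ρ (a / √b * (1 - w), -(a / √b) * v)
      = (a / √b * (1 - -w), -(a / √b) * -v) := fun w v => by
    simp only [ρ]
    ext
    · simp only; ring
    · simp only; ring
  have hH : ∀ p, H2 a b (ρ p) = H2 a b p := fun p => by
    obtain ⟨w, v, rfl⟩ := point_eq ha hb p
    have h1 := H2_eq ha hb w v
    have h2 := H2_eq ha hb (-w) (-v)
    rw [hρpt]
    rw [neg_sq, neg_sq, show (-w) ^ 4 = w ^ 4 by ring] at h2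
    linarith
  have hL : ∀ p ∈ rightLoop a b, ρ p ∈ leftLoop a b := fun p hp =>
    ⟨(hH p).trans hp.1, by have := hp.2; simp only [ρ]; linarith⟩
  have hR : ∀ p ∈ leftLoop a b, ρ p ∈ rightLoop a b := fun p hp =>
    ⟨(hH p).trans hp.1, by have := hp.2; simp only [ρ]; linarith⟩
  have hcont : Continuous ρ := by simp only [ρ]; fun_prop
  have hlim : ∀ {l : Filter ℝ}, Tendsto γ l (𝓝 (q1 a b)) →
      Tendsto (fun t => ρ (γ t)) l (𝓝 (q1 a b)) := fun hl => by
    have := (hcont.tendsto (q1 a b)).comp hl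
    rwa [hρq] at this
  have hfield : ∀ p, field a b e ε (ρ p) = -field a b e ε p := fun p => by
    obtain ⟨w, v, rfl⟩ := point_eq ha hb p
    have h1 := field_snd_eq ha hb e ε w v
    have h2 := field_snd_eq ha hb e ε (-w) (-v)
    rw [hρpt]
    ext
    · simp [field]
    · rw [Prod.snd_neg, h1, h2, heven, neg_sq, neg_sq]
      ring
  refine ⟨fun t => ρ (γ t), ⟨fun t => ?_, fun t h0 => hne t ?_, hlim hbot, hlim htop⟩, ?_, ?_⟩
  · rw [hfield]
    have h1 : HasDerivAt (fun t => (γ t).1) (field a b e ε (γ t)).1 t :=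
      (hasFDerivAt_fst (p := γ t)).comp_hasDerivAt t (hder t)
    have h2 : HasDerivAt (fun t => (γ t).2) (field a b e ε (γ t)).2 t :=
      (hasFDerivAt_snd (p := γ t)).comp_hasDerivAt t (hder t)
    exact (h1.const_sub (2 * (a / √b))).prodMk h2.neg
  · have h1 : ρ (γ t) = q1 a b := h0
    rw [← hρρ (γ t), h1, hρq]
  · rintro p (rfl | ⟨t, rfl⟩)
    · obtain ⟨z, hz, hd⟩ := Metric.mem_thickening_iff.1 (hc1 (mem_insert _ _))
      refine Metric.mem_thickening_iff.2 ⟨ρ z, hL z hz, ?_⟩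
      rw [← hρq, hρd]; exact hd
    · obtain ⟨z, hz, hd⟩ := Metric.mem_thickening_iff.1 (hc1 (Or.inr ⟨t, rfl⟩))
      refine Metric.mem_thickening_iff.2 ⟨ρ z, hL z hz, ?_⟩
      simp only
      rw [hρd]; exact hd
  · intro p hp
    obtain ⟨z, hz, hd⟩ := Metric.mem_thickening_iff.1 (hc2 (hR p hp))
    refine Metric.mem_thickening_iff.2 ⟨ρ z, ?_, ?_⟩
    · rcases hz with rfl | ⟨t, rfl⟩
      · exact Or.inl hρq
      · exact Or.inr ⟨t, rfl⟩
    · rw [← hρd, hρρ]; exact hd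

/-- Here w is the position in the oscillator divided by that of its right equilibrium, and the
damping factor of the oscillator is even in the position. -/
lemma rescaledPert_canonicalCoeffs_neg (ha : a < 0) (hb : 0 < b) (c1 c2 c3 c4 c5 c6 w Z : ℝ) :
    rescaledPert a b (canonicalCoeffs a b c1 c2 c3 c4 c5 c6) (-w) Z
      = rescaledPert a b (canonicalCoeffs a b c1 c2 c3 c4 c5 c6) w Z := by
  have hs := (Real.sqrt_pos.2 hb).ne'
  have hA := (Real.sqrt_pos.2 (neg_pos.2 ha)).ne'
  have h2 : √2 ≠ 0 := by positivity
  have hB : b = √b ^ 2 := (Real.sq_sqrt hb.le).symm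
  have haA : a = -√(-a) ^ 2 := by rw [Real.sq_sqrt (by linarith)]; ring
  unfold rescaledPert
  simp only [canonicalCoeffs]
  generalize √(-a) = A at hA haA
  generalize √(-2 * a) = A2
  generalize √b = B at hs hB
  subst haA hB
  field_simp
  ring

end conjugation

/-! ### Solving the splitting equation for e₂. -/

/-- The coefficient of `e₂` in the first order displacement of a branch. -/
def slopeConst (a b : ℝ) : ℝ :=
  2 / (a / √b) ^ 2 * (a ^ 2 / (110880 * b ^ 4) * (5544 * a ^ 2 * b ^ 2 * (12 * √2 - 5 * Real.pi)))

section

variable {a b : ℝ}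

lemma twelve_sqrt_two_sub_pos : 0 < 12 * √2 - 5 * Real.pi := by
  have h1 : 1.414 < √2 := Real.lt_sqrt_of_sq_lt (by norm_num)
  have h2 := Real.pi_lt_d2
  norm_num at h1 h2
  linarith

lemma slopeConst_pos (ha : a < 0) (hb : 0 < b) : 0 < slopeConst a b := by
  have h := twelve_sqrt_two_sub_pos
  have hs := (scale_neg ha hb).ne
  have ha' := ha.ne
  unfold slopeConst
  positivity

/-- Exhibits `phiLead` as the root in e₂ of an affine function with nonzero slope. -/
lemma melnikovClosedForm_eq (ha : a < 0) (hb : 0 < b) (e : Coeffs) :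
    melnikovClosedForm a b e
      = a ^ 2 / (110880 * b ^ 4) * (5544 * a ^ 2 * b ^ 2 * (12 * √2 - 5 * Real.pi))
        * (e.e2 - phiLead a b e.toOtherCoeffs) := by
  have h := twelve_sqrt_two_sub_pos.ne'
  have ha' := ha.ne
  have hb' := hb.ne'
  have hφ : 5544 * a ^ 2 * b ^ 2 * (12 * √2 - 5 * Real.pi) * phiLead a b e.toOtherCoeffs
      = -32 * √2 * (1155 * b ^ 3 * e.e3 + 198 * a ^ 2 * b ^ 2 * e.e4
        + 32263 * a ^ 6 * e.e5 + 5 * a ^ 4 * b * (1551 * e.e1 + 8 * e.e6)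
        + 1155 * a * √b ^ 5 * e.e7 + 3927 * a ^ 3 * √b ^ 3 * e.e8 + 15675 * a ^ 5 * √b * e.e9)
      + 3465 * a * (32 * a ^ 3 * b * e.e1 + 134 * a ^ 5 * e.e5
        + 4 * √b ^ 5 * e.e7 + 16 * a ^ 2 * √b ^ 3 * e.e8 + 65 * a ^ 4 * √b * e.e9) * Real.pi := by
    unfold phiLead
    rw [← mul_assoc, mul_one_div_cancel (by positivity), one_mul]
  rw [mul_sub, mul_assoc _ _ (phiLead a b e.toOtherCoeffs), hφ]
  unfold melnikovClosedForm
  ring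

lemma firstOrder_eq (ha : a < 0) (hb : 0 < b) (e : Coeffs) (ε : ℝ) :
    firstOrder (fun w Z => ε * rescaledPert a b e w Z)
      = ε * (slopeConst a b * (e.e2 - phiLead a b e.toOtherCoeffs)) := by
  rw [firstOrder_rescaledPert ha hb, melnikov_eq_closedForm ha hb, melnikovClosedForm_eq ha hb,
    slopeConst]
  ring

lemma firstOrder_sub {η η' : ℝ} {P Q : ℝ → ℝ → ℝ} (hP : SmallOnBox η P) (hQ : SmallOnBox η' Q) :
    firstOrder (fun w Z => P w Z - Q w Z) = firstOrder P - firstOrder Q := by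
  have h1 : Continuous fun u : ℝ => slopePert P u 0 :=
    continuous_slopePert hP.cont continuous_id continuous_const
  have h2 : Continuous fun u : ℝ => slopePert Q u 0 :=
    continuous_slopePert hQ.cont continuous_id continuous_const
  unfold firstOrder
  rw [← intervalIntegral.integral_sub (Continuous.intervalIntegrable (by fun_prop) _ _)
    (Continuous.intervalIntegrable (by fun_prop) _ _)]
  simp only [slopePert_sub]
  refine intervalIntegral.integral_congr fun u _ => ?_
  ring

lemma firstOrder_neg (P : ℝ → ℝ → ℝ) : firstOrder (fun w Z => -P w Z) = -firstOrder P := by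
  unfold firstOrder slopePert
  rw [← intervalIntegral.integral_neg]
  refine intervalIntegral.integral_congr fun u _ => ?_
  ring

/-- Serves two purposes: Q = -P gives the splitting to first order, and two values of e₂ give its
variation in e₂. -/
lemma abs_branchEnd_sub_le {η ν : ℝ} {P Q : ℝ → ℝ → ℝ} (h : SmallOnBox η P)
    (h' : SmallOnBox η Q) (hd : SmallOnBox ν fun w Z => P w Z - Q w Z) (hη : η ≤ 1 / 100) :
    |branchEnd P - branchEnd Q - (firstOrder P - firstOrder Q)| ≤ 200 * η * ν := by
  obtain ⟨k, hk⟩ := exists_isBranch h hη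
  obtain ⟨k', hk'⟩ := exists_isBranch h' hη
  rw [hk.branchEnd_eq h hη, hk'.branchEnd_eq h' hη, ← firstOrder_sub h h']
  exact hk.abs_sub_sub_firstOrder_le h h' hd hη hk'

lemma OtherCoeffs.BoundedBy.mono {e : OtherCoeffs} {R R' : ℝ} (h : e.BoundedBy R) (hR : R ≤ R') :
    e.BoundedBy R' := by
  obtain ⟨h1, h2, h3, h4, h5, h6, h7, h8⟩ := h
  exact ⟨h1.trans hR, h2.trans hR, h3.trans hR, h4.trans hR, h5.trans hR, h6.trans hR,
    h7.trans hR, h8.trans hR⟩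

lemma Coeffs.BoundedBy.mono {e : Coeffs} {R R' : ℝ} (h : e.BoundedBy R) (hR : R ≤ R') :
    e.BoundedBy R' :=
  ⟨h.1.mono hR, h.2.trans hR⟩

/-- The splitting to first order, and its dependence on `e₂`. -/
lemma exists_splitting_estimates (ha : a < 0) (hb : 0 < b) : ∃ C > 0,
    (∀ (R ε : ℝ) (e : Coeffs), e.BoundedBy R →
      SmallOnBox (C * R * |ε|) fun w Z => ε * rescaledPert a b e w Z) ∧
    (∀ (R : ℝ) (e : OtherCoeffs), e.BoundedBy R → |phiLead a b e| ≤ C * R) ∧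
    (∀ (R ε : ℝ) (e : Coeffs), e.BoundedBy R → C * R * |ε| ≤ 1 / 100 →
      |splitting a b e ε - 2 * ε * (slopeConst a b * (e.e2 - phiLead a b e.toOtherCoeffs))|
        ≤ C * R ^ 2 * ε ^ 2) ∧
    ∀ (R ε : ℝ) (e : OtherCoeffs) (x y : ℝ), Coeffs.BoundedBy ⟨e, x⟩ R →
      Coeffs.BoundedBy ⟨e, y⟩ R → C * R * |ε| ≤ 1 / 100 →
      |splitting a b ⟨e, x⟩ ε - splitting a b ⟨e, y⟩ ε - 2 * ε * (slopeConst a b * (x - y))|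
        ≤ C * R * ε ^ 2 * |x - y| := by
  obtain ⟨C, hC, hsm, hdiff⟩ := exists_smallOnBox_rescaledPert a b
  have hκ := slopeConst_pos ha hb
  have hC2 : C ≤ C + 400 * C ^ 2 + 2 * C / slopeConst a b := by
    have : 0 ≤ 400 * C ^ 2 + 2 * C / slopeConst a b := by positivity
    linarith
  have hC3 : 400 * C ^ 2 ≤ C + 400 * C ^ 2 + 2 * C / slopeConst a b := by
    have : 0 ≤ C + 2 * C / slopeConst a b := by positivity
    linarith
  have hR0 : ∀ {R : ℝ} {e : Coeffs}, e.BoundedBy R → 0 ≤ R := fun h =>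
    (abs_nonneg _).trans h.2
  have hsmall : ∀ (R ε : ℝ) (e : Coeffs), e.BoundedBy R →
      SmallOnBox (C * R * |ε|) fun w Z => ε * rescaledPert a b e w Z := fun R ε e he => by
    rw [mul_comm (C * R)]
    exact (hsm R e he).const_mul ε
  refine ⟨C + 400 * C ^ 2 + 2 * C / slopeConst a b, by positivity, fun R ε e he => ?_,
    fun R e he => ?_, fun R ε e he hε => ?_, fun R ε e x y hx hy hε => ?_⟩
  · have := hR0 he
    exact (hsmall R ε e he).mono (by gcongr)
  · have he' : Coeffs.BoundedBy ⟨e, 0⟩ R := ⟨he, by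
      have := (abs_nonneg _).trans he.1
      simpa using this⟩
    have hR := hR0 he'
    -- The bound on `phiLead` is read off from the first order term at ε = 1, e₂ = 0.
    have h1 := abs_firstOrder_le (hsmall R 1 ⟨e, 0⟩ he')
    rw [firstOrder_eq ha hb, one_mul, zero_sub, abs_mul, abs_neg, abs_of_pos hκ, abs_one,
      mul_one] at h1
    have h2 : |phiLead a b e| ≤ 2 * C / slopeConst a b * R := by
      rw [div_mul_eq_mul_div, le_div_iff₀ hκ]
      linarith
    refine h2.trans (mul_le_mul_of_nonneg_right ?_ hR)
    have : 0 ≤ C + 400 * C ^ 2 := by positivity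
    linarith
  · have hR := hR0 he
    have hη : C * R * |ε| ≤ 1 / 100 := le_trans (by gcongr) hε
    have hP := hsmall R ε e he
    have hd : SmallOnBox (2 * (C * R * |ε|)) fun w Z =>
        ε * rescaledPert a b e w Z - -(ε * rescaledPert a b e w Z) := by
      simp only [sub_neg_eq_add]
      rw [two_mul]
      exact hP.add hP
    have h := abs_branchEnd_sub_le hP hP.neg hd hη
    rw [firstOrder_neg, firstOrder_eq ha hb] at h
    rw [splitting, show 2 * ε * (slopeConst a b * (e.e2 - phiLead a b e.toOtherCoeffs))
      = ε * (slopeConst a b * (e.e2 - phiLead a b e.toOtherCoeffs))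
        - -(ε * (slopeConst a b * (e.e2 - phiLead a b e.toOtherCoeffs))) by ring]
    refine h.trans ?_
    calc _ = 400 * C ^ 2 * R ^ 2 * ε ^ 2 := by rw [← sq_abs ε]; ring
      _ ≤ _ := by gcongr
  · have hR := hR0 hx
    have hη : C * R * |ε| ≤ 1 / 100 := le_trans (by gcongr) hε
    have hP := hsmall R ε _ hx
    have hQ := hsmall R ε _ hy
    have hd : SmallOnBox (|ε| * (C * |x - y|)) fun w Z =>
        ε * rescaledPert a b ⟨e, x⟩ w Z - ε * rescaledPert a b ⟨e, y⟩ w Z := by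
      simp only [← mul_sub]
      exact (hdiff e x y).const_mul ε
    have hd' : SmallOnBox (|ε| * (C * |x - y|)) fun w Z =>
        -(ε * rescaledPert a b ⟨e, x⟩ w Z) - -(ε * rescaledPert a b ⟨e, y⟩ w Z) := by
      have := hd.neg
      simp only [neg_sub'] at this
      exact this
    have h1 := abs_branchEnd_sub_le hP hQ hd hη
    have h2 := abs_branchEnd_sub_le hP.neg hQ.neg hd' hη
    rw [firstOrder_neg, firstOrder_neg] at h2
    rw [firstOrder_eq ha hb, firstOrder_eq ha hb] at h1 h2
    simp only at h1 h2
    have h3 := (abs_sub _ _).trans (add_le_add h1 h2)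
    have hle : 200 * (C * R * |ε|) * (|ε| * (C * |x - y|))
          + 200 * (C * R * |ε|) * (|ε| * (C * |x - y|))
        ≤ (C + 400 * C ^ 2 + 2 * C / slopeConst a b) * R * ε ^ 2 * |x - y| := by
      calc _ = 400 * C ^ 2 * R * ε ^ 2 * |x - y| := by rw [← sq_abs ε]; ring
        _ ≤ _ := by gcongr
    refine le_trans (le_of_eq ?_) (h3.trans hle)
    unfold splitting
    congr 1
    ring

open Classical in
/-- The value of `e₂` for which the loop persists. -/
def phi (a b : ℝ) (e : OtherCoeffs) (ε : ℝ) : ℝ :=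
  if h : ε ≠ 0 ∧ ∃ x, |x - phiLead a b e| ≤ 1 ∧ splitting a b ⟨e, x⟩ ε = 0 then h.2.choose
  else phiLead a b e

/-- The zeros of the splitting. -/
lemma exists_phi_estimates (ha : a < 0) (hb : 0 < b) {R : ℝ} (hR : 0 < R) :
    ∃ K ε₁ : ℝ, 0 < K ∧ 0 < ε₁ ∧ ∀ ε, |ε| < ε₁ →
      (∀ e : OtherCoeffs, e.BoundedBy R → |phi a b e ε - phiLead a b e| ≤ K * |ε|) ∧
      (∀ e : Coeffs, e.BoundedBy R → SmallOnBox (K * |ε|) fun w Z => ε * rescaledPert a b e w Z) ∧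
      (ε ≠ 0 → ∀ e : Coeffs, e.BoundedBy R →
        (splitting a b e ε = 0 ↔ e.e2 = phi a b e.toOtherCoeffs ε)) := by
  obtain ⟨C, hC, hsm, hφ, hA, hB⟩ := exists_splitting_estimates ha hb
  have hκ := slopeConst_pos ha hb
  set κ := slopeConst a b with hκd
  -- R' bounds every e₂ within distance 1 of `phiLead`, as |`phiLead`| ≤ CR.
  set R' := R + C * R + 1 with hR'
  have hR'0 : 0 < R' := by positivity
  have hRR' : R ≤ R' := by rw [hR']; have := mul_pos hC hR; linarith
  -- The first summand makes the O(ε²) error at most κK|ε|² in the sign comparison, the second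
  -- bounds the perturbation.
  set K := C * R' ^ 2 / κ + C * R with hK
  have hK0 : 0 < K := by positivity
  refine ⟨K, min (1 / K) (min (1 / (100 * (C * R'))) (κ / (C * R'))), hK0, by positivity,
    fun ε hε => ?_⟩
  have hε1 : K * |ε| ≤ 1 := by
    have := (hε.trans_le (min_le_left _ _)).le
    rwa [le_div_iff₀ hK0, mul_comm] at this
  have hε2 : C * R' * |ε| ≤ 1 / 100 := by
    have := (hε.trans_le ((min_le_right _ _).trans (min_le_left _ _))).le
    rw [le_div_iff₀ (by positivity)] at this
    linarith
  have hε3 : C * R' * |ε| < κ := by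
    have := hε.trans_le ((min_le_right _ _).trans (min_le_right _ _))
    rw [lt_div_iff₀ (by positivity)] at this
    linarith
  have hbd : ∀ {e : OtherCoeffs}, e.BoundedBy R → ∀ {x : ℝ}, |x - phiLead a b e| ≤ 1 →
      Coeffs.BoundedBy ⟨e, x⟩ R' := fun {e} he {x} hx => by
    refine ⟨he.mono hRR', ?_⟩
    have h1 := hφ R e he
    have h2 := abs_add_le (x - phiLead a b e) (phiLead a b e)
    rw [sub_add_cancel] at h2
    simp only
    linarith
  have huniq : ε ≠ 0 → ∀ (e : OtherCoeffs) (x y : ℝ), Coeffs.BoundedBy ⟨e, x⟩ R' →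
      Coeffs.BoundedBy ⟨e, y⟩ R' → splitting a b ⟨e, x⟩ ε = 0 → splitting a b ⟨e, y⟩ ε = 0 →
      x = y := by
    intro h0 e x y hx hy hx0 hy0
    -- Two zeros x ≠ y would give 2κ ≤ CR'|ε|, excluded by the choice of ε₁.
    by_contra hne
    have h := hB R' ε e x y hx hy hε2
    have hxy : 0 < |x - y| := abs_pos.2 (sub_ne_zero.2 hne)
    have hε0 : 0 < |ε| := abs_pos.2 h0
    rw [hx0, hy0, sub_zero, zero_sub, abs_neg, abs_mul, abs_mul, abs_mul, abs_two,
      abs_of_pos hκ, ← sq_abs ε] at h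
    have h1 : C * R' * |ε| ^ 2 * |x - y| = (C * R' * |ε|) * (|ε| * |x - y|) := by ring
    have h2 : 2 * |ε| * (κ * |x - y|) = (2 * κ) * (|ε| * |x - y|) := by ring
    rw [h1, h2] at h
    have := le_of_mul_le_mul_right h (by positivity)
    linarith
  have hex : ε ≠ 0 → ∀ e : OtherCoeffs, e.BoundedBy R →
      ∃ x, |x - phiLead a b e| ≤ K * |ε| ∧ splitting a b ⟨e, x⟩ ε = 0 := by
    intro h0 e he
    have hε0 : 0 < |ε| := abs_pos.2 h0
    set x₀ := phiLead a b e with hx₀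
    set m := K * |ε| with hm
    have hm0 : 0 < m := by positivity
    have hIcc : ∀ x ∈ Icc (x₀ - m) (x₀ + m), |x - x₀| ≤ m := fun x hx =>
      abs_le.2 ⟨by linarith [hx.1], by linarith [hx.2]⟩
    have hbd' : ∀ x ∈ Icc (x₀ - m) (x₀ + m), Coeffs.BoundedBy ⟨e, x⟩ R' := fun x hx =>
      hbd he ((hIcc x hx).trans hε1)
    have hcont : ContinuousOn (fun x => splitting a b ⟨e, x⟩ ε / ε) (Icc (x₀ - m) (x₀ + m)) := by
      refine ContinuousOn.div_const ?_ ε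
      refine (LipschitzOnWith.of_dist_le_mul
        (K := (C * R' * ε ^ 2 + 2 * |ε| * κ).toNNReal) fun x hx y hy => ?_).continuousOn
      have h := hB R' ε e x y (hbd' x hx) (hbd' y hy) hε2
      rw [Real.dist_eq, Real.dist_eq]
      have h2 := abs_add_le (splitting a b ⟨e, x⟩ ε - splitting a b ⟨e, y⟩ ε
        - 2 * ε * (κ * (x - y))) (2 * ε * (κ * (x - y)))
      rw [sub_add_cancel, abs_mul, abs_mul, abs_mul, abs_two, abs_of_pos hκ] at h2
      rw [Real.coe_toNNReal _ (by positivity)]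
      linarith
    -- At distance m from `phiLead` the main term has size 2κm, so an error of at most κm leaves
    -- opposite signs at the two ends.
    have hlead : ∀ x ∈ Icc (x₀ - m) (x₀ + m),
        |splitting a b ⟨e, x⟩ ε / ε - 2 * κ * (x - x₀)| ≤ κ * m := by
      intro x hx
      have h := hA R' ε ⟨e, x⟩ (hbd' x hx) hε2
      simp only at h
      have h1 : splitting a b ⟨e, x⟩ ε / ε - 2 * κ * (x - x₀)
          = (splitting a b ⟨e, x⟩ ε - 2 * ε * (κ * (x - x₀))) / ε := by
        field_simp
      rw [h1, abs_div, div_le_iff₀ hε0]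
      refine h.trans ?_
      have h2 : κ * m * |ε| = C * R' ^ 2 * ε ^ 2 + κ * (C * R) * ε ^ 2 := by
        rw [hm, hK, ← sq_abs ε]; field_simp
      rw [h2]
      have : 0 ≤ κ * (C * R) * ε ^ 2 := by positivity
      linarith
    have hl := hlead (x₀ - m) ⟨le_rfl, by linarith⟩
    have hr := hlead (x₀ + m) ⟨by linarith, le_rfl⟩
    have hκm := mul_pos hκ hm0
    have hl' := (abs_le.1 hl).2
    have hr' := (abs_le.1 hr).1
    obtain ⟨x, hx, hx0⟩ := intermediate_value_Icc (by linarith) hcont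
      (show (0 : ℝ) ∈ Icc _ _ from ⟨by nlinarith, by nlinarith⟩)
    exact ⟨x, hIcc x hx, (div_eq_zero_iff.1 hx0).resolve_right h0⟩
  have hphi : ε ≠ 0 → ∀ e : OtherCoeffs, e.BoundedBy R →
      |phi a b e ε - phiLead a b e| ≤ K * |ε| ∧ splitting a b ⟨e, phi a b e ε⟩ ε = 0 := by
    intro h0 e he
    obtain ⟨x, hx, hx0⟩ := hex h0 e he
    -- The search window of radius 1 in `phi` does not depend on R, so one function serves every R;
    -- uniqueness identifies the chosen zero with the one at distance at most K|ε|.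
    have hcond : ε ≠ 0 ∧ ∃ x, |x - phiLead a b e| ≤ 1 ∧ splitting a b ⟨e, x⟩ ε = 0 :=
      ⟨h0, x, hx.trans hε1, hx0⟩
    have hval : phi a b e ε = hcond.2.choose := by
      unfold phi; rw [dif_pos hcond]
    obtain ⟨h1, h2⟩ := hcond.2.choose_spec
    rw [← hval] at h1 h2
    have := huniq h0 e _ x (hbd he h1) (hbd he (hx.trans hε1)) h2 hx0
    rw [this]
    exact ⟨hx, hx0⟩
  refine ⟨fun e he => ?_, fun e he => ?_, fun h0 e he => ⟨fun h => ?_, fun h => ?_⟩⟩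
  · rcases eq_or_ne ε 0 with rfl | h0
    · have : phi a b e 0 = phiLead a b e := by
        unfold phi; rw [dif_neg (by simp)]
      rw [this]
      simp
    · exact (hphi h0 e he).1
  · refine (hsm R ε e he).mono ?_
    have : 0 ≤ C * R' ^ 2 / κ := by positivity
    exact mul_le_mul_of_nonneg_right (by linarith) (abs_nonneg _)
  · obtain ⟨h1, h2⟩ := hphi h0 e.toOtherCoeffs he.1
    exact huniq h0 e.toOtherCoeffs _ _ (he.mono hRR') (hbd he.1 (h1.trans hε1)) h h2
  · obtain ⟨h1, h2⟩ := hphi h0 e.toOtherCoeffs he.1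
    rw [← h] at h2
    exact h2

end

end RayleighLienard

end

theorem mainTheorem9 (a b : ℝ) (ha : a < 0) (hb : 0 < b) :
    (∀ e : RayleighLienard.Coeffs,
      RayleighLienard.melnikov a b e = RayleighLienard.melnikovClosedForm a b e) ∧
    ∃ φ : RayleighLienard.OtherCoeffs → ℝ → ℝ, ∃ δ₀ : ℝ, 0 < δ₀ ∧ ∀ R : ℝ, 0 < R →
      (∃ C ε₁ : ℝ, 0 < ε₁ ∧ ∀ ε : ℝ, |ε| < ε₁ →
        ∀ e : RayleighLienard.OtherCoeffs, e.BoundedBy R →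
          |φ e ε - RayleighLienard.phiLead a b e| ≤ C * |ε|) ∧
      (∀ δ : ℝ, 0 < δ → δ ≤ δ₀ → ∃ ε₀ : ℝ, 0 < ε₀ ∧
        ∀ ε : ℝ, ε ≠ 0 → |ε| < ε₀ → ∀ e : RayleighLienard.Coeffs, e.BoundedBy R →
          (RayleighLienard.HasHomoclinicLoopNear a b e ε δ (RayleighLienard.rightLoop a b) ↔
            e.e2 = φ e.toOtherCoeffs ε) ∧
          (∀ c1 c2 c3 c4 c5 c6 : ℝ,
            e = RayleighLienard.canonicalCoeffs a b c1 c2 c3 c4 c5 c6 →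
            ((RayleighLienard.HasHomoclinicLoopNear a b e ε δ (RayleighLienard.leftLoop a b) ∧
              RayleighLienard.HasHomoclinicLoopNear a b e ε δ (RayleighLienard.rightLoop a b)) ↔
              e.e2 = φ e.toOtherCoeffs ε))) := by
  have hs := RayleighLienard.scale_neg ha hb
  refine ⟨RayleighLienard.melnikov_eq_closedForm ha hb, RayleighLienard.phi a b, -(a / √b) / 4,
    by linarith, fun R hR => ?_⟩
  obtain ⟨K, ε₁, hK, hε₁, h⟩ := RayleighLienard.exists_phi_estimates ha hb hR
  refine ⟨⟨K, ε₁, hε₁, fun ε hε => (h ε hε).1⟩, fun δ hδ hδ₀ => ?_⟩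
  have hs' : 0 < |a / √b| := abs_pos.2 hs.ne
  -- The second bound gives K|ε| ≤ 1/100; the third keeps the constructed loop, at distance at most
  -- 3K|ε||a/√b|, within δ.
  refine ⟨min ε₁ (min (1 / (100 * K)) (δ / (3 * K * |a / √b|))), by positivity,
    fun ε h0 hε e he => ?_⟩
  obtain ⟨-, hsm, hiff⟩ := h ε (hε.trans_le (min_le_left _ _))
  have hη : K * |ε| ≤ 1 / 100 := by
    have := (hε.trans_le ((min_le_right _ _).trans (min_le_left _ _))).le
    rw [le_div_iff₀ (by positivity)] at this
    linarith
  have hηδ : |a / √b| * (3 * (K * |ε|)) < δ := by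
    have := hε.trans_le ((min_le_right _ _).trans (min_le_right _ _))
    rw [lt_div_iff₀ (by positivity)] at this
    linarith
  have hright := (RayleighLienard.hasHomoclinicLoopNear_iff ha hb (hsm e he) hη hηδ hδ₀).trans
    (hiff h0 e he)
  refine ⟨hright, fun c1 c2 c3 c4 c5 c6 hc => ⟨fun h => hright.1 h.2, fun h => ?_⟩⟩
  have hloop := hright.2 h
  refine ⟨RayleighLienard.hasHomoclinicLoopNear_leftLoop ha hb (fun w Z => ?_) hloop, hloop⟩
  rw [hc]
  exact RayleighLienard.rescaledPert_canonicalCoeffs_neg ha hb c1 c2 c3 c4 c5 c6 w Z
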